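/- Let $\mathbb H$ be the upper half-plane, $\tau=x+iy\in\mathbb H$, $q=e^{2\pi i\tau}$, $q^{x}=e^{2\pi i x\tau}$, $\zeta_n=e^{2\pi i/n}$, $(q)_\infty=\prod_{n\ge1}(1-q^n)$, and let $\eta(\tau)=q^{1/24}(q)_\infty$ be the Dedekind eta function. Define Ramanujan's seventh-order mock theta functions through Hickerson's double sums $$(q)_\infty\mathcal F_0(q)=\Bigl(\sum_{r,s\ge0}-\sum_{r,s<0}\Bigr)(-1)^{r+s}q^{\frac32r^2+4rs+\frac32s^2+\frac12r+\frac12s},$$ $$(q)_\infty\mathcal F_1(q)=\Bigl(\sum_{r,s\ge0}-\sum_{r,s<0}\Bigr)(-1)^{r+s}q^{\frac32r^2+4rs+\frac32s^2+\frac52r+\frac52s+1},$$ $$(q)_\infty\mathcal F_2(q)=\Bigl(\sum_{r,s\ge0}-\sum_{r,s<0}\Bigr)(-1)^{r+s}q^{\frac32r^2+4rs+\frac32s^2+\frac32r+\frac32s}.$$ Let $A=\begin{pmatrix}3&4\\4&3\end{pmatrix}$, $B(x,y)=\langle x,Ay\rangle$ and $Q(x)=\frac12B(x,x)$ on $\mathbb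 R^2$, $c_1=\binom{-3}{4}$, $c_2=\binom{-4}{3}$ (so $Q(c_1)=Q(c_2)=-\frac{21}2$), $e=\binom11$. For $a,b\in\mathbb R^2$ put $$\theta_{a,b}(\tau)=\sum_{\nu\in a+\mathbb Z^2}\Bigl\{E\Bigl(\tfrac{B(c_1,\nu)}{\sqrt{-Q(c_1)}}y^{1/2}\Bigr)-E\Bigl(\tfrac{B(c_2,\nu)}{\sqrt{-Q(c_2)}}y^{1/2}\Bigr)\Bigr\}e^{2\pi iQ(\nu)\tau+2\pi iB(\nu,b)},\qquad E(z)=2\int_0^ze^{-\pi u^2}\,du.$$ For $a,b\in\mathbb R$ put $$R_{a,b}(\tau)=\sum_{\nu\in a+\mathbb Z}\operatorname{sign}(\nu)\,\beta(2\nu^2y)\,e^{-\pi i\nu^2\tau-2\pi i\nu b},\qquad \beta(x)=\int_x^\infty u^{-1/2}e^{-\pi u}\,du .$$ Define $$F_7(\tau)=\begin{pmatrix}q^{-1/168}\mathcal F_0(q)\\q^{47/168}\mathcal F_2(q)\\q^{-25/168}\mathcal F_1(q)\end{pmatrix},\qquad H_7(\tau)=\frac{\zeta_{14}^{-1}}{2\eta(\tau)}\begin{pmatrix}\theta_{\frac1{14}e,\frac1{14}e}(\tau)\\\theta_{\frac3{14}e,\frac5{14}e}(\tau)\\\theta_{\frac5{14}e,\frac3{14}e}(\tau)\end{pmatrix},$$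 $$G_7(\tau)=-\begin{pmatrix}\zeta_{84}^{-13}R_{\frac{13}{42},-\frac12}(21\tau)+\zeta_{84}R_{\frac{41}{42},-\frac12}(21\tau)\\\zeta_{84}^{29}R_{\frac{11}{42},-\frac52}(21\tau)+\zeta_{84}^{-41}R_{\frac{25}{42},-\frac52}(21\tau)\\\zeta_{28}^{5}R_{\frac{23}{42},-\frac32}(21\tau)+\zeta_{28}^{-9}R_{\frac{37}{42},-\frac32}(21\tau)\end{pmatrix}.$$ Proposition. For every $\tau\in\mathbb H$ the three double sums, the series $\theta_{a,b}(\tau)$ ($a,b\in\mathbb R^2$) and the series $R_{a,b}(\tau)$ ($a,b\in\mathbb R$) converge absolutely, and $$F_7=H_7+G_7\quad\text{on }\mathbb H,$$ where: (1) $H_7$ is a vector-valued real-analytic modular form of weight $\frac12$: it is real-analytic on $\mathbb H$, and for every $\gamma=\begin{pmatrix}a&b\\c&d\end{pmatrix}\in SL_2(\mathbb Z)$ there is a constant matrix $M_\gamma\in GL_3(\mathbb C)$ with $H_7\bigl(\frac{a\tau+b}{c\tau+d}\bigr)=(c\tau+d)^{1/2}M_\gamma H_7(\tau)$ for all $\tau\in\mathbb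 H$ (principal branch). Explicitly, $$H_7(\tau+1)=\begin{pmatrix}\zeta_{168}^{-1}&0&0\\0&\zeta_{168}^{47}&0\\0&0&\zeta_{168}^{-25}\end{pmatrix}H_7(\tau),$$ $$H_7\Bigl(-\frac1\tau\Bigr)=\sqrt{-i\tau}\,\frac2{\sqrt7}\begin{pmatrix}\sin\frac\pi7&\sin\frac{3\pi}7&\sin\frac{2\pi}7\\\sin\frac{3\pi}7&-\sin\frac{2\pi}7&\sin\frac\pi7\\\sin\frac{2\pi}7&\sin\frac\pi7&-\sin\frac{3\pi}7\end{pmatrix}H_7(\tau).$$ Moreover $H_7$ is an eigenfunction (in particular not identically zero) of the weight $\frac12$ Casimir operator $$\Omega_{\frac12}=-4y^2\frac{\partial^2}{\partial\tau\,\partial\overline\tau}+iy\frac{\partial}{\partial\overline\tau}+\frac3{16},$$ acting on each component, with eigenvalue $\frac3{16}$. (2) For every $\xi\in\mathbb Q$, $G_7(\xi+it)$ is bounded as $t\downarrow0$. -/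

import Mathlib

namespace MockTheta

noncomputable section

open Complex

/-- The root of unity `ζ_n = e^{2πi/n}`. -/
def zeta (n : ℕ) : ℂ := exp (2 * Real.pi * I / n)

/-- The power `q^x = e^{2πixτ}` of `q = e^{2πiτ}`, for real `x`. -/
def qPow (x : ℝ) (τ : ℂ) : ℂ := exp (2 * Real.pi * I * x * τ)

/-! ### The seventh order mock theta functions -/

/-- The coefficient of the operator `∑_{r,s ≥ 0} - ∑_{r,s < 0}`. -/
def quadrantSign (r s : ℤ) : ℂ :=
  if 0 ≤ r ∧ 0 ≤ s then 1 else if r < 0 ∧ s < 0 then -1 else 0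

/-- The terms of
`(∑_{r,s ≥ 0} - ∑_{r,s < 0}) (-1)^{r+s} q^{(3/2) r^2 + 4 r s + (3/2) s^2 + (k/2)(r + s) + c}`.
For odd `k` the number that is divided by two is even, so that the integer division is exact. -/
def hickersonTerm (k c : ℤ) (q : ℂ) (p : ℤ × ℤ) : ℂ :=
  quadrantSign p.1 p.2 * (-1) ^ (p.1 + p.2) *
    q ^ ((3 * p.1 ^ 2 + 8 * p.1 * p.2 + 3 * p.2 ^ 2 + k * (p.1 + p.2)) / 2 + c)

/-- The infinite product `(q)_∞ = ∏_{n ≥ 1} (1 - q^n)`. -/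
def qInfinity (q : ℂ) : ℂ := ∏' n : ℕ, (1 - q ^ (n + 1))

/-- Ramanujan's seventh order mock theta function `𝓕₀`, through Hickerson's double sum. -/
def mockF0 (q : ℂ) : ℂ := (∑' p, hickersonTerm 1 0 q p) / qInfinity q

/-- Ramanujan's seventh order mock theta function `𝓕₁`, through Hickerson's double sum. -/
def mockF1 (q : ℂ) : ℂ := (∑' p, hickersonTerm 5 1 q p) / qInfinity q

/-- Ramanujan's seventh order mock theta function `𝓕₂`, through Hickerson's double sum. -/
def mockF2 (q : ℂ) : ℂ := (∑' p, hickersonTerm 3 0 q p) / qInfinity q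

/-- The vector `F₇`; the order of its entries is `𝓕₀`, `𝓕₂`, `𝓕₁`. -/
def F7 (τ : ℂ) : Fin 3 → ℂ :=
  ![qPow (-1 / 168) τ * mockF0 (qPow 1 τ),
    qPow (47 / 168) τ * mockF2 (qPow 1 τ),
    qPow (-25 / 168) τ * mockF1 (qPow 1 τ)]

/-! ### Indefinite theta functions -/

/-- `E(x) = 2 ∫_0^x e^{-πu²} du` for real `x`. -/
def errorE (x : ℝ) : ℝ := 2 * ∫ u in (0 : ℝ)..x, Real.exp (-Real.pi * u ^ 2)

/-- The bilinear form `B(x, y) = ⟨x, Ay⟩` on real vectors. -/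
def bilin {r : ℕ} (A : Matrix (Fin r) (Fin r) ℤ) (x y : Fin r → ℝ) : ℝ :=
  x ⬝ᵥ (A.map (Int.cast : ℤ → ℝ)).mulVec y

/-- The quadratic form `Q(x) = ⟨x, Ax⟩ / 2` on real vectors. -/
def quad {r : ℕ} (A : Matrix (Fin r) (Fin r) ℤ) (x : Fin r → ℝ) : ℝ := bilin A x x / 2

/-- The factor `ρ^c(ν; τ)` with `y = Im τ`: for `Q(c) < 0` it is `E(B(c, ν) y^{1/2} / √(-Q(c)))`,
and for `Q(c) = 0` it is `sign B(c, ν)`. -/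
def rhoFactor {r : ℕ} (A : Matrix (Fin r) (Fin r) ℤ) (c ν : Fin r → ℝ) (y : ℝ) : ℝ :=
  if quad A c < 0 then errorE (bilin A c ν / Real.sqrt (-quad A c) * Real.sqrt y)
  else Real.sign (bilin A c ν)

/-- The terms of the indefinite theta series with characteristics `a`, `b`, with `ν = a + n`. -/
def indefThetaTerm {r : ℕ} (A : Matrix (Fin r) (Fin r) ℤ) (c₁ c₂ a b : Fin r → ℝ) (τ : ℂ)
    (n : Fin r → ℤ) : ℂ :=
  let ν : Fin r → ℝ := fun i => a i + n i
  ((rhoFactor A c₁ ν τ.im - rhoFactor A c₂ ν τ.im : ℝ) : ℂ) *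
    exp (2 * Real.pi * I * quad A ν * τ + 2 * Real.pi * I * bilin A ν b)

/-- The indefinite theta function `θ_{a,b}^{c₁,c₂}(τ)` of the quadratic form with matrix `A`. -/
def indefTheta {r : ℕ} (A : Matrix (Fin r) (Fin r) ℤ) (c₁ c₂ a b : Fin r → ℝ) (τ : ℂ) : ℂ :=
  ∑' n : Fin r → ℤ, indefThetaTerm A c₁ c₂ a b τ n

/-- The matrix `A` that belongs to the seventh order functions. -/
def A7 : Matrix (Fin 2) (Fin 2) ℤ := !![3, 4; 4, 3]

/-- The vector `c₁` that belongs to the seventh order functions. -/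
def c71 : Fin 2 → ℝ := ![-3, 4]

/-- The vector `c₂` that belongs to the seventh order functions. -/
def c72 : Fin 2 → ℝ := ![-4, 3]

/-- The function `θ_{s e, t e}` for `A7`, `c71`, `c72`, where `e = (1, 1)`. -/
def theta7 (s t : ℝ) (τ : ℂ) : ℂ := indefTheta A7 c71 c72 ![s, s] ![t, t] τ

/-- The vector `H₇`. -/
def H7 (τ : ℂ) : Fin 3 → ℂ :=
  ((zeta 14)⁻¹ / (2 * ModularForm.eta τ)) •
    ![theta7 (1 / 14) (1 / 14) τ, theta7 (3 / 14) (5 / 14) τ, theta7 (5 / 14) (3 / 14) τ]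

/-! ### Non-holomorphic unary theta series -/

/-- `β(x) = ∫_x^∞ u^{-1/2} e^{-πu} du` for `x ≥ 0`. -/
def beta (x : ℝ) : ℝ :=
  ∫ u in Set.Ioi x, u ^ (-(1 / 2) : ℝ) * Real.exp (-Real.pi * u)

/-- The terms of the series `R_{a,b}(τ)`, with `ν = a + n`. -/
def unaryTerm (a b : ℝ) (τ : ℂ) (n : ℤ) : ℂ :=
  let ν : ℝ := a + n
  ((Real.sign ν * beta (2 * ν ^ 2 * τ.im) : ℝ) : ℂ) *
    exp (-Real.pi * I * ν ^ 2 * τ - 2 * Real.pi * I * ν * b)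

/-- `R_{a,b}(τ) = ∑_{ν ∈ a + ℤ} sign(ν) β(2ν²y) e^{-πiν²τ - 2πiνb}` with `y = Im τ`. -/
def unaryR (a b : ℝ) (τ : ℂ) : ℂ := ∑' n : ℤ, unaryTerm a b τ n

/-- The vector `G₇`. -/
def G7 (τ : ℂ) : Fin 3 → ℂ :=
  -![zeta 84 ^ (-13 : ℤ) * unaryR (13 / 42) (-1 / 2) (21 * τ)
        + zeta 84 * unaryR (41 / 42) (-1 / 2) (21 * τ),
     zeta 84 ^ (29 : ℤ) * unaryR (11 / 42) (-5 / 2) (21 * τ)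
        + zeta 84 ^ (-41 : ℤ) * unaryR (25 / 42) (-5 / 2) (21 * τ),
     zeta 28 ^ (5 : ℤ) * unaryR (23 / 42) (-3 / 2) (21 * τ)
        + zeta 28 ^ (-9 : ℤ) * unaryR (37 / 42) (-3 / 2) (21 * τ)]

/-! ### Real-analytic modular forms and the Casimir operator -/

/-- `∂f/∂τ = (∂f/∂x - i ∂f/∂y) / 2`. -/
def dTau (f : ℂ → ℂ) (τ : ℂ) : ℂ := (fderiv ℝ f τ 1 - I * fderiv ℝ f τ I) / 2

/-- `∂f/∂τ̄ = (∂f/∂x + i ∂f/∂y) / 2`. -/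
def dTauBar (f : ℂ → ℂ) (τ : ℂ) : ℂ := (fderiv ℝ f τ 1 + I * fderiv ℝ f τ I) / 2

/-- The weight 1/2 Casimir operator `-4y² ∂²/∂τ∂τ̄ + iy ∂/∂τ̄ + 3/16`. -/
def casimirHalf (f : ℂ → ℂ) (τ : ℂ) : ℂ :=
  -4 * (τ.im : ℂ) ^ 2 * dTau (dTauBar f) τ + I * τ.im * dTauBar f τ + 3 / 16 * f τ

/-- The vector-valued function `f` is not identically zero on the upper half-plane, and the
weight 1/2 Casimir operator multiplies each of its components there by `ev`. -/
def IsCasimirHalfEigenfunction {m : ℕ} (f : ℂ → Fin m → ℂ) (ev : ℂ) : Prop :=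
  (∃ τ : ℂ, 0 < τ.im ∧ f τ ≠ 0) ∧
    ∀ τ : ℂ, 0 < τ.im → ∀ j, casimirHalf (fun z => f z j) τ = ev * f τ j

/-- `f` is real-analytic on the upper half-plane and transforms there under each element of
`SL₂(ℤ)` with weight `k` (principal branch of the power) and a constant invertible matrix. -/
structure IsRealAnalyticModularForm {m : ℕ} (k : ℝ) (f : ℂ → Fin m → ℂ) : Prop where
  analytic : AnalyticOnNhd ℝ f {τ : ℂ | 0 < τ.im}
  modular : ∀ γ : Matrix.SpecialLinearGroup (Fin 2) ℤ, ∃ M : GL (Fin m) ℂ,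
    ∀ τ : ℂ, 0 < τ.im →
      f (((γ 0 0 : ℂ) * τ + (γ 0 1 : ℂ)) / ((γ 1 0 : ℂ) * τ + (γ 1 1 : ℂ))) =
        ((γ 1 0 : ℂ) * τ + (γ 1 1 : ℂ)) ^ (k : ℂ) • (M : Matrix (Fin m) (Fin m) ℂ).mulVec (f τ)

/-- The matrix of `τ ↦ τ + 1`. -/
def T7 : Matrix (Fin 3) (Fin 3) ℂ :=
  Matrix.diagonal ![zeta 168 ^ (-1 : ℤ), zeta 168 ^ (47 : ℤ), zeta 168 ^ (-25 : ℤ)]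

/-- The matrix of `τ ↦ -1/τ`. -/
def M7 : Matrix (Fin 3) (Fin 3) ℂ :=
  ((2 / Real.sqrt 7 : ℝ) : ℂ) •
    (!![Real.sin (Real.pi / 7), Real.sin (3 * Real.pi / 7), Real.sin (2 * Real.pi / 7);
        Real.sin (3 * Real.pi / 7), -Real.sin (2 * Real.pi / 7), Real.sin (Real.pi / 7);
        Real.sin (2 * Real.pi / 7), Real.sin (Real.pi / 7), -Real.sin (3 * Real.pi / 7)]).map
      (fun x : ℝ => (x : ℂ))

end

end MockTheta

/-! ### The error function `errorE`, its link with `beta`, and its holomorphic extension. -/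

namespace MockTheta

noncomputable section

open Complex MeasureTheory Set

/-! Everything starts from E(z) = sign(z)(1 - β(z²)) (`errorE_eq`). Since B(c₁, ν) and B(c₂, ν) are
7ν₁ and -7ν₂, the bracket in θ is a sum of two values of E. Its sign part is twice the operator
∑_{r,s≥0} - ∑_{r,s<0} and gives Hickerson's double sum. Its two β parts agree by the symmetry r ↔ s.
In a β part the vectors (3,-4) and (0,1) are B-orthogonal and span a sublattice of index 3, so on
each coset the sum factors into a series R at 21τ and an alternating theta series
(`tsum_sign_beta_quadExp`). By the pentagonal number theorem the latter is ±η or 0, so division by η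
leaves exactly G₇ (`F7_eq_H7_add_G7`).

For the modularity of H₇, the bracket of error functions is integrated back: with hyperbolically
rotated coordinates X, Y such that Q = X² - Y² and dY/dφ = X, it is 4√y times the integral of X
e^{-4πyY²} over an interval of angles φ (`integral_rotTerm`). For fixed φ the resulting series is a
Siegel theta series with a linear factor, to which Poisson summation on ℤ² applies
(`tsum_siegelTerm_neg_one_div`). The dual lattice modulo ℤ² has order 7. Oddness and periodicity in
the characteristic fold the seven functions into three (`thetaOdd_neg_one_div`). Together with the
transformations of η this handles the generators S and T, hence all of SL₂(ℤ), the branch of the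
square root being controlled by connectedness (`HasHalfWeight.principal`).

Analyticity and the Casimir equation are read off from H₇ = F₇ - G₇: F₇ is holomorphic, and ∂R/∂τ̄
is y^{-1/2} times an antiholomorphic theta series, which the differential part of the operator
annihilates (`IsHalfHarmonic.casimirHalf_eq`). H₇ is not zero because the first entry of F₇ grows
like q^{-1/168} up the imaginary axis while G₇ stays bounded.

Finally, on a vertical line above a rational point the terms of R have phases that are periodic in n
and independent of t. In each residue class there remains a sum of signs times the monotone function
z ↦ β(2z²)e^{πz²}, which telescopes to a bound uniform in t (`exists_norm_unaryR_vertical_le`). -/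

lemma integrable_exp_quadratic (c : ℝ) :
    Integrable fun v : ℝ => Real.exp (c * v - Real.pi * v ^ 2) := by
  have h := (integrable_exp_neg_mul_sq Real.pi_pos).comp_sub_right (c / (2 * Real.pi))
  refine (h.const_mul (Real.exp (c ^ 2 / (4 * Real.pi)))).congr (ae_of_all _ fun v => ?_)
  simp only []
  rw [← Real.exp_add]
  congr 1
  field_simp
  ring

lemma integral_gaussian_half : ∫ v in Ioi (0 : ℝ), Real.exp (-Real.pi * v ^ 2) = 1 / 2 := by
  rw [integral_gaussian_Ioi, div_self Real.pi_ne_zero, Real.sqrt_one]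

lemma integral_Ioi_zero_comp_add_left (f : ℝ → ℝ) (z : ℝ) :
    ∫ v in Ioi (0 : ℝ), f (z + v) = ∫ u in Ioi z, f u := by
  have h := (measurePreserving_add_left volume z).setIntegral_preimage_emb
    (measurableEmbedding_addLeft z) f (Ioi z)
  simpa using h

/-- `2 ∫_z^∞ e^{-πu²} du = 1 - E(z)` for real `z`. -/
lemma one_sub_errorE (z : ℝ) :
    1 - errorE z = 2 * ∫ v in Ioi (0 : ℝ), Real.exp (-Real.pi * (z + v) ^ 2) := by
  have hi : Integrable fun u : ℝ => Real.exp (-Real.pi * u ^ 2) :=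
    integrable_exp_neg_mul_sq Real.pi_pos
  have h1 : ∫ v in Ioi (0 : ℝ), Real.exp (-Real.pi * (z + v) ^ 2)
      = ∫ u in Ioi z, Real.exp (-Real.pi * u ^ 2) := by
    exact integral_Ioi_zero_comp_add_left (fun u : ℝ => Real.exp (-Real.pi * u ^ 2)) z
  have h2 := intervalIntegral.integral_interval_add_Ioi (a := 0) (b := z)
    (hi.integrableOn (s := Ioi 0)) (hi.integrableOn (s := Ioi z))
  rw [integral_gaussian_half] at h2
  rw [h1, errorE]
  linarith

lemma errorE_neg (z : ℝ) : errorE (-z) = -errorE z := by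
  unfold errorE
  have h := intervalIntegral.integral_comp_neg (a := 0) (b := z)
    (fun u : ℝ => Real.exp (-Real.pi * u ^ 2))
  simp only [neg_sq, neg_zero] at h
  rw [h, intervalIntegral.integral_symm]
  ring

lemma hasDerivAt_errorE (z : ℝ) :
    HasDerivAt errorE (2 * Real.exp (-Real.pi * z ^ 2)) z := by
  unfold errorE
  have hc : Continuous fun u : ℝ => Real.exp (-Real.pi * u ^ 2) := by fun_prop
  exact (intervalIntegral.integral_hasDerivAt_right (hc.intervalIntegrable _ _)
    (hc.stronglyMeasurableAtFilter _ _) hc.continuousAt).const_mul 2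

/-- The substitution u = v². The half-line beyond z² is encoded by an indicator, so that the
substitution can be made on all of (0, ∞). -/
lemma beta_sq {z : ℝ} (hz : 0 ≤ z) : beta (z ^ 2) = 1 - errorE z := by
  have h1 := integral_comp_rpow_Ioi (E := ℝ) ((Ioi (z ^ 2)).indicator
    fun u : ℝ => u ^ (-(1 / 2) : ℝ) * Real.exp (-Real.pi * u)) (p := 2) two_ne_zero
  have h2 : ∫ y in Ioi (0 : ℝ), (Ioi (z ^ 2)).indicator
      (fun u : ℝ => u ^ (-(1 / 2) : ℝ) * Real.exp (-Real.pi * u)) y = beta (z ^ 2) := by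
    rw [setIntegral_indicator measurableSet_Ioi, Ioi_inter_Ioi, sup_eq_right.2 (sq_nonneg z), beta]
  have h3 : ∀ x ∈ Ioi (0 : ℝ), (|(2 : ℝ)| * x ^ ((2 : ℝ) - 1)) • (Ioi (z ^ 2)).indicator
      (fun u : ℝ => u ^ (-(1 / 2) : ℝ) * Real.exp (-Real.pi * u)) (x ^ (2 : ℝ))
      = (Ioi z).indicator (fun u => 2 * Real.exp (-Real.pi * u ^ 2)) x := by
    intro x hx
    have hx : 0 < x := hx
    rw [Real.rpow_two]
    by_cases h : z < x
    · rw [indicator_of_mem (show x ∈ Ioi z from h),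
        indicator_of_mem (show x ^ 2 ∈ Ioi (z ^ 2) from pow_lt_pow_left₀ h hz two_ne_zero)]
      have : (x ^ 2) ^ (-(1 / 2) : ℝ) = x⁻¹ := by
        rw [← Real.rpow_two, ← Real.rpow_mul hx.le, ← Real.rpow_neg_one]; norm_num
      rw [this, abs_of_pos two_pos, smul_eq_mul]
      norm_num
      field_simp
    · rw [indicator_of_notMem (show x ∉ Ioi z from h),
        indicator_of_notMem (show x ^ 2 ∉ Ioi (z ^ 2) from
          fun h' => h (lt_of_pow_lt_pow_left₀ 2 hx.le h')), smul_zero]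
  rw [setIntegral_congr_fun measurableSet_Ioi h3, h2, setIntegral_indicator measurableSet_Ioi,
    Ioi_inter_Ioi, sup_eq_right.2 hz, integral_const_mul] at h1
  rw [one_sub_errorE, ← h1]
  rw [integral_Ioi_zero_comp_add_left (fun u : ℝ => Real.exp (-Real.pi * u ^ 2)) z]

/-- The sign is what remains holomorphic in the theta series; the β term is the correction
responsible for G₇. -/
lemma errorE_eq (z : ℝ) : errorE z = Real.sign z * (1 - beta (z ^ 2)) := by
  rcases lt_trichotomy z 0 with h | h | h
  · rw [Real.sign_of_neg h, ← neg_sq, beta_sq (by linarith), errorE_neg]; ring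
  · simp [h, errorE]
  · rw [Real.sign_of_pos h, beta_sq h.le]; ring

lemma beta_nonneg {x : ℝ} (hx : 0 ≤ x) : 0 ≤ beta x := by
  rw [← Real.sq_sqrt hx, beta_sq (Real.sqrt_nonneg x), one_sub_errorE]
  exact mul_nonneg two_pos.le (integral_nonneg fun v => (Real.exp_pos _).le)

/-- The function `z ↦ β(2z²) e^{πz²}`. -/
def betaWeighted (z : ℝ) : ℝ := beta (2 * z ^ 2) * Real.exp (Real.pi * z ^ 2)

/-- From (√2 z + v)² - z² = z² + 2√2 zv + v². In this form monotonicity in z ≥ 0 is visible under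
the integral sign. -/
lemma betaWeighted_eq {z : ℝ} (hz : 0 ≤ z) : betaWeighted z =
    2 * ∫ v in Ioi (0 : ℝ), Real.exp (-Real.pi * (z ^ 2 + 2 * Real.sqrt 2 * z * v + v ^ 2)) := by
  have h2 : (Real.sqrt 2 * z) ^ 2 = 2 * z ^ 2 := by rw [mul_pow, Real.sq_sqrt two_pos.le]
  rw [betaWeighted, ← h2, beta_sq (by positivity), one_sub_errorE, mul_assoc,
    ← integral_mul_const]
  congr 2
  ext v
  rw [← Real.exp_add]
  congr 1
  linear_combination (-Real.pi) * h2

lemma integrable_betaWeighted (z : ℝ) : Integrable fun v : ℝ =>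
    Real.exp (-Real.pi * (z ^ 2 + 2 * Real.sqrt 2 * z * v + v ^ 2)) := by
  refine ((integrable_exp_quadratic (-Real.pi * (2 * Real.sqrt 2 * z))).const_mul
    (Real.exp (-Real.pi * z ^ 2))).congr (ae_of_all _ fun v => ?_)
  simp only []
  rw [← Real.exp_add]
  congr 1
  ring

lemma betaWeighted_antitoneOn : AntitoneOn betaWeighted (Ici 0) := by
  intro x hx y hy hxy
  have hx : 0 ≤ x := hx
  have hy : 0 ≤ y := hy
  rw [betaWeighted_eq hx, betaWeighted_eq hy]
  refine mul_le_mul_of_nonneg_left (setIntegral_mono_on (integrable_betaWeighted _).integrableOn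
    (integrable_betaWeighted _).integrableOn measurableSet_Ioi fun v hv => ?_) two_pos.le
  have hv : 0 < v := hv
  refine Real.exp_le_exp.2 ?_
  rw [neg_mul, neg_mul, neg_le_neg_iff]
  gcongr

lemma betaWeighted_zero : betaWeighted 0 = 1 := by
  rw [betaWeighted_eq le_rfl]
  simp only [ne_eq, OfNat.ofNat_ne_zero, not_false_eq_true, zero_pow, mul_zero, zero_mul, zero_add]
  rw [integral_gaussian_half]
  norm_num

lemma betaWeighted_nonneg (z : ℝ) : 0 ≤ betaWeighted z :=
  mul_nonneg (beta_nonneg (by positivity)) (Real.exp_pos _).le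

/-- The holomorphic extension of `1 - E`. -/
def erfcC (z : ℂ) : ℂ :=
  exp (-Real.pi * z ^ 2) * (2 * ∫ v in Ioi (0 : ℝ), exp (-2 * Real.pi * z * v - Real.pi * v ^ 2))

lemma erfcC_ofReal (z : ℝ) : erfcC z = ((1 - errorE z : ℝ) : ℂ) := by
  rw [one_sub_errorE, erfcC]
  push_cast
  rw [← integral_complex_ofReal, mul_left_comm, ← integral_const_mul]
  congr 2
  ext v
  rw [← exp_add, ofReal_exp]
  congr 1
  push_cast
  ring

lemma norm_gauss_term (z : ℂ) (v : ℝ) :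
    ‖exp (-2 * Real.pi * z * v - Real.pi * v ^ 2)‖
      = Real.exp (-2 * Real.pi * z.re * v - Real.pi * v ^ 2) := by
  rw [norm_exp]
  congr 1
  have : (-2 * Real.pi * z * v - Real.pi * v ^ 2 : ℂ)
      = ((-2 * Real.pi * v : ℝ) : ℂ) * z + ((-Real.pi * v ^ 2 : ℝ) : ℂ) := by push_cast; ring
  rw [this, add_re, re_ofReal_mul, ofReal_re]
  ring

lemma integrable_gauss_term (z : ℂ) :
    Integrable fun v : ℝ => exp (-2 * Real.pi * z * v - Real.pi * v ^ 2) := by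
  refine (integrable_exp_quadratic (-2 * Real.pi * z.re)).mono'
    (by fun_prop : Continuous _).aestronglyMeasurable (ae_of_all _ fun v => ?_)
  rw [norm_gauss_term]

/-- For Re z ≥ 0 the factor e^{-2πzv} has modulus at most 1, so the integral is at most the
half-line Gaussian integral 1/2. -/
lemma norm_erfcC_le {z : ℂ} (hz : 0 ≤ z.re) :
    ‖erfcC z‖ ≤ Real.exp (-Real.pi * (z ^ 2).re) := by
  rw [erfcC, norm_mul, norm_exp, norm_mul]
  have h1 : (-Real.pi * z ^ 2 : ℂ).re = -Real.pi * (z ^ 2).re := by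
    rw [← ofReal_neg, re_ofReal_mul]
  rw [h1]
  have h2 : ‖∫ v in Ioi (0 : ℝ), exp (-2 * Real.pi * z * v - Real.pi * v ^ 2)‖ ≤ 1 / 2 := by
    rw [← integral_gaussian_half]
    refine norm_integral_le_of_norm_le (integrable_exp_neg_mul_sq Real.pi_pos).integrableOn ?_
    refine (ae_restrict_iff' measurableSet_Ioi).2 (ae_of_all _ fun v hv => ?_)
    have hv : 0 < v := hv
    rw [norm_gauss_term]
    refine Real.exp_le_exp.2 ?_
    have : 0 ≤ Real.pi * z.re * v := by have := Real.pi_pos; positivity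
    linarith
  have h3 : ‖(2 : ℂ)‖ = 2 := by simp
  rw [h3]
  have := Real.exp_pos (-Real.pi * (z ^ 2).re)
  nlinarith

lemma differentiable_erfcC : Differentiable ℂ erfcC := by
  intro z
  unfold erfcC
  refine DifferentiableAt.mul (by fun_prop) (DifferentiableAt.const_mul ?_ _)
  have key := hasDerivAt_integral_of_dominated_loc_of_deriv_le (𝕜 := ℂ)
    (μ := volume.restrict (Ioi (0 : ℝ))) (x₀ := z) (s := Metric.ball z 1)
    (F := fun z v => exp (-2 * Real.pi * z * v - Real.pi * v ^ 2))
    (F' := fun z v => exp (-2 * Real.pi * z * v - Real.pi * v ^ 2) * (-2 * Real.pi * v))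
    (bound := fun v => 2 * Real.pi *
      Real.exp ((2 * Real.pi * (‖z‖ + 1) + 1) * v - Real.pi * v ^ 2))
    (Metric.ball_mem_nhds z one_pos)
    (Filter.Eventually.of_forall fun w => (by fun_prop : Continuous _).aestronglyMeasurable)
    (integrable_gauss_term z).integrableOn
    (by fun_prop : Continuous _).aestronglyMeasurable ?_
    ((integrable_exp_quadratic _).const_mul _).integrableOn ?_
  · exact key.2.differentiableAt
  · refine (ae_restrict_iff' measurableSet_Ioi).2 (ae_of_all _ fun v hv w hw => ?_)
    have hv : 0 < v := hv
    have hw : ‖w‖ < ‖z‖ + 1 := by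
      have : ‖w - z‖ < 1 := by simpa [dist_eq_norm] using hw
      linarith [norm_le_norm_add_norm_sub' w z]
    have h0 : ‖(-2 * Real.pi * v : ℂ)‖ = 2 * Real.pi * v := by
      rw [norm_mul, norm_mul, norm_neg, norm_real, norm_real, Real.norm_of_nonneg hv.le,
        Real.norm_of_nonneg Real.pi_pos.le]; simp
    rw [norm_mul, norm_gauss_term, h0]
    -- The factor v produced by differentiation is absorbed into the exponential; this is the `+ 1`
    -- in the bound.
    have h1 : v ≤ Real.exp v := by linarith [Real.add_one_le_exp v]
    have h2 : -2 * Real.pi * w.re * v - Real.pi * v ^ 2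
        ≤ (2 * Real.pi * (‖z‖ + 1)) * v - Real.pi * v ^ 2 := by
      have h3 : -w.re ≤ ‖z‖ + 1 := by linarith [neg_abs_le w.re, abs_re_le_norm w]
      have := mul_le_mul_of_nonneg_left h3 (mul_nonneg (mul_nonneg two_pos.le Real.pi_pos.le) hv.le)
      linarith
    calc _ ≤ Real.exp ((2 * Real.pi * (‖z‖ + 1)) * v - Real.pi * v ^ 2)
          * (2 * Real.pi * Real.exp v) := by
          have := Real.pi_pos
          gcongr
      _ = _ := by
          rw [mul_left_comm, ← Real.exp_add]; congr 2; ring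
  · refine ae_of_all _ fun v w _ => ?_
    have : HasDerivAt (fun w : ℂ => -2 * Real.pi * w * v - Real.pi * v ^ 2)
        (-2 * Real.pi * v : ℂ) w := by
      have := (((hasDerivAt_id w).const_mul (-2 * Real.pi : ℂ)).mul_const (v : ℂ)).sub_const
        ((Real.pi : ℂ) * (v : ℂ) ^ 2)
      simpa using this
    exact this.cexp

/-- The complex derivative exists by holomorphy, and restriction to the real axis determines its
value. -/
lemma hasDerivAt_erfcC (x : ℝ) :
    HasDerivAt erfcC ((-2 * Real.exp (-Real.pi * x ^ 2) : ℝ) : ℂ) x := by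
  have h := (differentiable_erfcC x).hasDerivAt
  have h1 := h.comp_ofReal
  have h2 : HasDerivAt (fun y : ℝ => erfcC y) ((-2 * Real.exp (-Real.pi * x ^ 2) : ℝ) : ℂ) x := by
    have := ((hasDerivAt_errorE x).const_sub 1).ofReal_comp
    refine (this.congr_deriv (by push_cast; ring)).congr_of_eventuallyEq
      (Filter.Eventually.of_forall fun y => erfcC_ofReal y)
  rwa [h1.unique h2] at h

lemma beta_le {x : ℝ} (hx : 0 ≤ x) : beta x ≤ Real.exp (-Real.pi * x) := by
  have h : beta x = 1 - errorE (Real.sqrt x) := by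
    rw [← beta_sq (Real.sqrt_nonneg x), Real.sq_sqrt hx]
  have h1 := norm_erfcC_le (z := (Real.sqrt x : ℝ)) (by simp [Real.sqrt_nonneg])
  rw [erfcC_ofReal, ← h, norm_real, Real.norm_of_nonneg (beta_nonneg hx), ← ofReal_pow,
    Real.sq_sqrt hx, ofReal_re] at h1
  exact h1

end

end MockTheta

namespace MockTheta

noncomputable section

open Complex MeasureTheory Set

/-! ### Gaussian sums over `ℤ × ℤ` -/

lemma summable_exp_neg_sq_add_abs {c : ℝ} (hc : 0 < c) (A : ℝ) :
    Summable fun n : ℤ => Real.exp (-c * (n : ℝ) ^ 2 + A * |(n : ℝ)|) := by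
  refine (summable_pow_mul_jacobiTheta₂_term_bound (A / (2 * Real.pi))
    (div_pos hc Real.pi_pos) 0).congr fun n => ?_
  rw [pow_zero, one_mul]
  congr 1
  push_cast
  field_simp
  ring

lemma summable_exp_neg_sq_prod {c : ℝ} (hc : 0 < c) (A C : ℝ) :
    Summable fun n : ℤ × ℤ => Real.exp
      (-c * ((n.1 : ℝ) ^ 2 + (n.2 : ℝ) ^ 2) + A * (|(n.1 : ℝ)| + |(n.2 : ℝ)|) + C) := by
  have h := summable_exp_neg_sq_add_abs hc A
  refine ((h.mul_of_nonneg h (fun _ => (Real.exp_pos _).le) (fun _ =>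
    (Real.exp_pos _).le)).mul_left (Real.exp C)).congr fun n => ?_
  rw [← Real.exp_add, ← Real.exp_add]
  congr 1
  ring

/-- The symmetric matrix with rows `(p, r)` and `(r, u)` has positive definite imaginary part. -/
structure PosForm (p r u : ℂ) : Prop where
  pos : 0 < p.im
  det : r.im ^ 2 < p.im * u.im

namespace PosForm

variable {p r u : ℂ}

lemma pos' (h : PosForm p r u) : 0 < u.im := by
  have h1 := h.pos
  have h2 := h.det
  by_contra h3
  nlinarith [sq_nonneg r.im]

lemma symm (h : PosForm p r u) : PosForm u r p := ⟨h.pos', by rw [mul_comm]; exact h.det⟩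

lemma ne_zero (h : PosForm p r u) : p ≠ 0 := fun h0 => by simpa [h0] using h.pos

/-- This is the form obtained by Poisson summation in the first variable alone. The determinant of
the imaginary part gets divided by |p|². -/
lemma partialInv (h : PosForm p r u) : PosForm (-1 / p) (r / p) (u - r ^ 2 / p) := by
  have hN : 0 < normSq p := normSq_pos.2 h.ne_zero
  have h1 : (-1 / p).im = p.im / normSq p := by
    rw [neg_div, one_div, neg_im, inv_im]; ring
  refine ⟨by rw [h1]; exact div_pos h.pos hN, ?_⟩
  rw [h1, ← sub_pos]
  have h2 : p.im / normSq p * (u - r ^ 2 / p).im - (r / p).im ^ 2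
      = (p.im * u.im - r.im ^ 2) / normSq p := by
    rw [sub_im, div_im, div_im, pow_two r, mul_re, mul_im]
    have hN' : normSq p = p.re * p.re + p.im * p.im := normSq_apply p
    field_simp
    rw [hN']
    ring
  rw [h2]
  exact div_pos (sub_pos.2 h.det) hN

lemma exists_bound (h : PosForm p r u) : ∃ c : ℝ, 0 < c ∧ ∀ x y : ℝ,
    c * (x ^ 2 + y ^ 2) ≤ p.im * x ^ 2 + 2 * r.im * x * y + u.im * y ^ 2 := by
  have ha := h.pos
  have hc := h.pos'
  have hd := sub_pos.2 h.det
  -- Determinant over trace, a lower bound for the smaller eigenvalue.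
  refine ⟨(p.im * u.im - r.im ^ 2) / (p.im + u.im), by positivity, fun x y => ?_⟩
  set c := (p.im * u.im - r.im ^ 2) / (p.im + u.im) with hcdef
  have h1 : c * (p.im + u.im) = p.im * u.im - r.im ^ 2 := by rw [hcdef]; field_simp
  have h2 : 0 < p.im - c := by
    have : (p.im - c) * (p.im + u.im) = p.im ^ 2 + r.im ^ 2 := by linarith
    by_contra h3
    nlinarith [sq_nonneg r.im]
  have h3 : (p.im - c) * (p.im * x ^ 2 + 2 * r.im * x * y + u.im * y ^ 2 - c * (x ^ 2 + y ^ 2))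
      = ((p.im - c) * x + r.im * y) ^ 2 + c ^ 2 * y ^ 2 := by linear_combination (-y ^ 2) * h1
  have h4 : 0 ≤ (p.im - c) *
      (p.im * x ^ 2 + 2 * r.im * x * y + u.im * y ^ 2 - c * (x ^ 2 + y ^ 2)) := by
    rw [h3]; positivity
  linarith [nonneg_of_mul_nonneg_right h4 h2]

/-- The constant c is independent of the linear coefficients, so the bound is uniform for bounded
coefficients. This is what permits differentiation of the series in a parameter. -/
lemma exists_norm_exp_le (h : PosForm p r u) : ∃ c : ℝ, 0 < c ∧
    ∀ (α β γ : ℂ) (A C : ℝ), ‖α‖ ≤ A → ‖β‖ ≤ A → ‖γ‖ ≤ C → ∀ n : ℤ × ℤ,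
      ‖exp (Real.pi * I * (p * n.1 ^ 2 + 2 * r * n.1 * n.2 + u * n.2 ^ 2)
        + α * n.1 + β * n.2 + γ)‖ ≤ Real.exp
      (-c * ((n.1 : ℝ) ^ 2 + (n.2 : ℝ) ^ 2) + A * (|(n.1 : ℝ)| + |(n.2 : ℝ)|) + C) := by
  obtain ⟨c, hc, hb⟩ := h.exists_bound
  refine ⟨Real.pi * c, mul_pos Real.pi_pos hc, fun α β γ A C hα hβ hγ n => ?_⟩
  rw [norm_exp]
  refine Real.exp_le_exp.2 ?_
  have e1 : (Real.pi * I * (p * n.1 ^ 2 + 2 * r * n.1 * n.2 + u * n.2 ^ 2)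
      + α * n.1 + β * n.2 + γ : ℂ).re
      = -Real.pi * (p.im * (n.1 : ℝ) ^ 2 + 2 * r.im * n.1 * n.2 + u.im * (n.2 : ℝ) ^ 2)
        + α.re * n.1 + β.re * n.2 + γ.re := by
    have : (p * n.1 ^ 2 + 2 * r * n.1 * n.2 + u * n.2 ^ 2 : ℂ) = ((n.1 ^ 2 : ℝ) : ℂ) * p
        + ((2 * n.1 * n.2 : ℝ) : ℂ) * r + ((n.2 ^ 2 : ℝ) : ℂ) * u := by push_cast; ring
    have h2 : (p * n.1 ^ 2 + 2 * r * n.1 * n.2 + u * n.2 ^ 2 : ℂ).im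
        = (n.1 : ℝ) ^ 2 * p.im + 2 * n.1 * n.2 * r.im + (n.2 : ℝ) ^ 2 * u.im := by
      rw [this, add_im, add_im, im_ofReal_mul, im_ofReal_mul, im_ofReal_mul]
    rw [add_re, add_re, add_re, mul_assoc, re_ofReal_mul, I_mul_re, h2, ← ofReal_intCast,
      ← ofReal_intCast, re_mul_ofReal, re_mul_ofReal]
    ring
  rw [e1]
  have h1 := mul_le_mul_of_nonneg_left (hb n.1 n.2) Real.pi_pos.le
  have aux : ∀ (δ : ℂ) (k : ℤ), ‖δ‖ ≤ A → δ.re * k ≤ A * |(k : ℝ)| := fun δ k hδ =>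
    (le_abs_self _).trans (by
      rw [abs_mul]
      exact mul_le_mul_of_nonneg_right ((abs_re_le_norm δ).trans hδ) (abs_nonneg _))
  have h2 := aux α n.1 hα
  have h3 := aux β n.2 hβ
  have h4 : γ.re ≤ C := (re_le_norm γ).trans hγ
  linarith

lemma summable_exp (h : PosForm p r u) (α β γ : ℂ) :
    Summable fun n : ℤ × ℤ => exp (Real.pi * I *
      (p * n.1 ^ 2 + 2 * r * n.1 * n.2 + u * n.2 ^ 2) + α * n.1 + β * n.2 + γ) := by
  obtain ⟨c, hc, hb⟩ := h.exists_norm_exp_le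
  exact Summable.of_norm_bounded (summable_exp_neg_sq_prod hc (max ‖α‖ ‖β‖) ‖γ‖)
    (hb α β γ _ _ (le_max_left _ _) (le_max_right _ _) le_rfl)

/-- Linear factors in front of a Gaussian come from differentiating in a parameter ε at 0. The term
ε²γ₂ does not affect the derivative, but it occurs on the dual side of Poisson summation, where the
argument is shifted inside a quadratic form. -/
lemma hasSum_deriv (h : PosForm p r u) (α₀ α₁ β₀ β₁ γ₀ γ₁ γ₂ : ℂ) :
    HasSum (fun n : ℤ × ℤ => (α₁ * n.1 + β₁ * n.2 + γ₁) * exp (Real.pi * I *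
      (p * n.1 ^ 2 + 2 * r * n.1 * n.2 + u * n.2 ^ 2) + α₀ * n.1 + β₀ * n.2 + γ₀))
      (deriv (fun ε : ℂ => ∑' n : ℤ × ℤ, exp (Real.pi * I *
        (p * n.1 ^ 2 + 2 * r * n.1 * n.2 + u * n.2 ^ 2) + (α₀ + ε * α₁) * n.1
          + (β₀ + ε * β₁) * n.2 + (γ₀ + ε * γ₁ + ε ^ 2 * γ₂))) 0) := by
  obtain ⟨c, hc, hb⟩ := h.exists_norm_exp_le
  have hlin : ∀ (a b ε : ℂ), ε ∈ Metric.ball (0 : ℂ) 1 → ‖a + ε * b‖ ≤ ‖a‖ + ‖b‖ := by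
    intro a b ε hε
    have hε : ‖ε‖ < 1 := by simpa using hε
    refine (norm_add_le _ _).trans ?_
    rw [norm_mul]
    nlinarith [norm_nonneg b]
  have key := hasSum_deriv_of_summable_norm (U := Metric.ball (0 : ℂ) 1) (z := 0)
    (F := fun (n : ℤ × ℤ) (ε : ℂ) => exp (Real.pi * I *
        (p * n.1 ^ 2 + 2 * r * n.1 * n.2 + u * n.2 ^ 2) + (α₀ + ε * α₁) * n.1
          + (β₀ + ε * β₁) * n.2 + (γ₀ + ε * γ₁ + ε ^ 2 * γ₂)))
    (summable_exp_neg_sq_prod hc (max (‖α₀‖ + ‖α₁‖) (‖β₀‖ + ‖β₁‖)) (‖γ₀‖ + ‖γ₁‖ + ‖γ₂‖))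
    (fun n => by fun_prop) Metric.isOpen_ball
    (fun n ε hε => hb _ _ _ _ _ ((hlin _ _ _ hε).trans (le_max_left _ _))
      ((hlin _ _ _ hε).trans (le_max_right _ _)) (by
        have h1 := hlin γ₀ γ₁ ε hε
        have hε : ‖ε‖ < 1 := by simpa using hε
        refine (norm_add_le _ _).trans (add_le_add h1 ?_)
        rw [norm_mul, norm_pow]
        have : ‖ε‖ ^ 2 ≤ 1 := pow_le_one₀ (norm_nonneg _) hε.le
        nlinarith [norm_nonneg γ₂]) n) (by simp)
  refine key.congr_fun ?_ |> fun h => h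
  intro n
  have h1 : HasDerivAt (fun ε : ℂ => (Real.pi * I *
        (p * n.1 ^ 2 + 2 * r * n.1 * n.2 + u * n.2 ^ 2) + (α₀ + ε * α₁) * n.1
          + (β₀ + ε * β₁) * n.2 + (γ₀ + ε * γ₁ + ε ^ 2 * γ₂) : ℂ))
      (α₁ * n.1 + β₁ * n.2 + γ₁) 0 := by
    have hid := hasDerivAt_id (0 : ℂ)
    have ha := ((hid.mul_const α₁).const_add α₀).mul_const (n.1 : ℂ)
    have hbb := ((hid.mul_const β₁).const_add β₀).mul_const (n.2 : ℂ)
    have hg := ((hid.mul_const γ₁).const_add γ₀).add ((hid.pow 2).mul_const γ₂)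
    refine (((ha.const_add (Real.pi * I *
        (p * n.1 ^ 2 + 2 * r * n.1 * n.2 + u * n.2 ^ 2) : ℂ)).add hbb).add hg).congr_deriv ?_
    simp
  rw [h1.cexp.deriv]
  simp [mul_comm]

lemma summable_linear_mul_exp (h : PosForm p r u) (α₀ α₁ β₀ β₁ γ₀ γ₁ : ℂ) :
    Summable (fun n : ℤ × ℤ => (α₁ * n.1 + β₁ * n.2 + γ₁) * exp (Real.pi * I *
      (p * n.1 ^ 2 + 2 * r * n.1 * n.2 + u * n.2 ^ 2) + α₀ * n.1 + β₀ * n.2 + γ₀)) :=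
  (h.hasSum_deriv α₀ α₁ β₀ β₁ γ₀ γ₁ 0).summable

/-- The quadratic form of the inverse matrix. -/
def invForm (p r u Z W : ℂ) : ℂ := (u * Z ^ 2 - 2 * r * Z * W + p * W ^ 2) / (p * u - r ^ 2)

lemma sub_ne_zero (h : PosForm p r u) : p * u - r ^ 2 ≠ 0 := by
  have h1 := h.partialInv.symm.ne_zero
  intro h0
  apply h1
  field_simp [h.ne_zero]
  linear_combination h0

/-- Minus the inverse matrix, obtained by two partial inversions, one in each variable. -/
lemma inv (h : PosForm p r u) :
    PosForm (-u / (p * u - r ^ 2)) (r / (p * u - r ^ 2)) (-p / (p * u - r ^ 2)) := by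
  have hp := h.ne_zero
  have hD := h.sub_ne_zero
  have hu : u - r ^ 2 / p = (p * u - r ^ 2) / p := by field_simp
  have h1 := h.partialInv.symm.partialInv.symm
  rw [hu] at h1
  generalize hDD : p * u - r ^ 2 = D at *
  have e1 : -u / D = -1 / p - (r / p) ^ 2 / (D / p) := by
    field_simp
    linear_combination (-1 : ℂ) * hDD
  have e2 : r / D = r / p / (D / p) := by field_simp
  have e3 : -p / D = -1 / (D / p) := by field_simp
  rwa [e1, e2, e3]

lemma div_neg_I_mul {a : ℂ} (ha : a ≠ 0) :
    -(Real.pi : ℂ) / (-I * a) = -Real.pi * I / a := by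
  rw [div_eq_div_iff (mul_ne_zero (neg_ne_zero.2 I_ne_zero) ha) ha]
  linear_combination (-Real.pi * a) * I_sq

/-- Poisson summation for Gaussians on `ℤ × ℤ`. -/
lemma tsum_exp (h : PosForm p r u) (z w : ℂ) :
    ∑' n : ℤ × ℤ, exp (Real.pi * I * (p * n.1 ^ 2 + 2 * r * n.1 * n.2 + u * n.2 ^ 2)
        + 2 * Real.pi * I * z * n.1 + 2 * Real.pi * I * w * n.2 + 0)
      = 1 / ((-I * p) ^ (1 / 2 : ℂ) * (-I * (u - r ^ 2 / p)) ^ (1 / 2 : ℂ)) *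
        ∑' n : ℤ × ℤ, exp (-Real.pi * I * invForm p r u (z - n.1) (w - n.2)) := by
  have hp := h.ne_zero
  have hD := h.sub_ne_zero
  have hu : u - r ^ 2 / p = (p * u - r ^ 2) / p := by field_simp
  set u' := u - r ^ 2 / p with hu'
  have hu0 : u' ≠ 0 := h.partialInv.symm.ne_zero
  have re_pos : ∀ {a : ℂ}, 0 < a.im → 0 < (-I * a).re := fun ha => by simpa using ha
  set f : ℤ × ℤ → ℂ := fun n => exp (Real.pi * I * (p * n.1 ^ 2 + 2 * r * n.1 * n.2 + u * n.2 ^ 2)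
        + 2 * Real.pi * I * z * n.1 + 2 * Real.pi * I * w * n.2 + 0) with hf
  set g : ℤ × ℤ → ℂ := fun n => exp (Real.pi * I * ((-1 / p) * n.1 ^ 2 + 2 * (r / p) * n.1 * n.2
    + u' * n.2 ^ 2) + 2 * Real.pi * I * (z / p) * n.1
    + 2 * Real.pi * I * (w - z * r / p) * n.2 - Real.pi * I * (z ^ 2 / p)) with hg
  set k : ℤ × ℤ → ℂ := fun n => exp (-Real.pi * I * invForm p r u (z - n.1) (w - n.2)) with hk
  have sf : Summable f := h.summable_exp _ _ _
  have sg : Summable g := by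
    refine (h.partialInv.summable_exp (2 * Real.pi * I * (z / p))
      (2 * Real.pi * I * (w - z * r / p)) (-(Real.pi * I * (z ^ 2 / p)))).congr fun n => ?_
    simp only [hg, hu']
    congr 1
  have sk : Summable k := by
    refine (h.inv.summable_exp (2 * Real.pi * I * ((u * z - r * w) / (p * u - r ^ 2)))
      (2 * Real.pi * I * ((p * w - r * z) / (p * u - r ^ 2)))
      (-Real.pi * I * invForm p r u z w)).congr fun n => ?_
    simp only [hk, invForm]
    congr 1
    field_simp
    ring
  -- One-dimensional Poisson summation in the first variable. What remains is Gaussian for the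
  -- partially inverted form, to which the same formula then applies in the second variable.
  have step1 : ∀ n : ℤ, ∑' m : ℤ, f (m, n) = 1 / (-I * p) ^ (1 / 2 : ℂ) * ∑' m : ℤ, g (m, n) := by
    intro n
    have h1 := Complex.tsum_exp_neg_quadratic (re_pos h.pos) (I * (z + r * n))
    calc ∑' m : ℤ, f (m, n) = exp (Real.pi * I * u * n ^ 2 + 2 * Real.pi * I * w * n) *
          ∑' m : ℤ, exp (-Real.pi * (-I * p) * m ^ 2 + 2 * Real.pi * (I * (z + r * n)) * m) := by
          rw [← tsum_mul_left]
          refine tsum_congr fun m => ?_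
          simp only [hf]
          rw [← Complex.exp_add]
          refine congrArg cexp ?_
          ring
      _ = _ := by
          rw [h1, mul_left_comm, ← tsum_mul_left]
          congr 1
          refine tsum_congr fun m => ?_
          have e2 : (m + I * (I * (z + r * n)) : ℂ) = m - (z + r * n) := by
            linear_combination (z + r * n) * I_sq
          simp only [hg]
          rw [← Complex.exp_add, div_neg_I_mul hp, e2, hu']
          refine congrArg cexp ?_
          field_simp
          ring
  have step2 : ∀ m : ℤ, ∑' n : ℤ, g (m, n)
      = 1 / (-I * u') ^ (1 / 2 : ℂ) * ∑' n : ℤ, k (m, n) := by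
    intro m
    have h1 := Complex.tsum_exp_neg_quadratic (re_pos h.partialInv.pos')
      (I * (w - (z - m) * r / p))
    calc ∑' n : ℤ, g (m, n) = exp (-Real.pi * I * (z - m) ^ 2 / p) *
          ∑' n : ℤ, exp (-Real.pi * (-I * u') * n ^ 2
            + 2 * Real.pi * (I * (w - (z - m) * r / p)) * n) := by
          rw [← tsum_mul_left]
          refine tsum_congr fun n => ?_
          rw [hg, ← Complex.exp_add]
          refine congrArg cexp ?_
          field_simp
          ring
      _ = _ := by
          rw [h1, mul_left_comm, ← tsum_mul_left]
          congr 1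
          refine tsum_congr fun n => ?_
          have e2 : (n + I * (I * (w - (z - m) * r / p)) : ℂ) = n - (w - (z - m) * r / p) := by
            linear_combination (w - (z - m) * r / p) * I_sq
          simp only [hk]
          rw [← Complex.exp_add, div_neg_I_mul hu0, e2, hu]
          simp only [invForm]
          refine congrArg cexp ?_
          field_simp
          ring
  have c1 : ∑' n, f n = ∑' n : ℤ, ∑' m : ℤ, f (m, n) := by
    rw [sf.tsum_prod, Summable.tsum_comm (f := fun m n => f (m, n)) sf]
  have c2 : ∑' n : ℤ, ∑' m : ℤ, g (m, n) = ∑' m : ℤ, ∑' n : ℤ, g (m, n) :=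
    (Summable.tsum_comm (f := fun m n => g (m, n)) sg)
  rw [c1, tsum_congr step1, tsum_mul_left, c2, tsum_congr step2, tsum_mul_left, sk.tsum_prod]
  rw [one_div_mul_eq_div, one_div_mul_eq_div, one_div_mul_eq_div, div_div, mul_comm]

/-- Replace (z, w) by (z + εx, w + εy) in `tsum_exp` and differentiate at ε = 0. The sign of the
dual exponent produces the minus sign. -/
lemma tsum_linear_mul_exp (h : PosForm p r u) (x y z w : ℂ) :
    ∑' n : ℤ × ℤ, (x * n.1 + y * n.2) * exp (Real.pi * I *
        (p * n.1 ^ 2 + 2 * r * n.1 * n.2 + u * n.2 ^ 2)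
        + 2 * Real.pi * I * z * n.1 + 2 * Real.pi * I * w * n.2)
      = -1 / ((-I * p) ^ (1 / 2 : ℂ) * (-I * (u - r ^ 2 / p)) ^ (1 / 2 : ℂ)) *
        ∑' n : ℤ × ℤ, (x * (u * (z - n.1) - r * (w - n.2)) + y * (p * (w - n.2) - r * (z - n.1)))
          / (p * u - r ^ 2) * exp (-Real.pi * I * invForm p r u (z - n.1) (w - n.2)) := by
  have hD := h.sub_ne_zero
  set K := 1 / ((-I * p) ^ (1 / 2 : ℂ) * (-I * (u - r ^ 2 / p)) ^ (1 / 2 : ℂ)) with hK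
  have hL := h.hasSum_deriv (2 * Real.pi * I * z) (2 * Real.pi * I * x)
    (2 * Real.pi * I * w) (2 * Real.pi * I * y) 0 0 0
  have hR := h.inv.hasSum_deriv (2 * Real.pi * I * ((u * z - r * w) / (p * u - r ^ 2)))
    (2 * Real.pi * I * ((u * x - r * y) / (p * u - r ^ 2)))
    (2 * Real.pi * I * ((p * w - r * z) / (p * u - r ^ 2)))
    (2 * Real.pi * I * ((p * y - r * x) / (p * u - r ^ 2)))
    (-Real.pi * I * invForm p r u z w)
    (-2 * Real.pi * I * ((x * (u * z - r * w) + y * (p * w - r * z)) / (p * u - r ^ 2)))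
    (-Real.pi * I * invForm p r u x y)
  have hfun : (fun ε : ℂ => ∑' n : ℤ × ℤ, exp (Real.pi * I *
        (p * n.1 ^ 2 + 2 * r * n.1 * n.2 + u * n.2 ^ 2)
          + (2 * Real.pi * I * z + ε * (2 * Real.pi * I * x)) * n.1
          + (2 * Real.pi * I * w + ε * (2 * Real.pi * I * y)) * n.2 + (0 + ε * 0 + ε ^ 2 * 0)))
      = fun ε : ℂ => K * ∑' n : ℤ × ℤ, exp (Real.pi * I * (-u / (p * u - r ^ 2) * n.1 ^ 2
          + 2 * (r / (p * u - r ^ 2)) * n.1 * n.2 + -p / (p * u - r ^ 2) * n.2 ^ 2)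
        + (2 * Real.pi * I * ((u * z - r * w) / (p * u - r ^ 2))
          + ε * (2 * Real.pi * I * ((u * x - r * y) / (p * u - r ^ 2)))) * n.1
        + (2 * Real.pi * I * ((p * w - r * z) / (p * u - r ^ 2))
          + ε * (2 * Real.pi * I * ((p * y - r * x) / (p * u - r ^ 2)))) * n.2
        + (-Real.pi * I * invForm p r u z w + ε * (-2 * Real.pi * I *
          ((x * (u * z - r * w) + y * (p * w - r * z)) / (p * u - r ^ 2)))
          + ε ^ 2 * (-Real.pi * I * invForm p r u x y))) := by
    ext ε
    have := h.tsum_exp (z + ε * x) (w + ε * y)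
    rw [← hK] at this
    calc _ = _ := tsum_congr fun n => by congr 1; ring
      _ = _ := this
      _ = _ := by
        congr 1
        refine tsum_congr fun n => ?_
        congr 1
        simp only [invForm]
        field_simp
        ring
  have hd : ∀ S : ℂ → ℂ, deriv (fun ε => K * S ε) 0 = K * deriv S 0 := fun S =>
    deriv_const_mul_field K
  rw [hfun, hd] at hL
  have e1 := hL.tsum_eq
  rw [← hR.tsum_eq] at e1
  have hpi : (2 * Real.pi * I : ℂ) ≠ 0 := by simp [Real.pi_ne_zero]
  have e2 : ∑' n : ℤ × ℤ, (2 * Real.pi * I * x * n.1 + 2 * Real.pi * I * y * n.2 + 0) *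
      exp (Real.pi * I * (p * n.1 ^ 2 + 2 * r * n.1 * n.2 + u * n.2 ^ 2)
        + 2 * Real.pi * I * z * n.1 + 2 * Real.pi * I * w * n.2 + 0)
      = (2 * Real.pi * I) * ∑' n : ℤ × ℤ, (x * n.1 + y * n.2) * exp (Real.pi * I *
        (p * n.1 ^ 2 + 2 * r * n.1 * n.2 + u * n.2 ^ 2)
        + 2 * Real.pi * I * z * n.1 + 2 * Real.pi * I * w * n.2) := by
    rw [← tsum_mul_left]
    refine tsum_congr fun n => ?_
    rw [add_zero (Real.pi * I * _ + _ + _ : ℂ)]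
    ring
  rw [e2] at e1
  apply mul_left_cancel₀ hpi
  have hnK : -1 / ((-I * p) ^ (1 / 2 : ℂ) * (-I * (u - r ^ 2 / p)) ^ (1 / 2 : ℂ)) = -K := by
    rw [hK, neg_div]
  rw [e1, hnK]
  have e3 : ∀ (S T : ℂ), S = -(2 * Real.pi * I) * T → K * S = 2 * Real.pi * I * (-K * T) := by
    intro S T hST
    rw [hST]; ring
  refine e3 _ _ ?_
  rw [← tsum_mul_left]
  refine tsum_congr fun n => ?_
  rw [← mul_assoc]
  refine congrArg₂ (· * ·) ?_ (congrArg cexp ?_)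
  · field_simp
    ring
  · simp only [invForm]
    field_simp
    ring

end PosForm

end

end MockTheta

namespace MockTheta

noncomputable section

open Complex MeasureTheory Set Filter

/-! ### The pentagonal number theorem and the eta function -/

lemma norm_prod_one_sub_pow_le {q : ℂ} (hq : ‖q‖ < 1) (k n : ℕ) :
    ‖∏ i ∈ Finset.range n, (1 - q ^ (k + i + 1))‖ ≤ Real.exp (1 / (1 - ‖q‖)) := by
  have hs : ∑ i ∈ Finset.range n, ‖q‖ ^ i ≤ 1 / (1 - ‖q‖) := by
    rw [one_div, ← tsum_geometric_of_lt_one (norm_nonneg q) hq]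
    exact (summable_geometric_of_lt_one (norm_nonneg q) hq).sum_le_tsum _
      fun i _ => pow_nonneg (norm_nonneg q) i
  refine le_trans ?_ (Real.exp_le_exp.2 hs)
  rw [Real.exp_sum, norm_prod]
  refine Finset.prod_le_prod (fun _ _ => norm_nonneg _) fun i _ => ?_
  calc ‖1 - q ^ (k + i + 1)‖ ≤ 1 + ‖q‖ ^ i := by
        refine (norm_sub_le _ _).trans ?_
        rw [norm_one, norm_pow]
        gcongr 1 + ?_
        exact pow_le_pow_of_le_one (norm_nonneg q) hq.le (by omega)
    _ ≤ Real.exp (‖q‖ ^ i) := by rw [add_comm]; exact Real.add_one_le_exp _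

lemma norm_pow_mul_prod_one_sub_pow_le {q : ℂ} (hq : ‖q‖ < 1) (k n : ℕ) :
    ‖q ^ ((k + 1) * n) * ∏ i ∈ Finset.range (n + 1), (1 - q ^ (k + i + 1))‖
      ≤ Real.exp (1 / (1 - ‖q‖)) * ‖q‖ ^ n := by
  rw [norm_mul, norm_pow, mul_comm]
  refine mul_le_mul (norm_prod_one_sub_pow_le hq k _) ?_ (by positivity) (Real.exp_pos _).le
  exact pow_le_pow_of_le_one (norm_nonneg q) hq.le (by nlinarith)

lemma le_pentagonal_neg (k : ℕ) : k ≤ pentagonal (-(k : ℤ)) := by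
  have := two_mul_natCast_pentagonal_neg (k : ℤ)
  zify
  nlinarith

lemma le_pentagonal_add_one (k : ℕ) : k ≤ pentagonal ((k : ℤ) + 1) := by
  have := two_mul_natCast_pentagonal ((k : ℤ) + 1)
  zify
  nlinarith

lemma summable_pow_comp {q : ℂ} (hq : ‖q‖ < 1) {f : ℕ → ℕ} (hf : ∀ k, k ≤ f k) :
    Summable fun k : ℕ => (-1 : ℂ) ^ k * q ^ f k := by
  refine Summable.of_norm_bounded (summable_geometric_of_lt_one (norm_nonneg q) hq) fun k => ?_
  rw [norm_mul, norm_pow, norm_pow, norm_neg, norm_one, one_pow, one_mul]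
  exact pow_le_pow_of_le_one (norm_nonneg q) hq.le (hf k)

/-- The pentagonal number theorem for complex numbers. -/
lemma qInfinity_eq_tsum {q : ℂ} (hq : ‖q‖ < 1) :
    qInfinity q = ∑' k : ℤ, (-1 : ℂ) ^ k * q ^ pentagonal (-k) := by
  have hgeo := summable_geometric_of_lt_one (norm_nonneg q) hq
  have hsum : ∀ k : ℕ, Summable fun n : ℕ =>
      q ^ ((k + 1) * n) * ∏ i ∈ Finset.range (n + 1), (1 - q ^ (k + i + 1)) := fun k =>
    Summable.of_norm_bounded (hgeo.mul_left _) (norm_pow_mul_prod_one_sub_pow_le hq k)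
  have h1 := summable_pow_comp hq le_pentagonal_neg
  have h2 := summable_pow_comp hq le_pentagonal_add_one
  have key := Pentagonal.tprod_one_sub_pow (x := q)
    (tendsto_pow_atTop_nhds_zero_of_norm_lt_one hq) hsum (fun k => ?_) ?_ ?_
  -- The pentagonal theorem in `key` pairs the indices k and -(k+1); here the pairs are unfolded
  -- into a sum over ℤ.
  · rw [qInfinity, key, tsum_of_nat_of_neg_add_one (f := fun k : ℤ =>
      (-1 : ℂ) ^ k * q ^ pentagonal (-k))]
    · rw [← Summable.tsum_add]
      · refine tsum_congr fun k => ?_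
        have : (-1 : ℂ) ^ (-((k : ℤ) + 1)) = -(-1) ^ k := by
          rw [zpow_neg, zpow_add₀ (by norm_num), zpow_natCast, zpow_one, mul_neg_one, inv_neg,
            ← inv_pow, inv_neg, inv_one]
        rw [this, neg_neg, zpow_natCast]
        ring
      · simpa using h1
      · refine h2.neg.congr fun k => ?_
        have : (-1 : ℂ) ^ (-((k : ℤ) + 1)) = -(-1) ^ k := by
          rw [zpow_neg, zpow_add₀ (by norm_num), zpow_natCast, zpow_one, mul_neg_one, inv_neg,
            ← inv_pow, inv_neg, inv_one]
        rw [this, neg_neg]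
        ring
    · simpa using h1
    · refine h2.neg.congr fun k => ?_
      have : (-1 : ℂ) ^ (-((k : ℤ) + 1)) = -(-1) ^ k := by
        rw [zpow_neg, zpow_add₀ (by norm_num), zpow_natCast, zpow_one, mul_neg_one, inv_neg,
          ← inv_pow, inv_neg, inv_one]
      rw [this, neg_neg]
      ring
  · have : Summable fun n : ℕ => ‖-q ^ (n + k + 1)‖ := by
      simp_rw [norm_neg, norm_pow, add_assoc]
      exact (summable_nat_add_iff (k + 1)).2 hgeo
    simpa [sub_eq_add_neg] using multipliable_one_add_of_summable this
  · exact (h1.sub h2).congr fun k => by ring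
  · refine squeeze_zero_norm (a := fun k : ℕ => ‖q‖ ^ k *
      (Real.exp (1 / (1 - ‖q‖)) * ∑' n : ℕ, ‖q‖ ^ n)) (fun k => ?_) ?_
    · rw [norm_mul, norm_mul, norm_pow, norm_pow, norm_neg, norm_one, one_pow, one_mul]
      refine mul_le_mul (pow_le_pow_of_le_one (norm_nonneg q) hq.le ?_) ?_ (norm_nonneg _)
        (by positivity)
      · rw [Nat.le_div_iff_mul_le two_pos]; nlinarith
      · rw [← tsum_mul_left]
        exact tsum_of_norm_bounded (hgeo.mul_left _).hasSum
          (norm_pow_mul_prod_one_sub_pow_le hq k)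
    · simpa using (tendsto_pow_atTop_nhds_zero_of_lt_one (norm_nonneg q) hq).mul_const _

lemma norm_qPow_one_lt {τ : ℂ} (hτ : 0 < τ.im) : ‖qPow 1 τ‖ < 1 := by
  rw [qPow, norm_exp, Real.exp_lt_one_iff]
  have : (2 * Real.pi * I * (1 : ℝ) * τ : ℂ).re = -(2 * Real.pi * τ.im) := by
    simp
  rw [this]
  have := Real.pi_pos
  simp only [Left.neg_neg_iff]
  positivity

lemma qPow_add (a b : ℝ) (τ : ℂ) : qPow (a + b) τ = qPow a τ * qPow b τ := by
  rw [qPow, qPow, qPow, ← exp_add]; congr 1; push_cast; ring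

lemma qPow_one_zpow (n : ℤ) (τ : ℂ) : qPow 1 τ ^ n = qPow n τ := by
  rw [qPow, qPow, ← exp_int_mul]; congr 1; push_cast; ring

lemma qPow_ne_zero (a : ℝ) (τ : ℂ) : qPow a τ ≠ 0 := exp_ne_zero _

lemma eta_eq (τ : ℂ) : ModularForm.eta τ = qPow (1 / 24) τ * qInfinity (qPow 1 τ) := by
  rw [ModularForm.eta, qInfinity, Function.Periodic.qParam, qPow, qPow]
  congr 1
  · congr 1; push_cast; ring
  · refine tprod_congr fun n => ?_
    rw [ModularForm.eta_q, Function.Periodic.qParam]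
    simp

/-- The alternating unary theta series `∑ (-1)^k q^{(3/2)(k+c)²}`. -/
def altTheta (c : ℝ) (τ : ℂ) : ℂ :=
  ∑' k : ℤ, (-1 : ℂ) ^ k * exp (3 * Real.pi * I * (k + c) ^ 2 * τ)

/-- Completing the square, k(3k+1)/2 + 1/24 = (3/2)(k + 1/6)², in the pentagonal number theorem. -/
lemma altTheta_one_sixth {τ : ℂ} (hτ : 0 < τ.im) : altTheta (1 / 6) τ = ModularForm.eta τ := by
  rw [eta_eq, qInfinity_eq_tsum (norm_qPow_one_lt hτ), altTheta, ← tsum_mul_left]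
  refine tsum_congr fun k => ?_
  rw [mul_left_comm]
  congr 1
  rw [← zpow_natCast (qPow 1 τ), qPow_one_zpow, ← qPow_add, qPow]
  congr 1
  have h : (2 * (pentagonal (-k) : ℂ)) = k * (3 * k + 1) := by
    exact_mod_cast congrArg (Int.cast : ℤ → ℂ) (two_mul_natCast_pentagonal_neg k)
  push_cast
  linear_combination (-Real.pi * I * τ) * h

lemma altTheta_neg (c : ℝ) (τ : ℂ) : altTheta (-c) τ = altTheta c τ := by
  rw [altTheta, altTheta, ← (Equiv.neg ℤ).tsum_eq]
  refine tsum_congr fun k => ?_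
  simp only [Equiv.neg_apply, zpow_neg, ← inv_zpow, inv_neg, inv_one]
  congr 2
  push_cast
  ring

lemma altTheta_add_one (c : ℝ) (τ : ℂ) : altTheta (c + 1) τ = -altTheta c τ := by
  rw [altTheta, altTheta, ← (Equiv.subRight (1 : ℤ)).tsum_eq, ← tsum_neg]
  refine tsum_congr fun k => ?_
  simp only [Equiv.subRight_apply]
  rw [zpow_sub₀ (by norm_num), zpow_one, div_neg, div_one, neg_mul]
  congr 3
  push_cast
  ring

/-- Evenness and antiperiodicity in c force the value at 1/2 to equal its own negative. This
eliminates one of the three cosets in each component. -/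
lemma altTheta_half (τ : ℂ) : altTheta (1 / 2) τ = 0 := by
  have h := altTheta_add_one (-(1 / 2)) τ
  rw [altTheta_neg] at h
  norm_num at h
  linear_combination h / 2

lemma altTheta_five_sixths {τ : ℂ} (hτ : 0 < τ.im) :
    altTheta (5 / 6) τ = -ModularForm.eta τ := by
  rw [← altTheta_one_sixth hτ, ← altTheta_neg (1 / 6), ← altTheta_add_one]
  norm_num

lemma altTheta_seven_sixths {τ : ℂ} (hτ : 0 < τ.im) :
    altTheta (7 / 6) τ = -ModularForm.eta τ := by
  rw [← altTheta_one_sixth hτ, ← altTheta_add_one]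
  norm_num

lemma altTheta_three_halves (τ : ℂ) : altTheta (3 / 2) τ = 0 := by
  have := altTheta_add_one (1 / 2) τ
  rw [altTheta_half] at this
  norm_num at this
  exact this

end

end MockTheta

namespace MockTheta

noncomputable section

open Complex MeasureTheory Set Filter

/-! ### Roots of unity -/

/-- `ex x = e^{2πix}`. -/
def ex (x : ℝ) : ℂ := exp (2 * Real.pi * I * x)

lemma ex_add (x y : ℝ) : ex (x + y) = ex x * ex y := by
  rw [ex, ex, ex, ← exp_add]; congr 1; push_cast; ring

lemma ex_zero : ex 0 = 1 := by simp [ex]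

lemma ex_intCast (n : ℤ) : ex n = 1 := by
  rw [ex, ← exp_int_mul_two_pi_mul_I n]; congr 1; push_cast; ring

lemma ex_half : ex (1 / 2) = -1 := by
  rw [ex, ← exp_pi_mul_I]; congr 1; push_cast; ring

lemma ex_ne_zero (x : ℝ) : ex x ≠ 0 := exp_ne_zero _

lemma ex_eq_of_sub_eq {x y : ℝ} {n : ℤ} (h : x - y = n) : ex x = ex y := by
  rw [show x = y + n by linarith, ex_add, ex_intCast, mul_one]

lemma ex_eq_neg_of_sub_eq {x y : ℝ} {n : ℤ} (h : x - y = n + 1 / 2) : ex x = -ex y := by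
  rw [show x = y + (n + 1 / 2) by linarith, ex_add, ex_add, ex_intCast, ex_half]; ring

lemma norm_ex (x : ℝ) : ‖ex x‖ = 1 := by
  rw [ex, show (2 * Real.pi * I * x : ℂ) = ((2 * Real.pi * x : ℝ) : ℂ) * I by push_cast; ring,
    norm_exp_ofReal_mul_I]

lemma ex_int_mul (n : ℤ) (x : ℝ) : ex (n * x) = ex x ^ n := by
  rw [ex, ex, ← exp_int_mul]; congr 1; push_cast; ring

lemma zeta_eq_ex (n : ℕ) : zeta n = ex (1 / n) := by
  rw [zeta, ex]; congr 1; push_cast; ring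

lemma zeta_zpow_eq_ex (n : ℕ) (k : ℤ) : zeta n ^ k = ex (k / n) := by
  rw [zeta_eq_ex, ← ex_int_mul]; congr 1; ring

lemma zeta_inv_eq_ex (n : ℕ) : (zeta n)⁻¹ = ex (-1 / n) := by
  rw [← zpow_neg_one, zeta_zpow_eq_ex]; push_cast; rfl

lemma ex_neg_one_zpow {h : ℝ} {l : ℤ} (hh : h = l + 1 / 2) (n : ℤ) : ex (h * n) = (-1) ^ n := by
  rw [mul_comm, ex_int_mul, hh, ex_add, ex_intCast, ex_half, one_mul]

/-! ### The terms of the indefinite theta series -/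

/-- The constant `√(14/3)`. -/
def kap : ℝ := 7 / Real.sqrt (21 / 2)

lemma kap_sq : kap ^ 2 = 14 / 3 := by
  rw [kap, div_pow, Real.sq_sqrt (by norm_num)]; norm_num

lemma kap_pos : 0 < kap := by unfold kap; positivity

/-- The exponential factor of the terms of the theta series. -/
def quadExp (h₀ h₁ : ℝ) (τ : ℂ) (x y : ℝ) : ℂ :=
  exp (2 * Real.pi * I * (3 / 2 * x ^ 2 + 4 * x * y + 3 / 2 * y ^ 2) * τ
    + 2 * Real.pi * I * (h₀ * x + h₁ * y))

lemma norm_quadExp (h₀ h₁ : ℝ) (τ : ℂ) (x y : ℝ) : ‖quadExp h₀ h₁ τ x y‖ =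
    Real.exp (-2 * Real.pi * τ.im * (3 / 2 * x ^ 2 + 4 * x * y + 3 / 2 * y ^ 2)) := by
  rw [quadExp, norm_exp]
  congr 1
  have : (2 * Real.pi * I * (3 / 2 * x ^ 2 + 4 * x * y + 3 / 2 * y ^ 2) * τ
    + 2 * Real.pi * I * (h₀ * x + h₁ * y) : ℂ)
    = ((2 * Real.pi * (3 / 2 * x ^ 2 + 4 * x * y + 3 / 2 * y ^ 2) : ℝ) : ℂ) * (I * τ)
      + ((2 * Real.pi * (h₀ * x + h₁ * y) : ℝ) : ℂ) * I := by push_cast; ring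
  rw [this, add_re, re_ofReal_mul, re_ofReal_mul, I_re, I_mul_re]
  ring

/-- Since B(c₁, ν) = 7ν₁ and B(c₂, ν) = -7ν₂, oddness of E turns the difference into a sum, and each
error function sees a single coordinate. -/
lemma indefThetaTerm_eq (a b : Fin 2 → ℝ) (τ : ℂ) (n : Fin 2 → ℤ) :
    indefThetaTerm A7 c71 c72 a b τ n =
      ((errorE (kap * (a 0 + n 0) * Real.sqrt τ.im)
        + errorE (kap * (a 1 + n 1) * Real.sqrt τ.im) : ℝ) : ℂ) *
      quadExp (3 * b 0 + 4 * b 1) (4 * b 0 + 3 * b 1) τ (a 0 + n 0) (a 1 + n 1) := by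
  have hb1 : ∀ ν : Fin 2 → ℝ, bilin A7 c71 ν = 7 * ν 0 := fun ν => by
    simp [bilin, A7, c71, Matrix.mulVec, dotProduct, Fin.sum_univ_two]; ring
  have hb2 : ∀ ν : Fin 2 → ℝ, bilin A7 c72 ν = -(7 * ν 1) := fun ν => by
    simp [bilin, A7, c72, Matrix.mulVec, dotProduct, Fin.sum_univ_two]; ring
  have hq1 : quad A7 c71 = -(21 / 2) := by rw [quad, hb1]; simp [c71]; norm_num
  have hq2 : quad A7 c72 = -(21 / 2) := by rw [quad, hb2]; simp [c72]; norm_num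
  have hq : ∀ ν : Fin 2 → ℝ, quad A7 ν
      = 3 / 2 * ν 0 ^ 2 + 4 * ν 0 * ν 1 + 3 / 2 * ν 1 ^ 2 := fun ν => by
    simp [quad, bilin, A7, Matrix.mulVec, dotProduct, Fin.sum_univ_two]; ring
  have hbb : ∀ ν : Fin 2 → ℝ, bilin A7 ν b
      = (3 * b 0 + 4 * b 1) * ν 0 + (4 * b 0 + 3 * b 1) * ν 1 := fun ν => by
    simp [bilin, A7, Matrix.mulVec, dotProduct, Fin.sum_univ_two]; ring
  simp only [indefThetaTerm, rhoFactor, hb1, hb2, hq1, hq2, hq, hbb, neg_neg]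
  rw [if_pos (by norm_num), if_pos (by norm_num)]
  congr 1
  · congr 1
    rw [neg_div, neg_mul, errorE_neg, sub_neg_eq_add]
    congr 2 <;> rw [kap] <;> ring
  · rw [quadExp]
    congr 1
    push_cast
    ring

/-- If xy < 0 the signs cancel exactly; if xy ≥ 0 the cross term only helps and the indefinite form
is bounded below by a definite one. -/
lemma sign_add_sign_mul_le (x y : ℝ) {c : ℝ} (hc : 0 ≤ c) :
    |Real.sign x + Real.sign y| * Real.exp (-2 * c * (3 / 2 * x ^ 2 + 4 * x * y + 3 / 2 * y ^ 2))
      ≤ 2 * Real.exp (-(c / 2) * (x ^ 2 + y ^ 2)) := by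
  have key : 0 ≤ x * y → Real.exp (-2 * c * (3 / 2 * x ^ 2 + 4 * x * y + 3 / 2 * y ^ 2))
      ≤ Real.exp (-(c / 2) * (x ^ 2 + y ^ 2)) := fun h => by
    refine Real.exp_le_exp.2 ?_
    have h1 := mul_nonneg hc h
    have h2 := mul_nonneg hc (sq_nonneg x)
    have h3 := mul_nonneg hc (sq_nonneg y)
    nlinarith
  have hp := Real.exp_pos (-(c / 2) * (x ^ 2 + y ^ 2))
  have hs : ∀ z, |Real.sign z| ≤ 1 := fun z => by
    rcases Real.sign_apply_eq z with h | h | h <;> rw [h] <;> norm_num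
  rcases le_or_gt 0 (x * y) with h | h
  · exact mul_le_mul ((abs_add_le _ _).trans (by linarith [hs x, hs y])) (key h)
      (Real.exp_pos _).le two_pos.le
  · have : Real.sign x + Real.sign y = 0 := by
      rcases mul_neg_iff.1 h with ⟨h1, h2⟩ | ⟨h1, h2⟩
      · rw [Real.sign_of_pos h1, Real.sign_of_neg h2]; norm_num
      · rw [Real.sign_of_neg h1, Real.sign_of_pos h2]; norm_num
    rw [this, abs_zero, zero_mul]
    positivity

/-- The decay of β adds (14/3)x² to 3x² + 8xy + 3y². The result is positive definite, since (23/3)·3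
> 4², with enough room to retain (x² + y²)/2. -/
lemma sign_mul_beta_mul_le (x y : ℝ) {c : ℝ} (hc : 0 ≤ c) :
    |Real.sign x * beta (14 / 3 * x ^ 2 * c)| *
      Real.exp (-2 * Real.pi * c * (3 / 2 * x ^ 2 + 4 * x * y + 3 / 2 * y ^ 2))
      ≤ Real.exp (-(Real.pi * c / 2) * (x ^ 2 + y ^ 2)) := by
  have hb : 0 ≤ 14 / 3 * x ^ 2 * c := by positivity
  have hs : |Real.sign x| ≤ 1 := by
    rcases Real.sign_apply_eq x with h | h | h <;> rw [h] <;> norm_num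
  rw [abs_mul, abs_of_nonneg (beta_nonneg hb)]
  calc _ ≤ 1 * Real.exp (-Real.pi * (14 / 3 * x ^ 2 * c)) *
        Real.exp (-2 * Real.pi * c * (3 / 2 * x ^ 2 + 4 * x * y + 3 / 2 * y ^ 2)) := by
        have := beta_le hb
        have := beta_nonneg hb
        gcongr
    _ ≤ _ := by
        rw [one_mul, ← Real.exp_add]
        refine Real.exp_le_exp.2 ?_
        have h1 : 0 ≤ Real.pi * c := mul_nonneg Real.pi_pos.le hc
        have h2 : 0 ≤ (43 / 6) * x ^ 2 + 8 * x * y + 5 / 2 * y ^ 2 := by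
          nlinarith [sq_nonneg (5 * y + 8 * x), sq_nonneg x]
        nlinarith [mul_nonneg h1 h2]

lemma summable_exp_shifted {c : ℝ} (hc : 0 < c) (a₀ a₁ : ℝ) : Summable fun n : ℤ × ℤ =>
    Real.exp (-c * ((a₀ + n.1) ^ 2 + (a₁ + n.2) ^ 2)) := by
  refine Summable.of_nonneg_of_le (fun _ => (Real.exp_pos _).le) (fun n => ?_)
    (summable_exp_neg_sq_prod hc (2 * c * (|a₀| + |a₁|)) 0)
  refine Real.exp_le_exp.2 ?_
  have h1 : -(a₀ * n.1) ≤ |a₀| * |(n.1 : ℝ)| := by rw [← abs_mul]; exact neg_le_abs _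
  have h2 : -(a₁ * n.2) ≤ |a₁| * |(n.2 : ℝ)| := by rw [← abs_mul]; exact neg_le_abs _
  have h3 : 0 ≤ |a₀| * |(n.2 : ℝ)| + |a₁| * |(n.1 : ℝ)| := by positivity
  have h4 : -(a₀ * n.1) - a₁ * n.2 ≤ (|a₀| + |a₁|) * (|(n.1 : ℝ)| + |(n.2 : ℝ)|) := by linarith
  have h5 := mul_le_mul_of_nonneg_left h4 (mul_pos two_pos hc).le
  nlinarith [mul_nonneg hc.le (sq_nonneg a₀), mul_nonneg hc.le (sq_nonneg a₁)]

lemma summable_sign_quadExp (a₀ a₁ h₀ h₁ : ℝ) {τ : ℂ} (hτ : 0 < τ.im) :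
    Summable fun n : ℤ × ℤ => ((Real.sign (a₀ + n.1) + Real.sign (a₁ + n.2) : ℝ) : ℂ) *
      quadExp h₀ h₁ τ (a₀ + n.1) (a₁ + n.2) := by
  refine Summable.of_norm_bounded
    ((summable_exp_shifted (c := Real.pi * τ.im / 2)
      (by have := Real.pi_pos; positivity) a₀ a₁).mul_left 2) fun n => ?_
  rw [norm_mul, norm_real, norm_quadExp, Real.norm_eq_abs]
  have := sign_add_sign_mul_le (a₀ + n.1) (a₁ + n.2) (mul_pos Real.pi_pos hτ).le
  rwa [← mul_assoc (-2 : ℝ)] at this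

lemma summable_beta_quadExp (a₀ a₁ h₀ h₁ : ℝ) {τ : ℂ} (hτ : 0 < τ.im) :
    Summable fun n : ℤ × ℤ =>
      ((Real.sign (a₀ + n.1) * beta (14 / 3 * (a₀ + n.1) ^ 2 * τ.im) : ℝ) : ℂ) *
      quadExp h₀ h₁ τ (a₀ + n.1) (a₁ + n.2) := by
  refine Summable.of_norm_bounded
    (summable_exp_shifted (c := Real.pi * τ.im / 2)
      (by have := Real.pi_pos; positivity) a₀ a₁) fun n => ?_
  rw [norm_mul, norm_real, norm_quadExp, Real.norm_eq_abs]
  exact sign_mul_beta_mul_le _ _ hτ.le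

lemma quadExp_swap (h₀ h₁ : ℝ) (τ : ℂ) (x y : ℝ) : quadExp h₀ h₁ τ x y = quadExp h₁ h₀ τ y x := by
  rw [quadExp, quadExp]; congr 1; ring

lemma summable_beta_quadExp' (a₀ a₁ h₀ h₁ : ℝ) {τ : ℂ} (hτ : 0 < τ.im) :
    Summable fun n : ℤ × ℤ =>
      ((Real.sign (a₁ + n.2) * beta (14 / 3 * (a₁ + n.2) ^ 2 * τ.im) : ℝ) : ℂ) *
      quadExp h₀ h₁ τ (a₀ + n.1) (a₁ + n.2) := by
  refine ((Equiv.prodComm ℤ ℤ).summable_iff.2 (summable_beta_quadExp a₁ a₀ h₁ h₀ hτ)).congr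
    fun n => ?_
  simp only [Function.comp_apply, Equiv.prodComm_apply, Prod.fst_swap, Prod.snd_swap]
  rw [quadExp_swap]

lemma errorE_kap (x : ℝ) {y : ℝ} (hy : 0 < y) : errorE (kap * x * Real.sqrt y)
    = Real.sign x - Real.sign x * beta (14 / 3 * x ^ 2 * y) := by
  rw [errorE_eq, mul_pow, mul_pow, kap_sq, Real.sq_sqrt hy.le, mul_sub, mul_one]
  have : Real.sign (kap * x * Real.sqrt y) = Real.sign x := by
    have h1 := kap_pos
    have h2 := Real.sqrt_pos.2 hy
    rcases lt_trichotomy x 0 with h | h | h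
    · rw [Real.sign_of_neg h, Real.sign_of_neg]
      exact mul_neg_of_neg_of_pos (mul_neg_of_pos_of_neg h1 h) h2
    · simp [h]
    · rw [Real.sign_of_pos h, Real.sign_of_pos]
      positivity
  rw [this]

lemma summable_errorE_quadExp (a₀ a₁ h₀ h₁ : ℝ) {τ : ℂ} (hτ : 0 < τ.im) :
    Summable fun n : ℤ × ℤ => ((errorE (kap * (a₀ + n.1) * Real.sqrt τ.im)
        + errorE (kap * (a₁ + n.2) * Real.sqrt τ.im) : ℝ) : ℂ) *
      quadExp h₀ h₁ τ (a₀ + n.1) (a₁ + n.2) := by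
  refine (((summable_sign_quadExp a₀ a₁ h₀ h₁ hτ).sub
    (summable_beta_quadExp a₀ a₁ h₀ h₁ hτ)).sub
    (summable_beta_quadExp' a₀ a₁ h₀ h₁ hτ)).congr fun n => ?_
  rw [errorE_kap _ hτ, errorE_kap _ hτ]
  push_cast
  ring

lemma summable_indefThetaTerm (a b : Fin 2 → ℝ) {τ : ℂ} (hτ : 0 < τ.im) :
    Summable (indefThetaTerm A7 c71 c72 a b τ) := by
  rw [← (finTwoArrowEquiv ℤ).symm.summable_iff]
  refine (summable_errorE_quadExp (a 0) (a 1) (3 * b 0 + 4 * b 1) (4 * b 0 + 3 * b 1) hτ).congr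
    fun n => ?_
  rw [Function.comp_apply, indefThetaTerm_eq]
  simp

lemma theta7_eq (s t : ℝ) (τ : ℂ) : theta7 s t τ = ∑' n : ℤ × ℤ,
    ((errorE (kap * (s + n.1) * Real.sqrt τ.im)
        + errorE (kap * (s + n.2) * Real.sqrt τ.im) : ℝ) : ℂ) *
      quadExp (7 * t) (7 * t) τ (s + n.1) (s + n.2) := by
  rw [theta7, indefTheta, ← (finTwoArrowEquiv ℤ).symm.tsum_eq]
  refine tsum_congr fun n => ?_
  rw [indefThetaTerm_eq]
  simp only [finTwoArrowEquiv_symm_apply, Matrix.cons_val_zero, Matrix.cons_val_one]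
  rw [show 3 * t + 4 * t = 7 * t by ring, show 4 * t + 3 * t = 7 * t by ring]

/-! ### The unary series -/

/-- The exponential grows like e^{πν²y}, but β(2ν²y) ≤ e^{-2πν²y} overcompensates. -/
lemma norm_unaryTerm_le (a b : ℝ) {τ : ℂ} (hτ : 0 ≤ τ.im) (n : ℤ) :
    ‖unaryTerm a b τ n‖ ≤ Real.exp (-(Real.pi * τ.im) * (a + n) ^ 2) := by
  have hb : 0 ≤ 2 * (a + n) ^ 2 * τ.im := by positivity
  have hs : |Real.sign (a + n)| ≤ 1 := by
    rcases Real.sign_apply_eq (a + n) with h | h | h <;> rw [h] <;> norm_num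
  have hn : ‖exp (-Real.pi * I * ((a + n : ℝ) : ℂ) ^ 2 * τ - 2 * Real.pi * I * ((a + n : ℝ) : ℂ) * b)‖
      = Real.exp (Real.pi * τ.im * (a + n) ^ 2) := by
    rw [norm_exp]
    congr 1
    have : (-Real.pi * I * ((a + n : ℝ) : ℂ) ^ 2 * τ - 2 * Real.pi * I * ((a + n : ℝ) : ℂ) * b : ℂ)
      = ((-Real.pi * (a + n) ^ 2 : ℝ) : ℂ) * (I * τ)
        + ((-2 * Real.pi * (a + n) * b : ℝ) : ℂ) * I := by push_cast; ring
    rw [this, add_re, re_ofReal_mul, re_ofReal_mul, I_re, I_mul_re]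
    ring
  rw [unaryTerm, norm_mul, hn, norm_real, Real.norm_eq_abs, abs_mul,
    abs_of_nonneg (beta_nonneg hb)]
  calc _ ≤ 1 * Real.exp (-Real.pi * (2 * (a + n) ^ 2 * τ.im)) *
        Real.exp (Real.pi * τ.im * (a + n) ^ 2) := by
        have := beta_le hb
        have := beta_nonneg hb
        gcongr
    _ = _ := by
        rw [one_mul, ← Real.exp_add]
        congr 1
        ring

lemma summable_exp_shifted_one {c : ℝ} (hc : 0 < c) (a : ℝ) : Summable fun n : ℤ =>
    Real.exp (-c * (a + n) ^ 2) := by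
  refine Summable.of_nonneg_of_le (fun _ => (Real.exp_pos _).le) (fun n => ?_)
    (summable_exp_neg_sq_add_abs hc (2 * c * |a|))
  refine Real.exp_le_exp.2 ?_
  have h1 : -(a * n) ≤ |a| * |(n : ℝ)| := by rw [← abs_mul]; exact neg_le_abs _
  have h5 := mul_le_mul_of_nonneg_left h1 (mul_pos two_pos hc).le
  nlinarith [mul_nonneg hc.le (sq_nonneg a)]

lemma summable_unaryTerm (a b : ℝ) {τ : ℂ} (hτ : 0 < τ.im) : Summable (unaryTerm a b τ) :=
  Summable.of_norm_bounded (summable_exp_shifted_one (mul_pos Real.pi_pos hτ) a)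
    (norm_unaryTerm_le a b hτ.le)

lemma unaryR_add_one (a b : ℝ) (τ : ℂ) : unaryR (a + 1) b τ = unaryR a b τ := by
  rw [unaryR, unaryR, ← (Equiv.addRight (1 : ℤ)).tsum_eq (unaryTerm a b τ)]
  refine tsum_congr fun n => ?_
  simp only [unaryTerm, Equiv.coe_addRight]
  rw [show a + 1 + (n : ℝ) = a + ((n + 1 : ℤ) : ℝ) by push_cast; ring]

lemma unaryR_neg (a b : ℝ) (τ : ℂ) : unaryR (-a) (-b) τ = -unaryR a b τ := by
  rw [unaryR, unaryR, ← (Equiv.neg ℤ).tsum_eq, ← tsum_neg]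
  refine tsum_congr fun n => ?_
  simp only [unaryTerm, Equiv.neg_apply]
  rw [show -a + ((-n : ℤ) : ℝ) = -(a + n) by push_cast; ring, neg_sq, Real.sign_neg]
  push_cast
  rw [neg_mul (_ : ℂ), neg_mul (_ : ℂ)]
  congr 3
  ring

/-! ### Splitting the theta series -/

/-- The vectors (3,-4) and (0,1) are B-orthogonal with Q = -21/2 and Q = 3/2, so the form separates
into -(21/2)μ² + (3/2)κ² with μ = m + (j+s)/3 and κ = k + (j+7s)/3. -/
lemma quadExp_split (h s : ℝ) (τ : ℂ) (m k : ℤ) (j : ℝ) :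
    quadExp h h τ (s + (3 * m + j)) (s + (k - 4 * m - j))
      = ex (h * ((j + 7 * s) / 3)) *
        (exp (-Real.pi * I * (((j + s) / 3 + m : ℝ) : ℂ) ^ 2 * (21 * τ)
          - 2 * Real.pi * I * (((j + s) / 3 + m : ℝ) : ℂ) * h) *
        (ex (h * k) * exp (3 * Real.pi * I * (k + ((j + 7 * s) / 3 : ℝ)) ^ 2 * τ))) := by
  rw [quadExp, ex, ex, ← exp_add, ← exp_add, ← exp_add]
  congr 1
  push_cast
  ring

lemma tsum_int_eq_sum_fin (N : ℕ) [NeZero N] {f : ℤ → ℂ} (hf : Summable f) :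
    ∑' n, f n = ∑ j : Fin N, ∑' m : ℤ, f (N * m + (j : ℕ)) := by
  have hS := (Equiv.prodComm (Fin N) ℤ).summable_iff.2 ((Int.divModEquiv N).symm.summable_iff.2 hf)
  rw [← (Int.divModEquiv N).symm.tsum_eq, ← (Equiv.prodComm (Fin N) ℤ).tsum_eq]
  refine (Summable.tsum_prod hS).trans ?_
  rw [tsum_fintype]
  refine Finset.sum_congr rfl fun j _ => tsum_congr fun m => ?_
  simp [Int.divModEquiv, mul_comm]

/-- The factor sign·β depends on the first coordinate only, hence only on μ in `quadExp_split`, so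
the sum over each of the three cosets is a product. A half-integral h makes the character of k equal
to (-1)^k. -/
lemma tsum_sign_beta_quadExp {h : ℝ} {l : ℤ} (hh : h = l + 1 / 2) (s : ℝ) {τ : ℂ}
    (hτ : 0 < τ.im) :
    ∑' n : ℤ × ℤ, ((Real.sign (s + n.1) * beta (14 / 3 * (s + n.1) ^ 2 * τ.im) : ℝ) : ℂ) *
      quadExp h h τ (s + n.1) (s + n.2)
      = ∑ j : Fin 3, ex (h * (((j : ℕ) + 7 * s) / 3)) *
        (unaryR (((j : ℕ) + s) / 3) h (21 * τ) * altTheta (((j : ℕ) + 7 * s) / 3) τ) := by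
  have hS := summable_beta_quadExp s s h h hτ
  rw [hS.tsum_prod, tsum_int_eq_sum_fin 3 hS.prod]
  refine Finset.sum_congr rfl fun j _ => ?_
  rw [unaryR, ← tsum_mul_right, ← tsum_mul_left]
  refine tsum_congr fun m => ?_
  -- For fixed m and j the second coordinate is reindexed as k - 4m - j, the shift that diagonalizes
  -- the form.
  rw [← (Equiv.subRight (4 * m + (j : ℕ) : ℤ)).tsum_eq, altTheta, ← tsum_mul_left, ← tsum_mul_left]
  refine tsum_congr fun k => ?_
  simp only [Equiv.subRight_apply]
  have e0 : (s + ((((3 : ℕ) : ℤ) * m + (j : ℕ) : ℤ) : ℝ)) = s + (3 * m + ((j : ℕ) : ℝ)) := by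
    push_cast; ring
  have e1 : (s + ((k - (4 * m + (j : ℕ)) : ℤ) : ℝ)) = s + (k - 4 * m - ((j : ℕ) : ℝ)) := by
    push_cast; ring
  rw [e0, e1, quadExp_split, unaryTerm, ex_neg_one_zpow hh]
  have e2 : s + (3 * m + ((j : ℕ) : ℝ)) = 3 * (((j : ℕ) + s) / 3 + m) := by ring
  have e3 : Real.sign (3 * ((((j : ℕ) : ℝ) + s) / 3 + m)) = Real.sign ((((j : ℕ) : ℝ) + s) / 3 + m) := by
    generalize (((j : ℕ) : ℝ) + s) / 3 + m = x
    rcases lt_trichotomy x 0 with h | h | h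
    · rw [Real.sign_of_neg h, Real.sign_of_neg (by linarith)]
    · simp [h]
    · rw [Real.sign_of_pos h, Real.sign_of_pos (by linarith)]
  have e4 : 14 / 3 * (3 * ((((j : ℕ) : ℝ) + s) / 3 + m)) ^ 2 * τ.im
      = 2 * ((((j : ℕ) : ℝ) + s) / 3 + m) ^ 2 * (21 * τ).im := by
    simp; ring
  rw [e2, e3, e4]
  ring

lemma sign_add_sign_eq {s : ℝ} (h0 : 0 < s) (h1 : s < 1) (n : ℤ × ℤ) :
    ((Real.sign (s + n.1) + Real.sign (s + n.2) : ℝ) : ℂ) = 2 * quadrantSign n.1 n.2 := by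
  have key : ∀ m : ℤ, Real.sign (s + m) = if 0 ≤ m then 1 else -1 := fun m => by
    split_ifs with h
    · have : (0 : ℝ) ≤ m := by exact_mod_cast h
      exact Real.sign_of_pos (by linarith)
    · have : (m : ℝ) ≤ -1 := by exact_mod_cast (by omega : m ≤ -1)
      exact Real.sign_of_neg (by linarith)
  rw [key, key, quadrantSign]
  by_cases h2 : 0 ≤ n.1 <;> by_cases h3 : 0 ≤ n.2
  · rw [if_pos h2, if_pos h3, if_pos ⟨h2, h3⟩]; norm_num
  · rw [if_pos h2, if_neg h3, if_neg (fun h => h3 h.2), if_neg (fun h => absurd h.1 (not_lt.2 h2))]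
    norm_num
  · rw [if_neg h2, if_pos h3, if_neg (fun h => h2 h.1), if_neg (fun h => absurd h.2 (not_lt.2 h3))]
    norm_num
  · rw [if_neg h2, if_neg h3, if_neg (fun h => h3 h.2), if_pos ⟨not_le.1 h2, not_le.1 h3⟩]
    norm_num

lemma summable_quadrantSign_quadExp {s : ℝ} (h0 : 0 < s) (h1 : s < 1) (h : ℝ) {τ : ℂ}
    (hτ : 0 < τ.im) : Summable fun n : ℤ × ℤ =>
      quadrantSign n.1 n.2 * quadExp h h τ (s + n.1) (s + n.2) := by
  refine ((summable_sign_quadExp s s h h hτ).mul_left (1 / 2)).congr fun n => ?_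
  rw [sign_add_sign_eq h0 h1]
  ring

/-- For 0 < s < 1 no coordinate s + n vanishes and its sign is that of n, with n = 0 counted as
positive, as in `quadrantSign`. The symmetry of the form merges the two β sums. -/
lemma theta7_eq_sub {s t : ℝ} (h0 : 0 < s) (h1 : s < 1) {τ : ℂ} (hτ : 0 < τ.im) :
    theta7 s t τ = 2 * ∑' n : ℤ × ℤ,
      quadrantSign n.1 n.2 * quadExp (7 * t) (7 * t) τ (s + n.1) (s + n.2)
      - 2 * ∑' n : ℤ × ℤ, ((Real.sign (s + n.1) * beta (14 / 3 * (s + n.1) ^ 2 * τ.im) : ℝ) : ℂ) *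
        quadExp (7 * t) (7 * t) τ (s + n.1) (s + n.2) := by
  have hS1 := summable_quadrantSign_quadExp h0 h1 (7 * t) hτ
  have hS2 := summable_beta_quadExp s s (7 * t) (7 * t) hτ
  have hS3 := summable_beta_quadExp' s s (7 * t) (7 * t) hτ
  have hswap : ∑' n : ℤ × ℤ, ((Real.sign (s + n.2) * beta (14 / 3 * (s + n.2) ^ 2 * τ.im) : ℝ) : ℂ) *
        quadExp (7 * t) (7 * t) τ (s + n.1) (s + n.2)
      = ∑' n : ℤ × ℤ, ((Real.sign (s + n.1) * beta (14 / 3 * (s + n.1) ^ 2 * τ.im) : ℝ) : ℂ) *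
        quadExp (7 * t) (7 * t) τ (s + n.1) (s + n.2) := by
    rw [← (Equiv.prodComm ℤ ℤ).tsum_eq]
    refine tsum_congr fun n => ?_
    simp only [Equiv.prodComm_apply, Prod.fst_swap, Prod.snd_swap]
    rw [quadExp_swap]
  have key : theta7 s t τ = 2 * ∑' n : ℤ × ℤ,
      quadrantSign n.1 n.2 * quadExp (7 * t) (7 * t) τ (s + n.1) (s + n.2)
      - ∑' n : ℤ × ℤ, ((Real.sign (s + n.1) * beta (14 / 3 * (s + n.1) ^ 2 * τ.im) : ℝ) : ℂ) *
        quadExp (7 * t) (7 * t) τ (s + n.1) (s + n.2)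
      - ∑' n : ℤ × ℤ, ((Real.sign (s + n.2) * beta (14 / 3 * (s + n.2) ^ 2 * τ.im) : ℝ) : ℂ) *
        quadExp (7 * t) (7 * t) τ (s + n.1) (s + n.2) := by
    rw [theta7_eq, ← tsum_mul_left, ← (hS1.mul_left 2).tsum_sub hS2,
      ← ((hS1.mul_left 2).sub hS2).tsum_sub hS3]
    refine tsum_congr fun n => ?_
    rw [errorE_kap _ hτ, errorE_kap _ hτ, ← mul_assoc, ← sign_add_sign_eq h0 h1]
    push_cast
    ring
  rw [key, hswap]
  ring

/-! ### The mock theta functions -/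

/-- Because Ae = 7e, shifting by (k/14)e adds the linear term (k/2)(r+s) and the constant Q((k/14)e)
= k²/28. Oddness of k makes the integer division in `hickersonTerm` exact. -/
lemma quadrantSign_mul_quadExp {k : ℤ} (hk : Odd k) {h : ℝ} {l : ℤ} (hh : h = l + 1 / 2)
    (τ : ℂ) (n : ℤ × ℤ) :
    quadrantSign n.1 n.2 * quadExp h h τ (k / 14 + n.1) (k / 14 + n.2)
      = ex (h * k / 7) * qPow ((k : ℝ) ^ 2 / 28) τ * hickersonTerm k 0 (qPow 1 τ) n := by
  obtain ⟨r, s⟩ := n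
  obtain ⟨N, hN⟩ : ∃ N : ℤ, 3 * r ^ 2 + 8 * r * s + 3 * s ^ 2 + k * (r + s) = 2 * N := by
    obtain ⟨a, ha⟩ := hk
    obtain ⟨b, hb⟩ := Int.even_mul_succ_self r
    obtain ⟨c, hc⟩ := Int.even_mul_succ_self s
    exact ⟨r ^ 2 + 4 * r * s + s ^ 2 + a * (r + s) + b + c, by rw [ha]; linear_combination hb + hc⟩
  rw [hickersonTerm]
  simp only
  rw [hN, Int.mul_ediv_cancel_left _ two_ne_zero, add_zero, qPow_one_zpow, ← ex_neg_one_zpow hh]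
  have hN' : (3 * r ^ 2 + 8 * r * s + 3 * s ^ 2 + k * (r + s) : ℂ) = 2 * N := by exact_mod_cast hN
  have key : quadExp h h τ (k / 14 + r) (k / 14 + s) =
      ex (h * k / 7) * qPow ((k : ℝ) ^ 2 / 28) τ * (ex (h * ((r + s : ℤ) : ℝ)) * qPow N τ) := by
    rw [quadExp, ex, ex, qPow, qPow, ← exp_add, ← exp_add, ← exp_add]
    congr 1
    push_cast
    linear_combination (Real.pi * I * τ) * hN'
  rw [key]
  ring

lemma summable_hickersonTerm_zero {k : ℤ} (hk : Odd k) (h0 : 0 < k) (h1 : k < 14) {τ : ℂ}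
    (hτ : 0 < τ.im) : Summable (hickersonTerm k 0 (qPow 1 τ)) := by
  have h0' : (0 : ℝ) < k := by exact_mod_cast h0
  have h1' : (k : ℝ) < 14 := by exact_mod_cast h1
  have hS := summable_quadrantSign_quadExp (s := k / 14) (by positivity)
    (by rw [div_lt_one (by norm_num)]; exact h1') (1 / 2) hτ
  simp_rw [quadrantSign_mul_quadExp hk (show (1 / 2 : ℝ) = (0 : ℤ) + 1 / 2 by norm_num)] at hS
  exact (summable_mul_left_iff (mul_ne_zero (ex_ne_zero _) (qPow_ne_zero _ _))).1 hS

lemma hickersonTerm_add (k c : ℤ) {q : ℂ} (hq : q ≠ 0) (p : ℤ × ℤ) :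
    hickersonTerm k c q p = q ^ c * hickersonTerm k 0 q p := by
  rw [hickersonTerm, hickersonTerm, add_zero, zpow_add₀ hq]
  ring

lemma summable_hickersonTerm {k : ℤ} (hk : Odd k) (h0 : 0 < k) (h1 : k < 14) (c : ℤ) {τ : ℂ}
    (hτ : 0 < τ.im) : Summable (hickersonTerm k c (qPow 1 τ)) :=
  ((summable_hickersonTerm_zero hk h0 h1 hτ).mul_left (qPow 1 τ ^ c)).congr
    fun p => (hickersonTerm_add k c (qPow_ne_zero 1 τ) p).symm

lemma eta_ne_zero {τ : ℂ} (hτ : 0 < τ.im) : ModularForm.eta τ ≠ 0 := ModularForm.eta_ne_zero hτ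

/-- A common form of the decomposition for the three components, used with (k, h) = (1, 1/2), (3,
5/2), (5, 3/2). -/
lemma zeta_inv_mul_theta7 {k : ℤ} (hk : Odd k) (h0 : 0 < k) (h1 : k < 14) {h : ℝ} {l : ℤ}
    (hh : h = l + 1 / 2) {τ : ℂ} (hτ : 0 < τ.im) :
    (zeta 14)⁻¹ / (2 * ModularForm.eta τ) * theta7 (k / 14) (h / 7) τ
      = ex (h * k / 7 - 1 / 14) * (qPow ((k : ℝ) ^ 2 / 28) τ * (∑' p, hickersonTerm k 0 (qPow 1 τ) p)
          / ModularForm.eta τ)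
        - ∑ j : Fin 3, ex (h * (((j : ℕ) + k / 2) / 3) - 1 / 14) *
          (unaryR (((j : ℕ) + k / 14) / 3) h (21 * τ)
            * (altTheta (((j : ℕ) + k / 2) / 3) τ / ModularForm.eta τ)) := by
  have h0' : (0 : ℝ) < k := by exact_mod_cast h0
  have h1' : (k : ℝ) < 14 := by exact_mod_cast h1
  have hη := eta_ne_zero hτ
  have e14 : zeta 14 ≠ 0 := exp_ne_zero _
  rw [theta7_eq_sub (by positivity) (by rw [div_lt_one (by norm_num)]; exact h1') hτ,
    mul_div_cancel₀ h (by norm_num : (7 : ℝ) ≠ 0)]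
  simp_rw [quadrantSign_mul_quadExp hk hh]
  rw [tsum_sign_beta_quadExp hh _ hτ, tsum_mul_left, mul_sub]
  have e7 : (7 : ℝ) * (k / 14) = k / 2 := by ring
  rw [e7]
  have eex : ∀ x : ℝ, ex (x - 1 / 14) = (zeta 14)⁻¹ * ex x := fun x => by
    rw [zeta_inv_eq_ex, ← ex_add]; congr 1; push_cast; ring
  congr 1
  · rw [eex]
    field_simp
  · rw [Finset.mul_sum, Finset.mul_sum]
    refine Finset.sum_congr rfl fun j _ => ?_
    rw [eex]
    field_simp

lemma qPow_mul_div_qInfinity (a b : ℝ) (hab : b = a + 1 / 24) (τ S : ℂ) :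
    qPow a τ * (S / qInfinity (qPow 1 τ)) = qPow b τ * S / ModularForm.eta τ := by
  have h : qPow (1 / 24) τ ≠ 0 := qPow_ne_zero _ _
  rw [eta_eq, hab, qPow_add]
  -- If the product vanishes, both quotients are 0 by the convention for division by zero, so τ may
  -- be arbitrary.
  by_cases h0 : qInfinity (qPow 1 τ) = 0
  · simp [h0]
  · field_simp

/-- From R_{1-a,-b} = -R_{a,b}. It brings the characteristics to those of G₇; in the primed variant
a half-integral shift of the phase supplies a second sign. -/
lemma ex_mul_unaryR_reflect {c c' a a' b b' : ℝ} {τ : ℂ} {n : ℤ} (hc : c' - c = n)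
    (ha : a' = 1 - a) (hb : b' = -b) : ex c * unaryR a b τ = -(ex c' * unaryR a' b' τ) := by
  rw [ha, hb, show 1 - a = -a + 1 by ring, unaryR_add_one, unaryR_neg, ex_eq_of_sub_eq hc]
  ring

lemma ex_mul_unaryR_reflect' {c c' a a' b b' : ℝ} {τ : ℂ} {n : ℤ} (hc : c' - c = n + 1 / 2)
    (ha : a' = 1 - a) (hb : b' = -b) : ex c * unaryR a b τ = ex c' * unaryR a' b' τ := by
  rw [ha, hb, show 1 - a = -a + 1 by ring, unaryR_add_one, unaryR_neg, ex_eq_neg_of_sub_eq hc]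
  ring

theorem F7_eq_H7_add_G7 {τ : ℂ} (hτ : 0 < τ.im) : F7 τ = H7 τ + G7 τ := by
  have hη := eta_ne_zero hτ
  have hA := zeta_inv_mul_theta7 (k := 1) (by decide) (by norm_num) (by norm_num)
    (show (1 / 2 : ℝ) = (0 : ℤ) + 1 / 2 by norm_num) hτ
  have hB := zeta_inv_mul_theta7 (k := 3) (by decide) (by norm_num) (by norm_num)
    (show (5 / 2 : ℝ) = (2 : ℤ) + 1 / 2 by norm_num) hτ
  have hC := zeta_inv_mul_theta7 (k := 5) (by decide) (by norm_num) (by norm_num)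
    (show (3 / 2 : ℝ) = (1 : ℤ) + 1 / 2 by norm_num) hτ
  rw [Fin.sum_univ_three] at hA hB hC
  -- The alternating theta series occur at 1/6, 1/2, 5/6, then at 1/2, 5/6, 7/6, then at 5/6, 7/6,
  -- 3/2. The half-integral entry drops out each time, and the other two are ±η.
  norm_num [altTheta_half, altTheta_three_halves, ex_zero] at hA hB hC
  have ex1 : ex 1 = 1 := by simpa using ex_intCast 1
  rw [altTheta_one_sixth hτ, altTheta_five_sixths hτ, neg_div, div_self hη, mul_one, mul_neg_one,
    mul_neg, ex_mul_unaryR_reflect (c' := 1 / 84) (c := 1 / 84) (a := 1 / 42) (a' := 41 / 42) (b' := -1 / 2) (n := 0)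
      (by norm_num) (by norm_num) (by norm_num),
    ex_mul_unaryR_reflect' (c' := -13 / 84) (c := 29 / 84) (a := 29 / 42) (a' := 13 / 42) (b' := -1 / 2) (n := -1)
      (by norm_num) (by norm_num) (by norm_num)] at hA
  rw [altTheta_seven_sixths hτ, altTheta_five_sixths hτ, neg_div, div_self hη, mul_neg_one,
    mul_neg_one, mul_neg, mul_neg, ex1, one_mul,
    ex_mul_unaryR_reflect' (c' := -41 / 84) (c := 169 / 84) (a := 17 / 42) (a' := 25 / 42) (b' := -5 / 2) (n := -3)
      (by norm_num) (by norm_num) (by norm_num),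
    ex_mul_unaryR_reflect' (c' := 29 / 84) (c := 239 / 84) (a := 31 / 42) (a' := 11 / 42) (b' := -5 / 2) (n := -3)
      (by norm_num) (by norm_num) (by norm_num)] at hB
  rw [altTheta_seven_sixths hτ, altTheta_five_sixths hτ, neg_div, div_self hη, mul_neg_one,
    mul_neg_one, mul_neg, mul_neg, ex1, one_mul,
    ex_mul_unaryR_reflect' (c' := -9 / 28) (c := 33 / 28) (a := 5 / 42) (a' := 37 / 42) (b' := -3 / 2) (n := -2)
      (by norm_num) (by norm_num) (by norm_num),
    ex_mul_unaryR_reflect' (c' := 5 / 28) (c := 47 / 28) (a := 19 / 42) (a' := 23 / 42) (b' := -3 / 2) (n := -2)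
      (by norm_num) (by norm_num) (by norm_num)] at hC
  have hF0 := qPow_mul_div_qInfinity (-1 / 168) (1 / 28) (by norm_num) τ
    (∑' p, hickersonTerm 1 0 (qPow 1 τ) p)
  have hF2 := qPow_mul_div_qInfinity (47 / 168) (9 / 28) (by norm_num) τ
    (∑' p, hickersonTerm 3 0 (qPow 1 τ) p)
  have hF1 := qPow_mul_div_qInfinity (-25 / 168) (-3 / 28) (by norm_num) τ
    (∑' p, hickersonTerm 5 1 (qPow 1 τ) p)
  -- The extra factor q in the sum for 𝓕₁ moves the exponent from -3/28 to 25/28 = 5²/28, as `hC`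
  -- requires.
  have h51 : ∑' p, hickersonTerm 5 1 (qPow 1 τ) p
      = qPow 1 τ * ∑' p, hickersonTerm 5 0 (qPow 1 τ) p := by
    rw [← tsum_mul_left]
    refine tsum_congr fun p => ?_
    rw [hickersonTerm_add 5 1 (qPow_ne_zero 1 τ), zpow_one]
  rw [h51, ← mul_assoc, ← qPow_add] at hF1
  rw [show (-3 / 28 + 1 : ℝ) = 25 / 28 by norm_num] at hF1
  ext i
  fin_cases i
  · simp only [F7, H7, G7, mockF0, zeta_zpow_eq_ex, Pi.add_apply, Pi.smul_apply,
      Pi.neg_apply, smul_eq_mul, Fin.zero_eta, Matrix.cons_val_zero]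
    rw [hA, hF0, zeta_eq_ex 84]
    push_cast
    ring
  · simp only [F7, H7, G7, mockF2, zeta_zpow_eq_ex, Pi.add_apply, Pi.smul_apply,
      Pi.neg_apply, smul_eq_mul, Fin.mk_one, Matrix.cons_val_one, Matrix.cons_val_zero]
    rw [hB, hF2]
    push_cast
    ring
  · simp only [F7, H7, G7, mockF1, zeta_zpow_eq_ex, Pi.add_apply, Pi.smul_apply,
      Pi.neg_apply, smul_eq_mul, Fin.reduceFinMk, Matrix.cons_val]
    rw [hC, h51, hF1]
    push_cast
    ring

end

end MockTheta

namespace MockTheta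

noncomputable section

open Complex MeasureTheory Set Filter

open scoped ComplexConjugate

/-! ### Siegel theta series -/

/-- In the right half-plane the two arguments add up without leaving (-π, π), so the principal
logarithms add. -/
lemma cpow_half_mul {a b : ℂ} (ha : 0 < a.re) (hb : 0 < b.re) {c : ℝ} (hc : 0 < c)
    (hab : a * b = c) : a ^ (1 / 2 : ℂ) * b ^ (1 / 2 : ℂ) = (Real.sqrt c : ℂ) := by
  have ha0 : a ≠ 0 := fun h => by simp [h] at ha
  have hb0 : b ≠ 0 := fun h => by simp [h] at hb
  have h1 := abs_lt.1 ((abs_arg_lt_pi_div_two_iff (z := a)).2 (Or.inl ha))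
  have h2 := abs_lt.1 ((abs_arg_lt_pi_div_two_iff (z := b)).2 (Or.inl hb))
  have hlog : log (a * b) = log a + log b :=
    (log_mul_eq_add_log_iff ha0 hb0).2 ⟨by linarith, by linarith⟩
  have h3 := Real.exp_log hc
  rw [cpow_def_of_ne_zero ha0, cpow_def_of_ne_zero hb0, ← exp_add, ← add_mul, ← hlog, hab,
    Real.sqrt_eq_rpow, ofReal_cpow hc.le, cpow_def_of_ne_zero (by exact_mod_cast hc.ne')]
  push_cast
  rfl

/-- Poisson summation for a Gaussian with a linear factor and characteristics. -/
lemma PosForm.tsum_linear_mul_exp_shift {p r u : ℂ} (h : PosForm p r u)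
    (x y a₀ a₁ b₀ b₁ : ℂ) :
    ∑' n : ℤ × ℤ, (x * (a₀ + n.1) + y * (a₁ + n.2)) * exp (Real.pi * I *
        (p * (a₀ + n.1) ^ 2 + 2 * r * (a₀ + n.1) * (a₁ + n.2) + u * (a₁ + n.2) ^ 2)
        + 2 * Real.pi * I * (b₀ * (a₀ + n.1) + b₁ * (a₁ + n.2)))
      = -1 / ((-I * p) ^ (1 / 2 : ℂ) * (-I * (u - r ^ 2 / p)) ^ (1 / 2 : ℂ)) *
        (exp (2 * Real.pi * I * (a₀ * b₀ + a₁ * b₁)) * ∑' n : ℤ × ℤ,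
          (x * (u * (b₀ - n.1) - r * (b₁ - n.2)) + y * (p * (b₁ - n.2) - r * (b₀ - n.1)))
          / (p * u - r ^ 2) * exp (-Real.pi * I * PosForm.invForm p r u (b₀ - n.1) (b₁ - n.2)
            - 2 * Real.pi * I * (a₀ * (b₀ - n.1) + a₁ * (b₁ - n.2)))) := by
  have hD := h.sub_ne_zero
  set K := 1 / ((-I * p) ^ (1 / 2 : ℂ) * (-I * (u - r ^ 2 / p)) ^ (1 / 2 : ℂ)) with hK
  have hnK : -1 / ((-I * p) ^ (1 / 2 : ℂ) * (-I * (u - r ^ 2 / p)) ^ (1 / 2 : ℂ)) = -K := by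
    rw [hK, neg_div]
  -- Expanding the square around (a₀, a₁) produces these linear coefficients and the constant `c`;
  -- this reduces to the case without shift, with a multiple of the plain Gaussian sum added.
  set z := p * a₀ + r * a₁ + b₀ with hz
  set w := r * a₀ + u * a₁ + b₁ with hw
  set c := exp (Real.pi * I * (p * a₀ ^ 2 + 2 * r * a₀ * a₁ + u * a₁ ^ 2)
    + 2 * Real.pi * I * (a₀ * b₀ + a₁ * b₁)) with hc
  have e1 := h.tsum_linear_mul_exp x y z w
  have e0 := h.tsum_exp z w
  rw [← hK] at e0
  rw [hnK] at e1 ⊢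
  have s1 := h.summable_linear_mul_exp (2 * Real.pi * I * z) x (2 * Real.pi * I * w) y 0 0
  have s0 := h.summable_exp (2 * Real.pi * I * z) (2 * Real.pi * I * w) 0
  have s2 := h.inv.summable_linear_mul_exp (2 * Real.pi * I * ((u * z - r * w) / (p * u - r ^ 2)))
    (-((x * u - y * r) / (p * u - r ^ 2)))
    (2 * Real.pi * I * ((p * w - r * z) / (p * u - r ^ 2)))
    (-((y * p - x * r) / (p * u - r ^ 2)))
    (-Real.pi * I * invForm p r u z w)
    ((x * (u * z - r * w) + y * (p * w - r * z)) / (p * u - r ^ 2))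
  have s3 := h.inv.summable_exp (2 * Real.pi * I * ((u * z - r * w) / (p * u - r ^ 2)))
    (2 * Real.pi * I * ((p * w - r * z) / (p * u - r ^ 2)))
    (-Real.pi * I * invForm p r u z w)
  have i3 : ∀ n : ℤ × ℤ, Real.pi * I * (-u / (p * u - r ^ 2) * n.1 ^ 2
      + 2 * (r / (p * u - r ^ 2)) * n.1 * n.2 + -p / (p * u - r ^ 2) * n.2 ^ 2)
      + 2 * Real.pi * I * ((u * z - r * w) / (p * u - r ^ 2)) * n.1
      + 2 * Real.pi * I * ((p * w - r * z) / (p * u - r ^ 2)) * n.2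
      + -Real.pi * I * invForm p r u z w
      = -Real.pi * I * invForm p r u (z - n.1) (w - n.2) := fun n => by
    simp only [invForm]
    field_simp
    ring
  have s2' : Summable fun n : ℤ × ℤ =>
      (x * (u * (z - n.1) - r * (w - n.2)) + y * (p * (w - n.2) - r * (z - n.1)))
        / (p * u - r ^ 2) * exp (-Real.pi * I * invForm p r u (z - n.1) (w - n.2)) := by
    refine s2.congr fun n => ?_
    rw [i3]
    congr 1
    field_simp
    ring
  have s3' : Summable fun n : ℤ × ℤ => exp (-Real.pi * I * invForm p r u (z - n.1) (w - n.2)) :=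
    s3.congr fun n => by rw [i3]
  calc _ = c * (∑' n : ℤ × ℤ, (x * n.1 + y * n.2) * exp (Real.pi * I *
        (p * n.1 ^ 2 + 2 * r * n.1 * n.2 + u * n.2 ^ 2)
        + 2 * Real.pi * I * z * n.1 + 2 * Real.pi * I * w * n.2)
        + (x * a₀ + y * a₁) * ∑' n : ℤ × ℤ, exp (Real.pi * I *
        (p * n.1 ^ 2 + 2 * r * n.1 * n.2 + u * n.2 ^ 2)
        + 2 * Real.pi * I * z * n.1 + 2 * Real.pi * I * w * n.2 + 0)) := by
        simp only [add_zero] at s1 s0 ⊢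
        rw [← s0.tsum_mul_left (x * a₀ + y * a₁),
          ← s1.tsum_add (s0.mul_left (x * a₀ + y * a₁)), ← tsum_mul_left (a := c)]
        refine tsum_congr fun n => ?_
        rw [← add_mul, mul_left_comm, hc, ← exp_add]
        congr 1
        · ring
        · refine congrArg cexp ?_
          rw [hz, hw]
          ring
    _ = -K * (c * (∑' n : ℤ × ℤ,
          ((x * (u * (z - n.1) - r * (w - n.2)) + y * (p * (w - n.2) - r * (z - n.1)))
          / (p * u - r ^ 2) * exp (-Real.pi * I * invForm p r u (z - n.1) (w - n.2))
          - (x * a₀ + y * a₁) * exp (-Real.pi * I * invForm p r u (z - n.1) (w - n.2))))) := by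
        rw [e1, e0, s2'.tsum_sub (s3'.mul_left _), tsum_mul_left]
        ring
    _ = _ := by
        refine congrArg (-K * ·) ?_
        rw [← tsum_mul_left (a := c), ← tsum_mul_left]
        refine tsum_congr fun n => ?_
        rw [← sub_mul, mul_left_comm, mul_left_comm (exp _), hc, ← exp_add, ← exp_add]
        refine congrArg₂ (· * ·) ?_ (congrArg cexp ?_)
        · rw [div_sub' hD, hz, hw]
          congr 1
          ring
        · rw [hz, hw]
          simp only [invForm]
          field_simp
          ring

/-- Two linear forms `X`, `Y` with `X² - Y² = (3/2) x² + 4 x y + (3/2) y²`. -/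
structure IsoPair (ξ₁ ξ₂ η₁ η₂ : ℝ) : Prop where
  h11 : ξ₁ ^ 2 - η₁ ^ 2 = 3 / 2
  h22 : ξ₂ ^ 2 - η₂ ^ 2 = 3 / 2
  h12 : ξ₁ * ξ₂ - η₁ * η₂ = 2

/-- The terms of the Siegel theta series. -/
def siegelTerm (ξ₁ ξ₂ η₁ η₂ s t : ℝ) (τ : ℂ) (n : ℤ × ℤ) : ℂ :=
  (ξ₁ * (s + n.1) + ξ₂ * (s + n.2)) * exp (2 * Real.pi * I *
    ((ξ₁ * (s + n.1) + ξ₂ * (s + n.2)) ^ 2 * τ - (η₁ * (s + n.1) + η₂ * (s + n.2)) ^ 2 * conj τ)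
    + 14 * Real.pi * I * t * ((s + n.1) + (s + n.2)))

namespace IsoPair

variable {ξ₁ ξ₂ η₁ η₂ : ℝ}

lemma det_sq (h : IsoPair ξ₁ ξ₂ η₁ η₂) : (ξ₁ * η₂ - ξ₂ * η₁) ^ 2 = 7 / 4 := by
  have h1 := h.h11
  have h2 := h.h22
  have h3 := h.h12
  linear_combination (-(ξ₂ ^ 2 - η₂ ^ 2)) * h1 - (3 / 2 : ℝ) * h2
    + (ξ₁ * ξ₂ - η₁ * η₂ + 2) * h3

/-- The form is 2(X²τ - Y²τ̄), whose imaginary part is the definite majorant 2y(X² + Y²), of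
determinant 7y². -/
lemma posForm (h : IsoPair ξ₁ ξ₂ η₁ η₂) {τ : ℂ} (hτ : 0 < τ.im) :
    PosForm (2 * (ξ₁ ^ 2 * τ - η₁ ^ 2 * conj τ)) (2 * (ξ₁ * ξ₂ * τ - η₁ * η₂ * conj τ))
      (2 * (ξ₂ ^ 2 * τ - η₂ ^ 2 * conj τ)) := by
  have im_eq : ∀ a b : ℝ, (2 * (a * τ - b * conj τ) : ℂ).im = 2 * (a + b) * τ.im := fun a b => by
    have : (2 * (a * τ - b * conj τ) : ℂ)
      = ((2 * a : ℝ) : ℂ) * τ + ((-(2 * b) : ℝ) : ℂ) * conj τ := by push_cast; ring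
    rw [this, add_im, im_ofReal_mul, im_ofReal_mul, conj_im]
    ring
  have i1 := im_eq (ξ₁ ^ 2) (η₁ ^ 2)
  have i2 := im_eq (ξ₁ * ξ₂) (η₁ * η₂)
  have i3 := im_eq (ξ₂ ^ 2) (η₂ ^ 2)
  push_cast at i1 i2 i3
  have hd := h.det_sq
  refine ⟨?_, ?_⟩
  · rw [i1]
    have : 0 < ξ₁ ^ 2 + η₁ ^ 2 := by nlinarith [h.h11, sq_nonneg η₁]
    positivity
  · rw [i1, i2, i3, ← sub_pos]
    have : 2 * (ξ₁ ^ 2 + η₁ ^ 2) * τ.im * (2 * (ξ₂ ^ 2 + η₂ ^ 2) * τ.im)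
        - (2 * (ξ₁ * ξ₂ + η₁ * η₂) * τ.im) ^ 2 = 7 * τ.im ^ 2 := by
      linear_combination (4 * τ.im ^ 2) * hd
    rw [this]
    positivity

end IsoPair

/-- The bijection `(k, n) ↦ -(A n + k e)` for `A = A7`, `e = (1, 1)`. -/
def cosetEquiv : Fin 7 × (ℤ × ℤ) ≃ ℤ × ℤ :=
  Equiv.ofBijective (fun p => (-(3 * p.2.1 + 4 * p.2.2 + (p.1 : ℕ)),
    -(4 * p.2.1 + 3 * p.2.2 + (p.1 : ℕ)))) (by
    constructor
    · rintro ⟨⟨k, hk⟩, m, n⟩ ⟨⟨k', hk'⟩, m', n'⟩ h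
      simp only [Prod.mk.injEq] at h
      obtain ⟨h1, h2⟩ := h
      have : k = k' := by omega
      have : m = m' := by omega
      have : n = n' := by omega
      simp only [Prod.mk.injEq, Fin.mk.injEq]
      exact ⟨by assumption, by assumption, by assumption⟩
    · rintro ⟨a, b⟩
      -- If (a, b) is the image of (k, m, n), then 3a - 4b = 7m + k and a - b = m - n.
      refine ⟨(⟨((3 * a - 4 * b) % 7).toNat, by omega⟩, ((3 * a - 4 * b) / 7,
        (3 * a - 4 * b) / 7 - a + b)), ?_⟩
      simp only [Prod.mk.injEq]
      constructor <;> omega)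

lemma cosetEquiv_apply (k : Fin 7) (m n : ℤ) :
    cosetEquiv (k, m, n) = (-(3 * m + 4 * n + (k : ℕ)), -(4 * m + 3 * n + (k : ℕ))) := rfl

lemma im_neg_one_div (τ : ℂ) : (-1 / τ).im = τ.im / normSq τ := by
  rw [neg_div, one_div, neg_im, inv_im]; ring

lemma im_neg_one_div_pos {τ : ℂ} (hτ : 0 < τ.im) : 0 < (-1 / τ).im := by
  have h0 : τ ≠ 0 := fun h => by simp [h] at hτ
  rw [im_neg_one_div]
  exact div_pos hτ (normSq_pos.2 h0)

lemma summable_siegelTerm {ξ₁ ξ₂ η₁ η₂ : ℝ} (h : IsoPair ξ₁ ξ₂ η₁ η₂) (s t : ℝ) {τ : ℂ}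
    (hτ : 0 < τ.im) : Summable (siegelTerm ξ₁ ξ₂ η₁ η₂ s t τ) := by
  have hP := h.posForm hτ
  set p := 2 * (ξ₁ ^ 2 * τ - η₁ ^ 2 * conj τ) with hp
  set r := 2 * (ξ₁ * ξ₂ * τ - η₁ * η₂ * conj τ) with hr
  set u := 2 * (ξ₂ ^ 2 * τ - η₂ ^ 2 * conj τ) with hu
  refine (hP.summable_linear_mul_exp (2 * Real.pi * I * (s * (p + r) + 7 * t)) ξ₁
    (2 * Real.pi * I * (s * (r + u) + 7 * t)) ξ₂
    (Real.pi * I * s ^ 2 * (p + 2 * r + u) + 28 * Real.pi * I * t * s)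
    (s * (ξ₁ + ξ₂))).congr fun n => ?_
  rw [siegelTerm]
  refine congrArg₂ (· * ·) ?_ (congrArg cexp ?_)
  · ring
  · rw [hp, hr, hu]; ring

/-- Poisson summation inverts τ on the positive line and τ̄ on the negative line, so the frame (X,
Y) is preserved when dual vectors are written as Av. The v run through seven cosets of ℤ², shifted
by multiples of e/7. The Gaussian contributes |τ|/√7 and the linear factor X contributes τ. -/
theorem tsum_siegelTerm_neg_one_div {ξ₁ ξ₂ η₁ η₂ : ℝ} (h : IsoPair ξ₁ ξ₂ η₁ η₂) (s t : ℝ) {τ : ℂ}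
    (hτ : 0 < τ.im) :
    ∑' n, siegelTerm ξ₁ ξ₂ η₁ η₂ s t (-1 / τ) n =
      ‖τ‖ * τ / Real.sqrt 7 * ex (14 * s * t) *
        ∑ k : Fin 7, ∑' n, siegelTerm ξ₁ ξ₂ η₁ η₂ (t + (k : ℕ) / 7) (-s) τ n := by
  have h0 : τ ≠ 0 := fun h => by simp [h] at hτ
  have h0' : conj τ ≠ 0 := (map_ne_zero _).2 h0
  have hP := h.posForm (im_neg_one_div_pos hτ)
  have hconj : conj (-1 / τ) = -1 / conj τ := by simp
  rw [hconj] at hP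
  have hδ := h.det_sq
  set δ := ξ₁ * η₂ - ξ₂ * η₁ with hδdef
  have hδ0 : δ ≠ 0 := fun h => by rw [h] at hδ; norm_num at hδ
  have hδc : (δ : ℂ) ^ 2 = 7 / 4 := by rw [← ofReal_pow, hδ]; push_cast; rfl
  have hδc' : (ξ₁ * η₂ - ξ₂ * η₁ : ℂ) = δ := by rw [hδdef]; push_cast; rfl
  have c11 : (ξ₁ ^ 2 - η₁ ^ 2 : ℂ) = 3 / 2 := by
    simpa using congrArg ((↑) : ℝ → ℂ) h.h11
  have c22 : (ξ₂ ^ 2 - η₂ ^ 2 : ℂ) = 3 / 2 := by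
    simpa using congrArg ((↑) : ℝ → ℂ) h.h22
  have c12 : (ξ₁ * ξ₂ - η₁ * η₂ : ℂ) = 2 := by
    simpa using congrArg ((↑) : ℝ → ℂ) h.h12
  set p := 2 * (ξ₁ ^ 2 * (-1 / τ) - η₁ ^ 2 * (-1 / conj τ)) with hp
  set r := 2 * (ξ₁ * ξ₂ * (-1 / τ) - η₁ * η₂ * (-1 / conj τ)) with hr
  set u := 2 * (ξ₂ ^ 2 * (-1 / τ) - η₂ ^ 2 * (-1 / conj τ)) with hu
  have hDD : p * u - r ^ 2 = -7 / (τ * conj τ) := by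
    rw [hp, hr, hu]
    have e : 4 * (ξ₁ * η₂ - ξ₂ * η₁ : ℂ) ^ 2 = 7 := by rw [hδc', hδc]; norm_num
    rw [← e]
    field_simp
    ring
  -- The product of the two radicands is the positive number 7/|τ|², so the branches combine.
  have hK : (-I * p) ^ (1 / 2 : ℂ) * (-I * (u - r ^ 2 / p)) ^ (1 / 2 : ℂ)
      = ((Real.sqrt 7 / ‖τ‖ : ℝ) : ℂ) := by
    have hn : 0 < ‖τ‖ := norm_pos_iff.2 h0
    rw [cpow_half_mul (c := 7 / ‖τ‖ ^ 2) (by simpa using hP.pos)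
      (by simpa using hP.partialInv.pos') (by positivity), Real.sqrt_div (by norm_num),
      Real.sqrt_sq hn.le]
    have hp0 := hP.ne_zero
    have e1 : (-I * p) * (-I * (u - r ^ 2 / p)) = -(p * u - r ^ 2) := by
      field_simp
      rw [I_sq]; ring
    rw [e1, hDD, mul_conj, normSq_eq_norm_sq]
    push_cast
    ring
  have key := hP.tsum_linear_mul_exp_shift ξ₁ ξ₂ s s (7 * t) (7 * t)
  rw [hK, hDD] at key
  have hL : ∑' n, siegelTerm ξ₁ ξ₂ η₁ η₂ s t (-1 / τ) n
      = ∑' n : ℤ × ℤ, (ξ₁ * (s + n.1) + ξ₂ * (s + n.2)) * exp (Real.pi * I *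
        (p * (s + n.1) ^ 2 + 2 * r * (s + n.1) * (s + n.2) + u * (s + n.2) ^ 2)
        + 2 * Real.pi * I * (7 * t * (s + n.1) + 7 * t * (s + n.2))) := by
    refine tsum_congr fun n => ?_
    rw [siegelTerm, hconj, hp, hr, hu]
    refine congrArg₂ (· * ·) rfl (congrArg cexp ?_)
    ring
  have hS : ∀ k : Fin 7, Summable (siegelTerm ξ₁ ξ₂ η₁ η₂ (t + (k : ℕ) / 7) (-s) τ) :=
    fun k => summable_siegelTerm h _ _ hτ
  have hterm : ∀ q : Fin 7 × (ℤ × ℤ),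
      (ξ₁ * (u * (7 * t - (cosetEquiv q).1) - r * (7 * t - (cosetEquiv q).2))
        + ξ₂ * (p * (7 * t - (cosetEquiv q).2) - r * (7 * t - (cosetEquiv q).1)))
          / (-7 / (τ * conj τ)) *
        exp (-Real.pi * I * PosForm.invForm p r u (7 * t - (cosetEquiv q).1)
            (7 * t - (cosetEquiv q).2)
            - 2 * Real.pi * I * (s * (7 * t - (cosetEquiv q).1) + s * (7 * t - (cosetEquiv q).2)))
      = -τ * siegelTerm ξ₁ ξ₂ η₁ η₂ (t + (q.1 : ℕ) / 7) (-s) τ q.2 := by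
    rintro ⟨k, m, n⟩
    rw [cosetEquiv_apply]
    dsimp only
    rw [siegelTerm, ← mul_assoc]
    set v := (t : ℂ) + (k : ℕ) / 7 + m with hv
    set w := (t : ℂ) + (k : ℕ) / 7 + n with hw
    have eZ : (7 * t - ((-(3 * m + 4 * n + (k : ℕ)) : ℤ) : ℂ) : ℂ) = 3 * v + 4 * w := by
      rw [hv, hw]; push_cast; ring
    have eW : (7 * t - ((-(4 * m + 3 * n + (k : ℕ)) : ℤ) : ℂ) : ℂ) = 4 * v + 3 * w := by
      rw [hv, hw]; push_cast; ring
    rw [eZ, eW]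
    -- The vector (Z, W) = A(v, w) is twice the gradient pairing of X² - Y². Inverting the frame, of
    -- determinant δ with δ² = 7/4, recovers X and Y of (v, w) up to the factor 2δ.
    have fZ : 3 * v + 4 * w = 2 * (ξ₁ * (ξ₁ * v + ξ₂ * w) - η₁ * (η₁ * v + η₂ * w)) := by
      linear_combination (-2 * v) * c11 - 2 * w * c12
    have fW : 4 * v + 3 * w = 2 * (ξ₂ * (ξ₁ * v + ξ₂ * w) - η₂ * (η₁ * v + η₂ * w)) := by
      linear_combination (-2 * w) * c22 - 2 * v * c12
    have gX : η₂ * (3 * v + 4 * w) - η₁ * (4 * v + 3 * w) = 2 * δ * (ξ₁ * v + ξ₂ * w) := by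
      rw [fZ, fW, ← hδc']; ring
    have gY : ξ₂ * (3 * v + 4 * w) - ξ₁ * (4 * v + 3 * w) = 2 * δ * (η₁ * v + η₂ * w) := by
      rw [fZ, fW, ← hδc']; ring
    set Z := 3 * v + 4 * w with hZ
    set W := 4 * v + 3 * w with hW
    have l1 : ξ₁ * (u * Z - r * W) + ξ₂ * (p * W - r * Z)
        = 2 * δ * (η₂ * Z - η₁ * W) / conj τ := by
      rw [hp, hr, hu, ← hδc']
      field_simp
      ring
    have l2 : u * Z ^ 2 - 2 * r * Z * W + p * W ^ 2
        = -2 * (ξ₂ * Z - ξ₁ * W) ^ 2 / τ + 2 * (η₂ * Z - η₁ * W) ^ 2 / conj τ := by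
      rw [hp, hr, hu]
      field_simp
      ring
    rw [PosForm.invForm, l1, l2, hDD, gX, gY]
    have hcast : ((t + (k : ℕ) / 7 : ℝ) : ℂ) = t + (k : ℕ) / 7 := by push_cast; rfl
    rw [hcast, ← hv, ← hw]
    refine congrArg₂ (· * ·) ?_ (congrArg cexp ?_)
    · field_simp
      linear_combination (-4 * (ξ₁ * v + ξ₂ * w)) * hδc
    · have q : (-2 * (2 * δ * (η₁ * v + η₂ * w)) ^ 2 / τ
          + 2 * (2 * δ * (ξ₁ * v + ξ₂ * w)) ^ 2 / conj τ) / (-7 / (τ * conj τ))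
          = -(2 * ((ξ₁ * v + ξ₂ * w) ^ 2 * τ - (η₁ * v + η₂ * w) ^ 2 * conj τ)) := by
        rw [mul_pow, mul_pow, mul_pow, mul_pow, hδc]
        field_simp
        ring
      rw [q, hZ, hW]
      push_cast
      ring
  rw [hL, key, ← cosetEquiv.tsum_eq, tsum_congr hterm, tsum_mul_left]
  have hSall : Summable fun q : Fin 7 × (ℤ × ℤ) =>
      siegelTerm ξ₁ ξ₂ η₁ η₂ (t + (q.1 : ℕ) / 7) (-s) τ q.2 := by
    refine summable_norm_iff.1 ((summable_prod_of_nonneg fun _ => norm_nonneg _).2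
      ⟨fun k => (hS k).norm, (hasSum_fintype _).summable⟩)
  rw [Summable.tsum_prod hSall, tsum_fintype]
  have hex : exp (2 * Real.pi * I * (s * (7 * t) + s * (7 * t))) = ex (14 * s * t) := by
    rw [ex]; congr 1; push_cast; ring
  have hn : (‖τ‖ : ℂ) ≠ 0 := by exact_mod_cast (norm_pos_iff.2 h0).ne'
  have h7 : (Real.sqrt 7 : ℂ) ≠ 0 := by exact_mod_cast (Real.sqrt_pos.2 (by norm_num)).ne'
  rw [hex]
  push_cast
  field_simp

end

end MockTheta

namespace MockTheta

noncomputable section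

open Complex MeasureTheory Set Filter

open scoped ComplexConjugate

/-! ### The indefinite theta function as an integral of Siegel theta series -/

/-- The Siegel theta term for the hyperbolic rotation by `φ`. -/
def rotTerm (s t : ℝ) (τ : ℂ) (n : ℤ × ℤ) (φ : ℝ) : ℂ :=
  siegelTerm ((Real.sqrt 7 * Real.cosh φ + Real.sinh φ) / 2)
    ((Real.sqrt 7 * Real.cosh φ - Real.sinh φ) / 2)
    ((Real.sqrt 7 * Real.sinh φ + Real.cosh φ) / 2)
    ((Real.sqrt 7 * Real.sinh φ - Real.cosh φ) / 2) s t τ n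

lemma isoPair_rot (φ : ℝ) : IsoPair ((Real.sqrt 7 * Real.cosh φ + Real.sinh φ) / 2)
    ((Real.sqrt 7 * Real.cosh φ - Real.sinh φ) / 2)
    ((Real.sqrt 7 * Real.sinh φ + Real.cosh φ) / 2)
    ((Real.sqrt 7 * Real.sinh φ - Real.cosh φ) / 2) := by
  have h7 : Real.sqrt 7 ^ 2 = 7 := Real.sq_sqrt (by norm_num)
  have hc := Real.cosh_sq φ
  constructor
  · linear_combination (1 / 4 * (Real.cosh φ ^ 2 - Real.sinh φ ^ 2)) * h7 + 3 / 2 * hc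
  · linear_combination (1 / 4 * (Real.cosh φ ^ 2 - Real.sinh φ ^ 2)) * h7 + 3 / 2 * hc
  · linear_combination (1 / 4 * (Real.cosh φ ^ 2 - Real.sinh φ ^ 2)) * h7 + 2 * hc

/-- The positive coordinate of the vector `(x, y)` in the frame rotated by `φ`. -/
def rotX (φ x y : ℝ) : ℝ := (Real.sqrt 7 * Real.cosh φ * (x + y) + Real.sinh φ * (x - y)) / 2

/-- The negative coordinate of the vector `(x, y)` in the frame rotated by `φ`. -/
def rotY (φ x y : ℝ) : ℝ := (Real.sqrt 7 * Real.sinh φ * (x + y) + Real.cosh φ * (x - y)) / 2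

lemma rotX_sq_sub_rotY_sq (φ x y : ℝ) :
    rotX φ x y ^ 2 - rotY φ x y ^ 2 = 3 / 2 * x ^ 2 + 4 * x * y + 3 / 2 * y ^ 2 := by
  have h7 : Real.sqrt 7 ^ 2 = 7 := Real.sq_sqrt (by norm_num)
  have hc := Real.cosh_sq φ
  rw [rotX, rotY]
  linear_combination (1 / 4 * (Real.cosh φ ^ 2 - Real.sinh φ ^ 2) * (x + y) ^ 2) * h7
    + (3 / 2 * x ^ 2 + 4 * x * y + 3 / 2 * y ^ 2) * hc

/-- The rotation multiplies the isotropic coordinates X + Y and X - Y by e^φ and e^{-φ}, so for |φ|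
≤ T the majorant shrinks by at most e^{-2T}. -/
lemma le_rotX_sq_add_rotY_sq {φ T : ℝ} (hφ : |φ| ≤ T) (x y : ℝ) :
    Real.exp (-2 * T) / 2 * (x ^ 2 + y ^ 2) ≤ rotX φ x y ^ 2 + rotY φ x y ^ 2 := by
  have h7 : Real.sqrt 7 ^ 2 = 7 := Real.sq_sqrt (by norm_num)
  have hp := Real.cosh_add_sinh φ
  have hm := Real.cosh_sub_sinh φ
  obtain ⟨h1, h2⟩ := abs_le.1 hφ
  set u := (Real.sqrt 7 * (x + y) + (x - y)) / 2 with hu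
  set v := (Real.sqrt 7 * (x + y) - (x - y)) / 2 with hv
  have e1 : rotX φ x y ^ 2 + rotY φ x y ^ 2
      = (Real.exp φ ^ 2 * u ^ 2 + Real.exp (-φ) ^ 2 * v ^ 2) / 2 := by
    rw [← hp, ← hm, rotX, rotY, hu, hv]; ring
  have e2 : x ^ 2 + y ^ 2 ≤ u ^ 2 + v ^ 2 := by
    have : u ^ 2 + v ^ 2 = (7 * (x + y) ^ 2 + (x - y) ^ 2) / 2 := by
      rw [hu, hv]; linear_combination ((x + y) ^ 2 / 2) * h7
    nlinarith [sq_nonneg (x + y)]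
  have e3 : Real.exp (-2 * T) ≤ Real.exp φ ^ 2 := by
    rw [← Real.exp_nat_mul]; exact Real.exp_le_exp.2 (by push_cast; linarith)
  have e4 : Real.exp (-2 * T) ≤ Real.exp (-φ) ^ 2 := by
    rw [← Real.exp_nat_mul]; exact Real.exp_le_exp.2 (by push_cast; linarith)
  rw [e1]
  nlinarith [mul_le_mul_of_nonneg_right e3 (sq_nonneg u),
    mul_le_mul_of_nonneg_right e4 (sq_nonneg v),
    mul_le_mul_of_nonneg_left e2 (Real.exp_pos (-2 * T)).le]

lemma hasDerivAt_rotY (φ x y : ℝ) : HasDerivAt (fun φ => rotY φ x y) (rotX φ x y) φ := by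
  unfold rotX rotY
  have h1 := ((Real.hasDerivAt_sinh φ).const_mul (Real.sqrt 7)).mul_const (x + y)
  have h2 := (Real.hasDerivAt_cosh φ).mul_const (x - y)
  exact (h1.add h2).div_const 2

/-- Writing τ̄ = τ - 2iy separates the exponential of Q(ν)τ, which is independent of φ, from the
real factor X e^{-4πyY²}. -/
lemma rotTerm_eq (s t : ℝ) (τ : ℂ) (n : ℤ × ℤ) (φ : ℝ) : rotTerm s t τ n φ =
    ((rotX φ (s + n.1) (s + n.2)
      * Real.exp (-4 * Real.pi * τ.im * rotY φ (s + n.1) (s + n.2) ^ 2) : ℝ) : ℂ)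
      * quadExp (7 * t) (7 * t) τ (s + n.1) (s + n.2) := by
  have hX : ((rotX φ (s + n.1) (s + n.2) : ℝ) : ℂ)
      = ((Real.sqrt 7 * Real.cosh φ + Real.sinh φ) / 2 : ℝ) * (s + n.1)
        + ((Real.sqrt 7 * Real.cosh φ - Real.sinh φ) / 2 : ℝ) * (s + n.2) := by
    rw [rotX]; push_cast; ring
  have hY : ((rotY φ (s + n.1) (s + n.2) : ℝ) : ℂ)
      = ((Real.sqrt 7 * Real.sinh φ + Real.cosh φ) / 2 : ℝ) * (s + n.1)
        + ((Real.sqrt 7 * Real.sinh φ - Real.cosh φ) / 2 : ℝ) * (s + n.2) := by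
    rw [rotY]; push_cast; ring
  have hQ := congrArg ((↑) : ℝ → ℂ) (rotX_sq_sub_rotY_sq φ (s + n.1) (s + n.2))
  have hτ : conj τ = τ - 2 * τ.im * I := by
    rw [← re_add_im τ]; simp [-re_add_im]; ring
  rw [rotTerm, siegelTerm, ← hX, ← hY, quadExp, ofReal_mul, ofReal_exp,
    mul_assoc (rotX φ (s + n.1) (s + n.2) : ℂ), ← exp_add]
  push_cast at hQ ⊢
  refine congrArg₂ (· * ·) rfl (congrArg cexp ?_)
  rw [← hQ, hτ]
  linear_combination (4 * Real.pi * τ.im * (rotY φ (s + n.1) (s + n.2) : ℂ) ^ 2) * I_sq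

lemma norm_rotTerm_le (s t : ℝ) {τ : ℂ} (hτ : 0 < τ.im) {T : ℝ} (n : ℤ × ℤ) {φ : ℝ}
    (hφ : |φ| ≤ T) : ‖rotTerm s t τ n φ‖ ≤ (1 + 1 / (Real.pi * τ.im)) *
      Real.exp (-(Real.pi * τ.im * (Real.exp (-2 * T) / 2)) *
        ((s + n.1) ^ 2 + (s + n.2) ^ 2)) := by
  rw [rotTerm_eq, norm_mul, norm_quadExp, ← rotX_sq_sub_rotY_sq φ, norm_real, norm_mul,
    Real.norm_eq_abs, Real.norm_eq_abs, Real.abs_exp, mul_assoc, ← Real.exp_add]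
  have hle := le_rotX_sq_add_rotY_sq hφ (s + n.1) (s + n.2)
  set X := rotX φ (s + n.1) (s + n.2)
  set Y := rotY φ (s + n.1) (s + n.2)
  have hp : 0 < Real.pi * τ.im := mul_pos Real.pi_pos hτ
  have h1 : |X| ≤ (1 + 1 / (Real.pi * τ.im)) * Real.exp (Real.pi * τ.im * X ^ 2) := by
    have h2 : Real.pi * τ.im * X ^ 2 + 1 ≤ Real.exp (Real.pi * τ.im * X ^ 2) :=
      Real.add_one_le_exp _
    have h3 : |X| ≤ 1 + X ^ 2 := by nlinarith [sq_abs X, sq_nonneg (|X| - 1), abs_nonneg X]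
    have h4 : X ^ 2 = 1 / (Real.pi * τ.im) * (Real.pi * τ.im * X ^ 2) := by
      field_simp
    have h5 : 0 ≤ 1 / (Real.pi * τ.im) := by positivity
    have h6 : 0 ≤ Real.pi * τ.im * X ^ 2 := by positivity
    nlinarith [mul_le_mul_of_nonneg_left h2 h5]
  calc _ ≤ (1 + 1 / (Real.pi * τ.im)) * Real.exp (Real.pi * τ.im * X ^ 2)
        * Real.exp (-4 * Real.pi * τ.im * Y ^ 2 + -2 * Real.pi * τ.im * (X ^ 2 - Y ^ 2)) := by
        gcongr
    _ = (1 + 1 / (Real.pi * τ.im)) * Real.exp (-(Real.pi * τ.im) * (X ^ 2 + 2 * Y ^ 2)) := by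
        rw [mul_assoc, ← Real.exp_add]
        congr 2
        ring
    _ ≤ _ := by
        refine mul_le_mul_of_nonneg_left (Real.exp_le_exp.2 ?_) (by positivity)
        nlinarith [mul_le_mul_of_nonneg_left hle hp.le, mul_nonneg hp.le (sq_nonneg Y)]

lemma summable_exp_shifted_sq (s M : ℝ) {c : ℝ} (hc : 0 < c) : Summable fun n : ℤ × ℤ =>
    M * Real.exp (-c * ((s + n.1) ^ 2 + (s + n.2) ^ 2)) := by
  refine Summable.mul_left _ (Summable.of_nonneg_of_le (fun _ => (Real.exp_pos _).le) (fun n => ?_)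
    (summable_exp_neg_sq_prod hc (2 * c * |s|) 0))
  refine Real.exp_le_exp.2 ?_
  have h1 : -(s * n.1) ≤ |s| * |(n.1 : ℝ)| := by rw [← abs_mul]; exact neg_le_abs _
  have h2 : -(s * n.2) ≤ |s| * |(n.2 : ℝ)| := by rw [← abs_mul]; exact neg_le_abs _
  nlinarith [mul_le_mul_of_nonneg_left h1 hc.le, mul_le_mul_of_nonneg_left h2 hc.le,
    mul_nonneg hc.le (sq_nonneg s)]

lemma continuous_rotTerm (s t : ℝ) (τ : ℂ) (n : ℤ × ℤ) : Continuous (rotTerm s t τ n) := by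
  unfold rotTerm siegelTerm
  have := Real.continuous_cosh
  have := Real.continuous_sinh
  fun_prop

lemma intervalIntegrable_tsum_rotTerm (s t : ℝ) {τ : ℂ} (hτ : 0 < τ.im) (T : ℝ) :
    IntervalIntegrable (fun φ => ∑' n, rotTerm s t τ n φ) volume (-T) T := by
  refine ContinuousOn.intervalIntegrable ?_
  refine continuousOn_tsum (fun n => (continuous_rotTerm s t τ n).continuousOn)
    (summable_exp_shifted_sq s (1 + 1 / (Real.pi * τ.im))
      (c := Real.pi * τ.im * (Real.exp (-2 * |T|) / 2)) (by positivity))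
    (fun n φ hφ => norm_rotTerm_le s t hτ n ?_)
  rcases le_total (-T) T with h | h
  · rw [uIcc_of_le h] at hφ
    exact (abs_le.2 hφ).trans (le_abs_self T)
  · rw [uIcc_of_ge h] at hφ
    exact abs_le.2 ⟨by linarith [neg_abs_le T, hφ.1, neg_le_abs T],
      by linarith [hφ.2, neg_le_abs T]⟩

lemma hasSum_integral_rotTerm (s t : ℝ) {τ : ℂ} (hτ : 0 < τ.im) {T : ℝ} (hT : 0 ≤ T) :
    HasSum (fun n => ∫ φ in (-T)..T, rotTerm s t τ n φ)
      (∫ φ in (-T)..T, ∑' n, rotTerm s t τ n φ) := by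
  have hs := summable_exp_shifted_sq s (1 + 1 / (Real.pi * τ.im))
      (c := Real.pi * τ.im * (Real.exp (-2 * T) / 2)) (by positivity)
  refine intervalIntegral.hasSum_integral_of_dominated_convergence
    (fun n _ => (1 + 1 / (Real.pi * τ.im)) *
      Real.exp (-(Real.pi * τ.im * (Real.exp (-2 * T) / 2)) * ((s + n.1) ^ 2 + (s + n.2) ^ 2)))
    (fun n => (continuous_rotTerm s t τ n).aestronglyMeasurable)
    (fun n => .of_forall fun φ hφ => norm_rotTerm_le s t hτ n ?_)
    (.of_forall fun _ _ => hs) intervalIntegrable_const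
    (.of_forall fun φ _ => (summable_siegelTerm (isoPair_rot φ) s t hτ).hasSum)
  rw [uIoc_of_le (by linarith)] at hφ
  exact abs_le.2 ⟨hφ.1.le, hφ.2⟩

/-- The angle between the vectors `c71`, `c72` and the symmetric frame. -/
def halfAngle : ℝ := Real.arsinh (1 / Real.sqrt 6)

lemma halfAngle_nonneg : 0 ≤ halfAngle := Real.arsinh_nonneg_iff.2 (by positivity)

/-- At this angle sinh φ = 1/√6 and cosh φ = √7/√6, so one coordinate drops out of Y. The negative
axis then points along `c71` or, for the opposite angle, along `c72`. -/
lemma rotY_halfAngle (x y : ℝ) :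
    2 * rotY halfAngle x y = kap * x ∧ 2 * rotY (-halfAngle) x y = -(kap * y) := by
  have hs : Real.sinh halfAngle = 1 / Real.sqrt 6 := Real.sinh_arsinh _
  have h6 : Real.sqrt 6 ^ 2 = 6 := Real.sq_sqrt (by norm_num)
  have h60 : 0 < Real.sqrt 6 := Real.sqrt_pos.2 (by norm_num)
  have h7 : Real.sqrt 7 ^ 2 = 7 := Real.sq_sqrt (by norm_num)
  have h70 : 0 < Real.sqrt 7 := Real.sqrt_pos.2 (by norm_num)
  have hc : Real.cosh halfAngle = Real.sqrt 7 / Real.sqrt 6 := by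
    refine (pow_left_inj₀ (Real.cosh_pos _).le (by positivity) two_ne_zero).1 ?_
    rw [Real.cosh_sq, hs, div_pow, div_pow, h6, h7]; norm_num
  have hk : kap = 2 * (Real.sqrt 7 / Real.sqrt 6) := by
    refine (pow_left_inj₀ kap_pos.le (by positivity) two_ne_zero).1 ?_
    rw [kap_sq, mul_pow, div_pow, h6, h7]; norm_num
  constructor
  · rw [rotY, hs, hc, hk]; ring
  · rw [rotY, Real.sinh_neg, Real.cosh_neg, hs, hc, hk]; ring

/-- Since dY/dφ = X, the integrand is, up to 4√y, the derivative of E(2Y√y); the endpoints give the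
two error functions of the theta series. -/
lemma integral_rotTerm (s t : ℝ) {τ : ℂ} (hτ : 0 < τ.im) (n : ℤ × ℤ) :
    ((4 * Real.sqrt τ.im : ℝ) : ℂ) * ∫ φ in (-halfAngle)..halfAngle, rotTerm s t τ n φ =
      ((errorE (kap * (s + n.1) * Real.sqrt τ.im)
        + errorE (kap * (s + n.2) * Real.sqrt τ.im) : ℝ) : ℂ) *
      quadExp (7 * t) (7 * t) τ (s + n.1) (s + n.2) := by
  have hd : ∀ φ : ℝ, HasDerivAt
      (fun φ => errorE (2 * rotY φ (s + n.1) (s + n.2) * Real.sqrt τ.im))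
      (4 * Real.sqrt τ.im * (rotX φ (s + n.1) (s + n.2)
      * Real.exp (-4 * Real.pi * τ.im * rotY φ (s + n.1) (s + n.2) ^ 2))) φ := fun φ => by
    have h1 := (hasDerivAt_errorE (2 * rotY φ (s + n.1) (s + n.2) * Real.sqrt τ.im)).comp φ
      (((hasDerivAt_rotY φ (s + n.1) (s + n.2)).const_mul 2).mul_const (Real.sqrt τ.im))
    refine h1.congr_deriv ?_
    rw [mul_pow, Real.sq_sqrt hτ.le]
    have : -Real.pi * ((2 * rotY φ (s + n.1) (s + n.2)) ^ 2 * τ.im)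
        = -4 * Real.pi * τ.im * rotY φ (s + n.1) (s + n.2) ^ 2 := by ring
    rw [this]
    ring
  have hcont : Continuous fun φ => 4 * Real.sqrt τ.im * (rotX φ (s + n.1) (s + n.2)
      * Real.exp (-4 * Real.pi * τ.im * rotY φ (s + n.1) (s + n.2) ^ 2)) := by
    unfold rotX rotY
    have := Real.continuous_cosh
    have := Real.continuous_sinh
    fun_prop
  have hI := intervalIntegral.integral_eq_sub_of_hasDerivAt
    (a := -halfAngle) (b := halfAngle) (fun φ _ => hd φ) (hcont.intervalIntegrable _ _)
  rw [(rotY_halfAngle _ _).1, (rotY_halfAngle _ _).2, neg_mul (kap * _),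
    errorE_neg, sub_neg_eq_add,
    intervalIntegral.integral_const_mul] at hI
  simp_rw [rotTerm_eq]
  rw [intervalIntegral.integral_mul_const, intervalIntegral.integral_ofReal, ← mul_assoc,
    ← ofReal_mul, hI]

lemma theta7_eq_integral (s t : ℝ) {τ : ℂ} (hτ : 0 < τ.im) : theta7 s t τ =
    ((4 * Real.sqrt τ.im : ℝ) : ℂ) *
      ∫ φ in (-halfAngle)..halfAngle, ∑' n, rotTerm s t τ n φ := by
  rw [theta7_eq, ← (hasSum_integral_rotTerm s t hτ halfAngle_nonneg).tsum_eq, ← tsum_mul_left]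
  exact tsum_congr fun n => (integral_rotTerm s t hτ n).symm

/-- The Siegel transformation is the same for every φ, so it passes through the integral. The factor
√(Im(-1/τ)) = √y/|τ| cancels |τ|, leaving holomorphic weight 1. -/
theorem theta7_neg_one_div (s t : ℝ) {τ : ℂ} (hτ : 0 < τ.im) : theta7 s t (-1 / τ) =
    τ / Real.sqrt 7 * ex (14 * s * t) *
      ∑ k : Fin 7, theta7 (t + (k : ℕ) / 7) (-s) τ := by
  have h0 : τ ≠ 0 := fun h => by simp [h] at hτ
  have hn : 0 < ‖τ‖ := norm_pos_iff.2 h0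
  rw [theta7_eq_integral s t (im_neg_one_div_pos hτ)]
  have h1 : ∀ φ, ∑' n, rotTerm s t (-1 / τ) n φ = ‖τ‖ * τ / Real.sqrt 7 * ex (14 * s * t) *
      ∑ k : Fin 7, ∑' n, rotTerm (t + (k : ℕ) / 7) (-s) τ n φ := fun φ =>
    tsum_siegelTerm_neg_one_div (isoPair_rot φ) s t hτ
  simp_rw [h1]
  rw [intervalIntegral.integral_const_mul, intervalIntegral.integral_finsetSum
    fun k _ => intervalIntegrable_tsum_rotTerm _ _ hτ _]
  simp_rw [fun k : Fin 7 => theta7_eq_integral (t + (k : ℕ) / 7) (-s) hτ]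
  rw [← Finset.mul_sum, im_neg_one_div, normSq_eq_norm_sq, Real.sqrt_div hτ.le,
    Real.sqrt_sq hn.le]
  have hn' : (‖τ‖ : ℂ) ≠ 0 := by exact_mod_cast hn.ne'
  push_cast
  field_simp

end

end MockTheta

namespace MockTheta

noncomputable section

open Complex MeasureTheory Set Filter

open scoped ComplexConjugate

/-! ### Modular transformations -/

lemma theta7_add_one (s t : ℝ) (τ : ℂ) : theta7 (s + 1) t τ = theta7 s t τ := by
  rw [theta7_eq, theta7_eq, ← (Equiv.addRight ((1, 1) : ℤ × ℤ)).tsum_eq (fun n : ℤ × ℤ =>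
    ((errorE (kap * (s + n.1) * Real.sqrt τ.im)
        + errorE (kap * (s + n.2) * Real.sqrt τ.im) : ℝ) : ℂ) *
      quadExp (7 * t) (7 * t) τ (s + n.1) (s + n.2))]
  refine tsum_congr fun n => ?_
  have h1 : s + 1 + (n.1 : ℝ) = s + ((n + (1, 1)).1 : ℤ) := by
    rw [Prod.fst_add]; push_cast; ring
  have h2 : s + 1 + (n.2 : ℝ) = s + ((n + (1, 1)).2 : ℤ) := by
    rw [Prod.snd_add]; push_cast; ring
  rw [h1, h2]
  rfl

lemma theta7_neg_neg (s t : ℝ) (τ : ℂ) : theta7 (-s) (-t) τ = -theta7 s t τ := by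
  rw [theta7_eq, theta7_eq, ← (Equiv.neg (ℤ × ℤ)).tsum_eq, ← tsum_neg]
  refine tsum_congr fun n => ?_
  have h1 : -s + ((-n).1 : ℝ) = -(s + n.1) := by rw [Prod.fst_neg]; push_cast; ring
  have h2 : -s + ((-n).2 : ℝ) = -(s + n.2) := by rw [Prod.snd_neg]; push_cast; ring
  have h3 : quadExp (7 * -t) (7 * -t) τ (-(s + n.1)) (-(s + n.2))
      = quadExp (7 * t) (7 * t) τ (s + n.1) (s + n.2) := by
    rw [quadExp, quadExp]; congr 1; push_cast; ring
  rw [Equiv.neg_apply, h1, h2, h3, mul_neg, mul_neg, neg_mul, neg_mul, errorE_neg, errorE_neg]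
  push_cast
  ring

lemma theta7_add_int_div (s t : ℝ) (l : ℤ) (τ : ℂ) :
    theta7 s (t + l / 7) τ = ex (2 * s * l) * theta7 s t τ := by
  rw [theta7_eq, theta7_eq, ← tsum_mul_left]
  refine tsum_congr fun n => ?_
  have h : quadExp (7 * (t + l / 7)) (7 * (t + l / 7)) τ (s + n.1) (s + n.2)
      = ex (2 * s * l) * quadExp (7 * t) (7 * t) τ (s + n.1) (s + n.2) := by
    rw [← ex_eq_of_sub_eq (x := 2 * s * l + (l * (n.1 + n.2) : ℤ)) (n := l * (n.1 + n.2)) (by ring),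
      ex, quadExp, quadExp, ← exp_add]
    congr 1
    push_cast
    ring
  rw [h]
  ring

/-- For odd k, Q(ν) is congruent to k²/28 modulo 1 on the whole coset (k/14)e + ℤ². -/
lemma theta7_tau_add_one {k : ℤ} (hk : Odd k) (t : ℝ) (τ : ℂ) :
    theta7 (k / 14) t (τ + 1) = ex (k ^ 2 / 28) * theta7 (k / 14) t τ := by
  rw [theta7_eq, theta7_eq, ← tsum_mul_left]
  refine tsum_congr fun n => ?_
  obtain ⟨j, rfl⟩ := hk
  have e : ∀ m : ℤ, ∃ a, (2 * j + 1) * m + 3 * m ^ 2 = 2 * a := fun m => by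
    obtain ⟨b, hb⟩ := Int.even_mul_succ_self m
    exact ⟨j * m - m + 3 * b, by linear_combination 3 * hb⟩
  obtain ⟨a, ha⟩ := e n.1
  obtain ⟨b, hb⟩ := e n.2
  have ha' := congrArg ((↑) : ℤ → ℂ) ha
  have hb' := congrArg ((↑) : ℤ → ℂ) hb
  have h : quadExp (7 * t) (7 * t) (τ + 1) ((2 * j + 1 : ℤ) / 14 + n.1)
        ((2 * j + 1 : ℤ) / 14 + n.2) = ex ((2 * j + 1 : ℤ) ^ 2 / 28)
      * quadExp (7 * t) (7 * t) τ ((2 * j + 1 : ℤ) / 14 + n.1) ((2 * j + 1 : ℤ) / 14 + n.2) := by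
    rw [← ex_eq_of_sub_eq (x := (2 * j + 1 : ℤ) ^ 2 / 28 + (a + b + 4 * n.1 * n.2 : ℤ))
      (n := a + b + 4 * n.1 * n.2) (by ring), ex, quadExp, quadExp, ← exp_add]
    congr 1
    push_cast at ha' hb' ⊢
    linear_combination (Real.pi * I) * (ha' + hb')
  rw [h, add_im, one_im, add_zero]
  ring

/-- The functions `θ_{m/14 e, 1/14 e}`, normalized to be odd and periodic in `m`. -/
def thetaOdd (m : ℤ) (τ : ℂ) : ℂ := ex (-m / 14) * theta7 (m / 14) (1 / 14) τ

lemma thetaOdd_add (m : ℤ) (τ : ℂ) : thetaOdd (m + 14) τ = thetaOdd m τ := by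
  rw [thetaOdd, thetaOdd, ex_eq_of_sub_eq (y := -m / 14) (n := -1) (by push_cast; ring),
    ← theta7_add_one (m / 14)]
  congr 2
  push_cast
  ring

lemma theta7_eq_thetaOdd (m l : ℤ) {t : ℝ} (ht : t = (2 * l + 1) / 14) (τ : ℂ) :
    theta7 (m / 14) t τ = ex (t * m) * thetaOdd m τ := by
  rw [thetaOdd, ht, show (2 * l + 1 : ℝ) / 14 = 1 / 14 + l / 7 by ring, theta7_add_int_div,
    ← mul_assoc, ← ex_add]
  congr 2
  ring

lemma thetaOdd_neg (m : ℤ) (τ : ℂ) : thetaOdd (-m) τ = -thetaOdd m τ := by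
  rw [thetaOdd, show ((-m : ℤ) : ℝ) / 14 = -(m / 14) by push_cast; ring,
    show (1 / 14 : ℝ) = -(-1 / 14) by ring, theta7_neg_neg,
    theta7_eq_thetaOdd m (-1) (by push_cast; ring), mul_neg, ← mul_assoc, ← ex_add]
  rw [show (-(-m : ℤ) / 14 + -1 / 14 * m : ℝ) = 0 by push_cast; ring, ex_zero, one_mul]

lemma thetaOdd_seven (τ : ℂ) : thetaOdd 7 τ = 0 := by
  have h1 := thetaOdd_neg 7 τ
  have h2 := thetaOdd_add (-7) τ
  norm_num at h1 h2
  rw [h1] at h2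
  linear_combination (1 / 2 : ℂ) * h2

lemma ex_neg_sub_ex (x : ℝ) : ex (-x) - ex x = -2 * I * Real.sin (2 * Real.pi * x) := by
  have e1 : ex (-x) = exp (-(2 * Real.pi * x) * I) := by rw [ex]; congr 1; push_cast; ring
  have e2 : ex x = exp ((2 * Real.pi * x) * I) := by rw [ex]; congr 1; ring
  rw [e1, e2, ofReal_sin, Complex.sin]
  push_cast
  linear_combination (exp (-(2 * Real.pi * x) * I) - exp ((2 * Real.pi * x) * I)) * I_sq

/-- Among the odd residues modulo 14 the class 7 contributes nothing, and m is paired with 14 - m by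
oddness; each pair of exponentials becomes a sine. -/
lemma thetaOdd_neg_one_div (l : ℤ) {τ : ℂ} (hτ : 0 < τ.im) :
    thetaOdd (2 * l + 1) (-1 / τ) = τ / Real.sqrt 7 * (-2 * I) *
      (Real.sin (Real.pi * (2 * l + 1) / 7) * thetaOdd 1 τ
        + Real.sin (Real.pi * (2 * l + 1) * 3 / 7) * thetaOdd 3 τ
        + Real.sin (Real.pi * (2 * l + 1) * 5 / 7) * thetaOdd 5 τ) := by
  have h := theta7_neg_one_div ((2 * l + 1 : ℤ) / 14) (1 / 14) hτ
  have hk : ∀ k : Fin 7, theta7 (1 / 14 + (k : ℕ) / 7) (-((2 * l + 1 : ℤ) / 14)) τ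
      = ex (-(2 * l + 1) / 14 * (1 + 2 * (k : ℕ) : ℤ)) * thetaOdd (1 + 2 * (k : ℕ)) τ := fun k => by
    rw [show (1 / 14 + (k : ℕ) / 7 : ℝ) = ((1 + 2 * (k : ℕ) : ℤ) : ℝ) / 14 by push_cast; ring,
      theta7_eq_thetaOdd _ (-l - 1) (by push_cast; ring)]
    congr 2
    push_cast
    ring
  have hp : ∀ m : ℤ, ex (-(2 * l + 1) / 14 * (14 - m : ℤ)) * thetaOdd (14 - m) τ
      = -(ex ((2 * l + 1) / 14 * m) * thetaOdd m τ) := fun m => by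
    rw [show 14 - m = -m + 14 by ring, thetaOdd_add, thetaOdd_neg,
      ex_eq_of_sub_eq (y := (2 * l + 1) / 14 * m) (n := -(2 * l + 1)) (by push_cast; ring)]
    ring
  have hs : ∀ m : ℤ, ex (-(2 * l + 1) / 14 * m) - ex ((2 * l + 1) / 14 * m)
      = -2 * I * Real.sin (Real.pi * (2 * l + 1) * m / 7) := fun m => by
    have := ex_neg_sub_ex ((2 * l + 1) / 14 * m)
    rw [show -((2 * l + 1) / 14 * m : ℝ) = -(2 * l + 1) / 14 * m by ring] at this
    rw [this]
    congr 3
    ring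
  have hsum : ∀ g : ℤ → ℂ, ∑ k : Fin 7, g (1 + 2 * (k : ℕ))
      = g 1 + g 3 + g 5 + g 7 + g (14 - 5) + g (14 - 3) + g (14 - 1) := fun g => by
    rw [Fin.sum_univ_seven]; rfl
  have h1 := hs 1
  have h3 := hs 3
  have h5 := hs 5
  have e1 : ex (14 * ((2 * l + 1 : ℤ) / 14) * (1 / 14)) = ex ((2 * l + 1 : ℤ) / 14) := by
    congr 1; ring
  have e2 : ex (-(2 * l + 1 : ℤ) / 14) * ex ((2 * l + 1 : ℤ) / 14) = 1 := by
    rw [← ex_add, neg_div, neg_add_cancel, ex_zero]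
  rw [Finset.sum_congr rfl fun k _ => hk k, e1,
    hsum fun m => ex (-(2 * l + 1) / 14 * m) * thetaOdd m τ] at h
  simp only [hp, thetaOdd_seven] at h
  rw [thetaOdd, h]
  push_cast at h1 h3 h5 e2 ⊢
  simp only [mul_one] at h1 ⊢
  linear_combination (τ / Real.sqrt 7) * (ex (-(2 * l + 1) / 14) * ex ((2 * l + 1) / 14)) *
      (thetaOdd 1 τ * h1 + thetaOdd 3 τ * h3 + thetaOdd 5 τ * h5)
    + (τ / Real.sqrt 7) * (-2 * I) * (sin (Real.pi * (2 * l + 1) / 7) * thetaOdd 1 τ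
        + sin (Real.pi * (2 * l + 1) * 3 / 7) * thetaOdd 3 τ
        + sin (Real.pi * (2 * l + 1) * 5 / 7) * thetaOdd 5 τ) * e2

lemma H7_eq_thetaOdd (τ : ℂ) :
    H7 τ = (1 / (2 * ModularForm.eta τ)) • ![thetaOdd 1 τ, thetaOdd 3 τ, thetaOdd 5 τ] := by
  have h1 := theta7_eq_thetaOdd 1 0 (t := 1 / 14) (by norm_num) τ
  have h3 := theta7_eq_thetaOdd 3 2 (t := 5 / 14) (by norm_num) τ
  have h5 := theta7_eq_thetaOdd 5 1 (t := 3 / 14) (by norm_num) τ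
  have e : ex (15 / 14) = ex (1 / 14) := ex_eq_of_sub_eq (n := 1) (by norm_num)
  have e0 : ex (-1 / 14) * ex (1 / 14) = 1 := by rw [← ex_add]; norm_num [ex_zero]
  norm_num at h1 h3 h5
  norm_num [e] at h3 h5
  have hv : ![theta7 (1 / 14) (1 / 14) τ, theta7 (3 / 14) (5 / 14) τ, theta7 (5 / 14) (3 / 14) τ]
      = ex (1 / 14) • ![thetaOdd 1 τ, thetaOdd 3 τ, thetaOdd 5 τ] := by
    rw [h1, h3, h5]; simp
  rw [H7, hv, smul_smul, zeta_inv_eq_ex]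
  congr 1
  push_cast
  rw [div_mul_eq_mul_div, e0]

lemma eta_add_one (τ : ℂ) : ModularForm.eta (τ + 1) = ex (1 / 24) * ModularForm.eta τ := by
  have h : ∀ x : ℝ, qPow x (τ + 1) = ex x * qPow x τ := fun x => by
    rw [ex, qPow, qPow, ← exp_add]
    congr 1
    ring
  have h1 := ex_intCast 1
  rw [Int.cast_one] at h1
  rw [eta_eq, eta_eq, h, h, h1, one_mul, mul_assoc]

lemma eta_neg_one_div {τ : ℂ} (hτ : 0 < τ.im) :
    ModularForm.eta (-1 / τ) = (-I * τ) ^ (1 / 2 : ℂ) * ModularForm.eta τ := by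
  have h0 : τ ≠ 0 := fun h => by simp [h] at hτ
  have h := ModularForm.eta_comp_eq_csqrt_I_inv (x := τ) hτ
  -- For arg τ in [0, π] the shifted argument arg τ - π/2 stays in the principal range, so no branch
  -- correction occurs.
  have hlog : log (-I * τ) = log τ - log I := by
    rw [log_mul_eq_add_log_iff (neg_ne_zero.2 I_ne_zero) h0 |>.2, log_neg_I, log_I]
    · ring
    · rw [arg_neg_I]
      have h1 := arg_nonneg_iff.2 hτ.le
      have h2 := arg_le_pi τ
      have := Real.pi_pos
      constructor <;> linarith
  have e : (-I * τ) ^ (1 / 2 : ℂ) = (sqrt I)⁻¹ * sqrt τ := by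
    rw [cpow_def_of_ne_zero (mul_ne_zero (neg_ne_zero.2 I_ne_zero) h0), hlog, sqrt_eq_exp h0,
      sqrt_eq_exp I_ne_zero, ← exp_neg, ← exp_add]
    congr 1
    ring
  rw [e]
  simpa [mul_assoc] using h

theorem H7_add_one (τ : ℂ) : H7 (τ + 1) = T7.mulVec (H7 τ) := by
  have h : ∀ l : ℤ, thetaOdd (2 * l + 1) (τ + 1)
      = ex ((2 * l + 1) ^ 2 / 28) * thetaOdd (2 * l + 1) τ := fun l => by
    rw [thetaOdd, thetaOdd, theta7_tau_add_one ⟨l, rfl⟩]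
    push_cast
    ring
  have h1 := h 0
  have h3 := h 1
  have h5 := h 2
  norm_num at h1 h3 h5
  have e : ∀ (x y : ℝ) (n : ℤ) , x - 1 / 24 - y = n → ex x / ex (1 / 24) = ex y :=
    fun x y n hn => by
      rw [div_eq_iff (ex_ne_zero _), ← ex_add]
      exact ex_eq_of_sub_eq (n := n) (by linarith)
  -- The exponents of the theta quotients are k²/28 - 1/24 modulo 1, for k = 1, 3, 5.
  have e1 := e (1 / 28) (-1 / 168) 0 (by norm_num)
  have e3 := e (9 / 28) (47 / 168) 0 (by norm_num)
  have e5 := e (25 / 28) (-25 / 168) 1 (by norm_num)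
  rw [H7_eq_thetaOdd, H7_eq_thetaOdd, eta_add_one, h1, h3, h5, T7, zeta_zpow_eq_ex,
    zeta_zpow_eq_ex, zeta_zpow_eq_ex]
  push_cast
  rw [← e1, ← e3, ← e5]
  funext j
  rw [Matrix.mulVec_diagonal]
  fin_cases j <;> simp <;> ring

theorem H7_neg_one_div {τ : ℂ} (hτ : 0 < τ.im) :
    H7 (-1 / τ) = (-I * τ) ^ (1 / 2 : ℂ) • M7.mulVec (H7 τ) := by
  have h0 : -I * τ ≠ 0 := mul_ne_zero (neg_ne_zero.2 I_ne_zero) fun h => by simp [h] at hτ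
  have h1 := thetaOdd_neg_one_div 0 hτ
  have h3 := thetaOdd_neg_one_div 1 hτ
  have h5 := thetaOdd_neg_one_div 2 hτ
  have s05 : Real.sin (Real.pi * (2 * (0 : ℤ) + 1) * 5 / 7) = Real.sin (2 * Real.pi / 7) := by
    rw [← Real.sin_pi_sub]; congr 1; push_cast; ring
  have s13 : Real.sin (Real.pi * (2 * (1 : ℤ) + 1) * 3 / 7) = -Real.sin (2 * Real.pi / 7) := by
    rw [← Real.sin_add_pi]; congr 1; push_cast; ring
  have s15 : Real.sin (Real.pi * (2 * (1 : ℤ) + 1) * 5 / 7) = Real.sin (Real.pi / 7) := by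
    rw [← Real.sin_add_two_pi (Real.pi / 7)]; congr 1; push_cast; ring
  have s21 : Real.sin (Real.pi * (2 * (2 : ℤ) + 1) / 7) = Real.sin (2 * Real.pi / 7) := by
    rw [← Real.sin_pi_sub]; congr 1; push_cast; ring
  have s23 : Real.sin (Real.pi * (2 * (2 : ℤ) + 1) * 3 / 7) = Real.sin (Real.pi / 7) := by
    rw [← Real.sin_add_two_pi (Real.pi / 7)]; congr 1; push_cast; ring
  have s25 : Real.sin (Real.pi * (2 * (2 : ℤ) + 1) * 5 / 7) = -Real.sin (3 * Real.pi / 7) := by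
    rw [← Real.sin_pi_sub (3 * Real.pi / 7), ← Real.sin_add_pi,
      ← Real.sin_add_two_pi (Real.pi - 3 * Real.pi / 7 + Real.pi)]
    congr 1; push_cast; ring
  have s03 : Real.sin (Real.pi * (2 * (0 : ℤ) + 1) * 3 / 7) = Real.sin (3 * Real.pi / 7) := by
    congr 1; push_cast; ring
  have s01 : Real.sin (Real.pi * (2 * (0 : ℤ) + 1) / 7) = Real.sin (Real.pi / 7) := by
    congr 1; push_cast; ring
  have s11 : Real.sin (Real.pi * (2 * (1 : ℤ) + 1) / 7) = Real.sin (3 * Real.pi / 7) := by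
    congr 1; push_cast; ring
  rw [s01, s03, s05] at h1
  rw [s11, s13, s15] at h3
  rw [s21, s23, s25] at h5
  norm_num only at h1 h3 h5
  set r := (-I * τ) ^ (1 / 2 : ℂ) with hr
  have hr2 : r ^ 2 = -I * τ := by
    rw [hr, ← cpow_nat_mul]; norm_num
  have hr0 : r ≠ 0 := fun h => h0 (by rw [← hr2, h]; norm_num)
  -- The theta functions have weight 1 and η has weight 1/2: the factor -iτ = r² divided by r leaves
  -- r.
  have key : ∀ X : ℂ, 1 / (2 * (r * ModularForm.eta τ)) * (τ / Real.sqrt 7 * (-2 * I) * X)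
      = r * (2 / Real.sqrt 7 * (1 / (2 * ModularForm.eta τ) * X)) := fun X => by
    have e0 := eta_ne_zero hτ
    have h7 : (Real.sqrt 7 : ℂ) ≠ 0 := by exact_mod_cast (Real.sqrt_pos.2 (by norm_num)).ne'
    field_simp
    linear_combination (-X) * hr2
  rw [H7_eq_thetaOdd, H7_eq_thetaOdd, eta_neg_one_div hτ, h1, h3, h5, ← hr, M7]
  funext j
  fin_cases j
  all_goals
    simp only [Fin.zero_eta, Fin.mk_one, Fin.reduceFinMk, Pi.smul_apply, smul_eq_mul,
      Matrix.cons_val, Matrix.smul_mulVec, Matrix.mulVec_smul, Matrix.mulVec, dotProduct,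
      Fin.sum_univ_three, Matrix.map_apply, Matrix.of_apply]
    rw [key]
    push_cast
    ring

end

end MockTheta

namespace MockTheta

noncomputable section

open Complex MeasureTheory Set Filter Matrix

/-! ### The action of the full modular group -/

/-- The automorphy factor `c τ + d`. -/
def denomJ (γ : SpecialLinearGroup (Fin 2) ℤ) (τ : ℂ) : ℂ := (γ 1 0 : ℂ) * τ + (γ 1 1 : ℂ)

/-- The fractional linear action `(a τ + b) / (c τ + d)`. -/
def moebius (γ : SpecialLinearGroup (Fin 2) ℤ) (τ : ℂ) : ℂ :=
  ((γ 0 0 : ℂ) * τ + (γ 0 1 : ℂ)) / denomJ γ τ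

lemma det_eq_one_cast (γ : SpecialLinearGroup (Fin 2) ℤ) :
    (γ 0 0 : ℂ) * γ 1 1 - γ 0 1 * γ 1 0 = 1 := by
  have h := γ.det_coe
  rw [det_fin_two] at h
  exact_mod_cast h

lemma denomJ_ne_zero (γ : SpecialLinearGroup (Fin 2) ℤ) {τ : ℂ} (hτ : 0 < τ.im) :
    denomJ γ τ ≠ 0 := by
  intro h
  have him := congrArg Complex.im h
  have hre := congrArg Complex.re h
  simp [denomJ, hτ.ne'] at him hre
  have hd := det_eq_one_cast γ
  simp [him] at hre hd
  simp [hre] at hd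

lemma denomJ_mul (γ δ : SpecialLinearGroup (Fin 2) ℤ) {τ : ℂ} (hτ : 0 < τ.im) :
    denomJ (γ * δ) τ = denomJ γ (moebius δ τ) * denomJ δ τ := by
  have h := denomJ_ne_zero δ hτ
  rw [denomJ, denomJ, moebius, add_mul, mul_assoc, div_mul_cancel₀ _ h]
  simp [denomJ, Matrix.mul_apply, Fin.sum_univ_two]
  ring

lemma moebius_mul (γ δ : SpecialLinearGroup (Fin 2) ℤ) {τ : ℂ} (hτ : 0 < τ.im) :
    moebius (γ * δ) τ = moebius γ (moebius δ τ) := by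
  have h := denomJ_ne_zero δ hτ
  have e : ((γ * δ) 0 0 : ℂ) * τ + ((γ * δ) 0 1 : ℂ)
      = ((γ 0 0 : ℂ) * moebius δ τ + (γ 0 1 : ℂ)) * denomJ δ τ := by
    rw [add_mul, mul_assoc, moebius, div_mul_cancel₀ _ h]
    simp [denomJ, Matrix.mul_apply, Fin.sum_univ_two]
    ring
  rw [show moebius (γ * δ) τ = (((γ * δ) 0 0 : ℂ) * τ + ((γ * δ) 0 1 : ℂ)) / denomJ (γ * δ) τ
    from rfl, e, denomJ_mul γ δ hτ, mul_div_mul_right _ _ h]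
  rfl

lemma moebius_one (τ : ℂ) : moebius 1 τ = τ := by simp [moebius, denomJ]

lemma im_moebius_pos (γ : SpecialLinearGroup (Fin 2) ℤ) {τ : ℂ} (hτ : 0 < τ.im) :
    0 < (moebius γ τ).im := by
  have h := normSq_pos.2 (denomJ_ne_zero γ hτ)
  have hd : (γ 0 0 : ℝ) * γ 1 1 - γ 0 1 * γ 1 0 = 1 := by exact_mod_cast det_eq_one_cast γ
  have e : (moebius γ τ).im = τ.im / normSq (denomJ γ τ) := by
    rw [moebius, div_im, ← sub_div]
    congr 1
    simp [denomJ]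
    linear_combination τ.im * hd
  rw [e]
  exact div_pos hτ h

lemma continuousOn_moebius (γ : SpecialLinearGroup (Fin 2) ℤ) :
    ContinuousOn (moebius γ) {τ : ℂ | 0 < τ.im} := by
  unfold moebius
  refine ContinuousOn.div (by fun_prop) (by unfold denomJ; fun_prop) fun τ hτ => denomJ_ne_zero γ hτ

/-- If c = 0 the factor is constant, possibly on the branch cut; otherwise cτ + d has nonzero
imaginary part and avoids it. -/
lemma continuousOn_denomJ_cpow (γ : SpecialLinearGroup (Fin 2) ℤ) (k : ℂ) :
    ContinuousOn (fun τ => denomJ γ τ ^ k) {τ : ℂ | 0 < τ.im} := by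
  rcases eq_or_ne (γ 1 0) 0 with hc | hc
  · simp only [denomJ, hc, Int.cast_zero, zero_mul, zero_add]
    exact continuousOn_const
  · refine ContinuousOn.cpow (by unfold denomJ; fun_prop) continuousOn_const fun τ hτ => ?_
    refine Or.inr ?_
    have hc' : (γ 1 0 : ℝ) ≠ 0 := by exact_mod_cast hc
    simpa [denomJ] using And.intro hc (ne_of_gt hτ)

lemma isPreconnected_upperHalf : IsPreconnected {τ : ℂ | 0 < τ.im} :=
  (convex_halfSpace_im_gt 0).isPreconnected

/-- Weight one half transformation behaviour, up to the choice of the square root. -/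
def HasHalfWeight {m : ℕ} (f : ℂ → Fin m → ℂ) (γ : SpecialLinearGroup (Fin 2) ℤ) : Prop :=
  ∃ (M : GL (Fin m) ℂ) (σ : ℂ → ℂ), ContinuousOn σ {τ : ℂ | 0 < τ.im} ∧
    ∀ τ : ℂ, 0 < τ.im → σ τ ^ 2 = denomJ γ τ ∧
      f (moebius γ τ) = σ τ • (M : Matrix (Fin m) (Fin m) ℂ).mulVec (f τ)

variable {m : ℕ} {f : ℂ → Fin m → ℂ} {γ δ : SpecialLinearGroup (Fin 2) ℤ}

lemma HasHalfWeight.one : HasHalfWeight f 1 :=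
  ⟨1, fun _ => 1, continuousOn_const, fun τ _ => by simp [denomJ, moebius_one]⟩

lemma HasHalfWeight.mul (h₁ : HasHalfWeight f γ) (h₂ : HasHalfWeight f δ) :
    HasHalfWeight f (γ * δ) := by
  obtain ⟨M, σ, hσ, h⟩ := h₁
  obtain ⟨N, ρ, hρ, h'⟩ := h₂
  refine ⟨M * N, fun τ => σ (moebius δ τ) * ρ τ,
    (hσ.comp (continuousOn_moebius δ) fun τ hτ => im_moebius_pos δ hτ).mul hρ, fun τ hτ => ?_⟩
  obtain ⟨a1, a2⟩ := h _ (im_moebius_pos δ hτ)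
  obtain ⟨b1, b2⟩ := h' _ hτ
  refine ⟨by rw [mul_pow, a1, b1, denomJ_mul γ δ hτ], ?_⟩
  rw [moebius_mul γ δ hτ, a2, b2, mulVec_smul, smul_smul, Units.val_mul, mulVec_mulVec]

lemma HasHalfWeight.inv (h₁ : HasHalfWeight f γ) : HasHalfWeight f γ⁻¹ := by
  obtain ⟨M, σ, hσ, h⟩ := h₁
  have h0 : ∀ τ : ℂ, 0 < τ.im → σ (moebius γ⁻¹ τ) ≠ 0 := fun τ hτ h0 => by
    have := (h _ (im_moebius_pos γ⁻¹ hτ)).1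
    rw [h0] at this
    exact denomJ_ne_zero γ (im_moebius_pos γ⁻¹ hτ) (by rw [← this]; norm_num)
  refine ⟨M⁻¹, fun τ => (σ (moebius γ⁻¹ τ))⁻¹,
    (hσ.comp (continuousOn_moebius _) fun τ hτ => im_moebius_pos _ hτ).inv₀ h0, fun τ hτ => ?_⟩
  obtain ⟨a1, a2⟩ := h _ (im_moebius_pos γ⁻¹ hτ)
  have e := denomJ_mul γ γ⁻¹ hτ
  rw [mul_inv_cancel] at e
  have e1 : denomJ 1 τ = 1 := by simp [denomJ]
  rw [e1] at e
  rw [← moebius_mul γ γ⁻¹ hτ, mul_inv_cancel, moebius_one] at a2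
  refine ⟨by rw [inv_pow, a1]; exact inv_eq_of_mul_eq_one_right e.symm, ?_⟩
  rw [a2, mulVec_smul, mulVec_mulVec, ← Units.val_mul, inv_mul_cancel, Units.val_one, one_mulVec,
    smul_smul, inv_mul_cancel₀ (h0 τ hτ), one_smul]

lemma HasHalfWeight.of_generators (hS : HasHalfWeight f ModularGroup.S)
    (hT : HasHalfWeight f ModularGroup.T) (γ : SpecialLinearGroup (Fin 2) ℤ) :
    HasHalfWeight f γ := by
  have hγ : γ ∈ Subgroup.closure {ModularGroup.S, ModularGroup.T} := by
    rw [SpecialLinearGroup.SL2Z_generators]; trivial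
  induction hγ using Subgroup.closure_induction with
  | mem x hx =>
    rcases hx with rfl | rfl
    · exact hS
    · exact hT
  | one => exact .one
  | mul _ _ _ _ h1 h2 => exact h1.mul h2
  | inv _ _ h => exact h.inv

/-- Two continuous square roots of a nonvanishing function on a connected set differ by a global
sign, which the matrix absorbs. Until this point only σ² = cτ + d has to be tracked, which is stable
under products and inverses. -/
lemma HasHalfWeight.principal (h : HasHalfWeight f γ) : ∃ M : GL (Fin m) ℂ,
    ∀ τ : ℂ, 0 < τ.im → f (moebius γ τ) =
      denomJ γ τ ^ ((1 / 2 : ℝ) : ℂ) • (M : Matrix (Fin m) (Fin m) ℂ).mulVec (f τ) := by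
  obtain ⟨M, σ, hσ, h⟩ := h
  have hsq : ∀ τ : ℂ, (denomJ γ τ ^ ((1 / 2 : ℝ) : ℂ)) ^ 2 = denomJ γ τ := fun τ => by
    rw [← cpow_nat_mul]; norm_num
  rcases isPreconnected_upperHalf.eq_or_eq_neg_of_sq_eq hσ (continuousOn_denomJ_cpow γ _)
    (fun τ hτ => by simp only [Pi.pow_apply]; rw [(h τ hτ).1, hsq])
    (fun {τ} hτ h0 => denomJ_ne_zero γ hτ (by rw [← hsq, h0]; norm_num)) with h1 | h1
  · exact ⟨M, fun τ hτ => by rw [(h τ hτ).2, h1 hτ]⟩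
  · refine ⟨-M, fun τ hτ => ?_⟩
    rw [(h τ hτ).2, h1 hτ, Units.val_neg, neg_mulVec, smul_neg, Pi.neg_apply, neg_smul]

/-- With x, y, z the sines of π/7, 2π/7, 3π/7, the determinant without its scalar factor is 3xyz +
y³ + z³ - x³, positive because z > x > 0. -/
lemma det_M7_ne_zero : M7.det ≠ 0 := by
  have hπ := Real.pi_pos
  have h1 : 0 < Real.sin (Real.pi / 7) := Real.sin_pos_of_pos_of_lt_pi (by linarith) (by linarith)
  have h2 : 0 < Real.sin (2 * Real.pi / 7) :=
    Real.sin_pos_of_pos_of_lt_pi (by linarith) (by linarith)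
  have h3 : Real.sin (Real.pi / 7) < Real.sin (3 * Real.pi / 7) :=
    Real.sin_lt_sin_of_lt_of_le_pi_div_two (by linarith) (by linarith) (by linarith)
  have hd := (ofRealHom.map_det !![Real.sin (Real.pi / 7), Real.sin (3 * Real.pi / 7),
      Real.sin (2 * Real.pi / 7); Real.sin (3 * Real.pi / 7), -Real.sin (2 * Real.pi / 7),
      Real.sin (Real.pi / 7); Real.sin (2 * Real.pi / 7), Real.sin (Real.pi / 7),
      -Real.sin (3 * Real.pi / 7)]).symm
  rw [M7, det_smul]
  refine mul_ne_zero (pow_ne_zero _ (ofReal_ne_zero.2 (by positivity))) ?_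
  refine (hd.trans_ne ?_ :)
  rw [ofRealHom_eq_coe, ofReal_ne_zero, det_fin_three]
  simp only [of_apply, cons_val]
  generalize Real.sin (Real.pi / 7) = x at *
  generalize Real.sin (2 * Real.pi / 7) = y at *
  generalize Real.sin (3 * Real.pi / 7) = z at *
  have h4 : x ^ 3 < z ^ 3 := pow_lt_pow_left₀ h3 h1.le three_ne_zero
  have h5 : 0 < y ^ 3 := pow_pos h2 3
  have h6 : 0 < x * y * z := mul_pos (mul_pos h1 h2) (h1.trans h3)
  refine ne_of_gt ?_
  nlinarith

lemma hasHalfWeight_H7_S : HasHalfWeight H7 ModularGroup.S := by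
  have hz : ex (1 / 8) ^ 2 = I := by
    rw [pow_two, ← ex_add, ex]
    refine Eq.trans ?_ exp_pi_div_two_mul_I
    congr 1
    push_cast
    ring
  have h1 : ∀ τ, moebius ModularGroup.S τ = -1 / τ := fun τ => by
    simp [moebius, denomJ, ModularGroup.S]
  have h2 : ∀ τ, denomJ ModularGroup.S τ = τ := fun τ => by simp [denomJ, ModularGroup.S]
  have hu : IsUnit (ex (-1 / 8) • M7).det := by
    rw [det_smul]
    exact isUnit_iff_ne_zero.2 (mul_ne_zero (pow_ne_zero _ (ex_ne_zero _)) det_M7_ne_zero)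
  -- The eighth root of unity converts √(-iτ) into a square root of τ, and its inverse goes into the
  -- matrix.
  refine ⟨GeneralLinearGroup.mk'' (ex (-1 / 8) • M7) hu,
    fun τ => ex (1 / 8) * (-I * τ) ^ (1 / 2 : ℂ), ?_, fun τ hτ => ⟨?_, ?_⟩⟩
  · refine continuousOn_const.mul (ContinuousOn.cpow (by fun_prop) continuousOn_const ?_)
    intro τ hτ
    refine Or.inl ?_
    simpa using hτ
  · rw [mul_pow, hz, ← cpow_nat_mul, h2]
    norm_num
    linear_combination (-τ) * I_sq
  · have e : ex (1 / 8) * ex (-1 / 8) = 1 := by rw [← ex_add]; norm_num [ex_zero]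
    change _ = _ • (ex (-1 / 8) • M7).mulVec _
    rw [h1, H7_neg_one_div hτ, smul_mulVec, smul_smul, mul_right_comm, e, one_mul]

lemma hasHalfWeight_H7_T : HasHalfWeight H7 ModularGroup.T := by
  have hdet : IsUnit T7.det := by
    rw [T7, det_diagonal, isUnit_iff_ne_zero, Finset.prod_ne_zero_iff]
    intro j _
    fin_cases j <;> simp [zeta_eq_ex, ex_ne_zero]
  refine ⟨GeneralLinearGroup.mk'' T7 hdet, fun _ => 1, continuousOn_const, fun τ _ => ?_⟩
  have h1 : moebius ModularGroup.T τ = τ + 1 := by simp [moebius, denomJ, ModularGroup.T]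
  have h2 : denomJ ModularGroup.T τ = 1 := by simp [denomJ, ModularGroup.T]
  rw [h1, h2, H7_add_one, one_smul]
  exact ⟨one_pow 2, rfl⟩

theorem H7_modular (γ : SpecialLinearGroup (Fin 2) ℤ) : ∃ M : GL (Fin 3) ℂ,
    ∀ τ : ℂ, 0 < τ.im →
      H7 (((γ 0 0 : ℂ) * τ + (γ 0 1 : ℂ)) / ((γ 1 0 : ℂ) * τ + (γ 1 1 : ℂ))) =
        ((γ 1 0 : ℂ) * τ + (γ 1 1 : ℂ)) ^ ((1 / 2 : ℝ) : ℂ) •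
          (M : Matrix (Fin 3) (Fin 3) ℂ).mulVec (H7 τ) :=
  (HasHalfWeight.of_generators hasHalfWeight_H7_S hasHalfWeight_H7_T γ).principal

end

end MockTheta

namespace MockTheta

noncomputable section

open Complex MeasureTheory Set Filter

open scoped ComplexConjugate BoundedContinuousFunction

/-! ### Real analytic functions as sums of products of holomorphic functions -/

/-- A continuous bilinear pairing of two Banach-valued holomorphic functions is analytic in two
complex variables, hence real-analytic in (x, y). -/
lemma analyticAt_pairing {E : Type*} [NormedAddCommGroup E] [NormedSpace ℂ E]
    {Φ : ℂ → E →L[ℂ] ℂ} {Ψ : ℂ → E} {τ : ℂ} (hΦ : AnalyticAt ℂ Φ τ.re)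
    (hΨ : AnalyticAt ℂ Ψ τ.im) : AnalyticAt ℝ (fun z : ℂ => Φ z.re (Ψ z.im)) τ := by
  have h1 : AnalyticAt ℂ (fun p : ℂ × ℂ => Φ p.1) ((τ.re : ℂ), (τ.im : ℂ)) :=
    hΦ.comp_of_eq analyticAt_fst rfl
  have h2 : AnalyticAt ℂ (fun p : ℂ × ℂ => Ψ p.2) ((τ.re : ℂ), (τ.im : ℂ)) :=
    hΨ.comp_of_eq analyticAt_snd rfl
  have h3 := ((ContinuousLinearMap.id ℂ (E →L[ℂ] ℂ)).analyticAt_bilinear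
    (Φ τ.re, Ψ τ.im)).comp_of_eq (h1.prod h2) rfl
  exact (h3.restrictScalars (𝕜 := ℝ)).comp_of_eq
    (((ofRealCLM.comp reCLM).prod (ofRealCLM.comp imCLM)).analyticAt τ) rfl

/-- The functions `u i`, `v i` are holomorphic on `U` and on `V`, with summable bounds. -/
structure SeparatedSeries {ι : Type*} (u v : ι → ℂ → ℂ) (A B : ι → ℝ) (U V : Set ℂ) : Prop where
  summable_left : Summable A
  summable_right : Summable B
  open_left : IsOpen U
  open_right : IsOpen V
  diff_left : ∀ i, DifferentiableOn ℂ (u i) U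
  diff_right : ∀ i, DifferentiableOn ℂ (v i) V
  norm_left_le : ∀ i, ∀ z ∈ U, ‖u i z‖ ≤ A i
  norm_right_le : ∀ i, ∀ z ∈ V, ‖v i z‖ ≤ B i

namespace SeparatedSeries

variable {ι : Type*} {u v : ι → ℂ → ℂ} {A B : ι → ℝ} {U V : Set ℂ} {τ : ℂ}

/-- The sum ∑ uᵢ(x)vᵢ(y) is the value of the functional Φ(x) = ∑ uᵢ(x)evᵢ at the bounded function
Ψ(y) = ∑ vᵢ(y)eᵢ. Both series converge uniformly in norm, so Φ and Ψ are holomorphic. -/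
theorem analyticAt (h : SeparatedSeries u v A B U V) (hτU : (τ.re : ℂ) ∈ U)
    (hτV : (τ.im : ℂ) ∈ V) : AnalyticAt ℝ (fun z : ℂ => ∑' i, u i z.re * v i z.im) τ := by
  -- With the discrete topology the bounded continuous functions are all bounded functions on ι.
  let _ : TopologicalSpace ι := ⊥
  have _ : DiscreteTopology ι := ⟨rfl⟩
  classical
  let e : ι → (ι →ᵇ ℂ) := fun i =>
    BoundedContinuousFunction.ofNormedAddCommGroupDiscrete (Pi.single i 1) 1 fun j => by
      rcases eq_or_ne j i with rfl | hj
      · simp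
      · simp [hj]
  have he : ∀ i j, e i j = if j = i then 1 else 0 := fun i j => by
    change (Pi.single i 1 : ι → ℂ) j = _
    rw [Pi.single_apply]
  have hen : ∀ i, ‖e i‖ ≤ 1 := fun i =>
    (BoundedContinuousFunction.norm_le zero_le_one).2 fun j => by
      rw [he]; split_ifs <;> simp
  let ev : ι → ((ι →ᵇ ℂ) →L[ℂ] ℂ) := fun i => BoundedContinuousFunction.evalCLM ℂ i
  have hevn : ∀ i, ‖ev i‖ ≤ 1 := fun i =>
    ContinuousLinearMap.opNorm_le_bound _ zero_le_one fun f => by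
      rw [one_mul]; exact f.norm_coe_le_norm i
  have bΦ : ∀ i, ∀ z ∈ U, ‖u i z • ev i‖ ≤ A i := fun i z hz => by
    rw [norm_smul]
    exact (mul_le_of_le_one_right (norm_nonneg _) (hevn i)).trans (h.norm_left_le i z hz)
  have bΨ : ∀ i, ∀ z ∈ V, ‖v i z • e i‖ ≤ B i := fun i z hz => by
    rw [norm_smul]
    exact (mul_le_of_le_one_right (norm_nonneg _) (hen i)).trans (h.norm_right_le i z hz)
  let Φ : ℂ → ((ι →ᵇ ℂ) →L[ℂ] ℂ) := fun z => ∑' i, u i z • ev i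
  let Ψ : ℂ → (ι →ᵇ ℂ) := fun z => ∑' i, v i z • e i
  have dΦ : DifferentiableOn ℂ Φ U :=
    differentiableOn_tsum_of_summable_norm h.summable_left (fun i => (h.diff_left i).smul_const (ev i)) h.open_left bΦ
  have dΨ : DifferentiableOn ℂ Ψ V :=
    differentiableOn_tsum_of_summable_norm h.summable_right (fun i => (h.diff_right i).smul_const (e i)) h.open_right bΨ
  have hΨ : ∀ z ∈ V, ∀ j, Ψ z j = v j z := fun z hz j => by
    have hs : Summable fun i => v i z • e i := .of_norm_bounded h.summable_right fun i => bΨ i z hz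
    have := (ev j).map_tsum hs
    refine this.trans ?_
    refine (tsum_eq_single j fun i hi => ?_).trans ?_
    · simp [ev, he, hi.symm]
    · simp [ev, he]
  have hΦ : ∀ z ∈ U, ∀ w, Φ z w = ∑' i, u i z * w i := fun z hz w => by
    have hs : Summable fun i => u i z • ev i := .of_norm_bounded h.summable_left fun i => bΦ i z hz
    have := (ContinuousLinearMap.apply ℂ ℂ w).map_tsum hs
    exact this
  have hb := analyticAt_pairing (dΦ.analyticAt (h.open_left.mem_nhds hτU))
    (dΨ.analyticAt (h.open_right.mem_nhds hτV))
  refine hb.congr ?_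
  have h1 : ∀ᶠ z : ℂ in nhds τ, (z.re : ℂ) ∈ U :=
    (continuous_ofReal.comp continuous_re).continuousAt.eventually (h.open_left.mem_nhds hτU)
  have h2 : ∀ᶠ z : ℂ in nhds τ, (z.im : ℂ) ∈ V :=
    (continuous_ofReal.comp continuous_im).continuousAt.eventually (h.open_right.mem_nhds hτV)
  filter_upwards [h1, h2] with z hz1 hz2
  rw [hΦ _ hz1]
  exact tsum_congr fun i => by rw [hΨ _ hz2]

lemma summable_bound_mul (h : SeparatedSeries u v A B U V) {y : ℂ} (hy : y ∈ V) :
    Summable (fun i => A i * ∑' j, B j) ∧ ∀ i, ‖v i y‖ ≤ ∑' j, B j :=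
  ⟨h.summable_left.mul_right _, fun i => (h.norm_right_le i y hy).trans
    (h.summable_right.le_tsum i fun j _ => (norm_nonneg _).trans (h.norm_right_le j y hy))⟩

lemma swap (h : SeparatedSeries u v A B U V) : SeparatedSeries v u B A V U :=
  ⟨h.2, h.1, h.4, h.3, h.6, h.5, h.8, h.7⟩

lemma hasSum_deriv (h : SeparatedSeries u v A B U V) {x y : ℂ} (hx : x ∈ U) (hy : y ∈ V) :
    ∃ d, HasSum (fun i => deriv (u i) x * v i y) d ∧
      HasDerivAt (fun z => ∑' i, u i z * v i y) d x := by
  obtain ⟨hs, hb⟩ := h.summable_bound_mul hy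
  have hd : ∀ i, DifferentiableOn ℂ (fun z => u i z * v i y) U :=
    fun i => (h.diff_left i).mul_const _
  have hle : ∀ i, ∀ z ∈ U, ‖u i z * v i y‖ ≤ A i * ∑' j, B j := fun i z hz => by
    rw [norm_mul]
    exact mul_le_mul (h.norm_left_le i z hz) (hb i) (norm_nonneg _)
      ((norm_nonneg _).trans (h.norm_left_le i z hz))
  have h1 := hasSum_deriv_of_summable_norm hs hd h.open_left hle hx
  have h2 := differentiableOn_tsum_of_summable_norm hs hd h.open_left hle
  refine ⟨_, ?_, ((h2.differentiableAt (h.open_left.mem_nhds hx)).hasDerivAt)⟩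
  refine h1.congr_fun fun i => ?_
  exact (deriv_mul_const ((h.diff_left i).differentiableAt (h.open_left.mem_nhds hx)) _).symm

theorem hasSum_fderiv_one (h : SeparatedSeries u v A B U V) (hτU : (τ.re : ℂ) ∈ U)
    (hτV : (τ.im : ℂ) ∈ V) : HasSum (fun i => deriv (u i) τ.re * v i τ.im)
      (fderiv ℝ (fun z : ℂ => ∑' i, u i z.re * v i z.im) τ 1) := by
  have hd := (h.analyticAt hτU hτV).differentiableAt.hasFDerivAt
  obtain ⟨d, hs, hd'⟩ := h.hasSum_deriv hτU hτV
  have hp : HasDerivAt (fun t : ℝ => (t : ℂ) + τ.im * I) 1 τ.re :=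
    ((hasDerivAt_id τ.re).ofReal_comp).add_const _
  have h1 := HasFDerivAt.comp_hasDerivAt_of_eq τ.re hd hp (re_add_im τ).symm
  have h2 := hd'.comp_ofReal
  have e : d = _ := h2.unique (h1.congr_of_eventuallyEq (.of_forall fun t => by simp))
  rwa [← e]

theorem hasSum_fderiv_I (h : SeparatedSeries u v A B U V) (hτU : (τ.re : ℂ) ∈ U)
    (hτV : (τ.im : ℂ) ∈ V) : HasSum (fun i => u i τ.re * deriv (v i) τ.im)
      (fderiv ℝ (fun z : ℂ => ∑' i, u i z.re * v i z.im) τ I) := by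
  have hd := (h.analyticAt hτU hτV).differentiableAt.hasFDerivAt
  obtain ⟨d, hs, hd'⟩ := h.swap.hasSum_deriv hτV hτU
  have hp : HasDerivAt (fun t : ℝ => (τ.re : ℂ) + t * I) (1 * I) τ.im :=
    (((hasDerivAt_id τ.im).ofReal_comp).mul_const I).const_add _
  rw [one_mul] at hp
  have h1 := HasFDerivAt.comp_hasDerivAt_of_eq τ.im hd hp (re_add_im τ).symm
  have h2 := hd'.comp_ofReal
  have e : d = _ := h2.unique (h1.congr_of_eventuallyEq (.of_forall fun t => by
    simp [mul_comm]))
  rw [← e]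
  simpa only [mul_comm] using hs

end SeparatedSeries

end

end MockTheta

namespace MockTheta

noncomputable section

open Complex MeasureTheory Set Filter

open scoped ComplexConjugate

/-! ### Real analyticity of the unary series -/

lemma sqrt_sq_complex (z : ℂ) : Complex.sqrt z ^ 2 = z := by
  rw [Complex.sqrt, ← cpow_nat_mul]; norm_num

lemma re_sqrt_nonneg (z : ℂ) : 0 ≤ (Complex.sqrt z).re := by
  rw [Complex.sqrt, cpow_inv_two_re]; positivity

lemma sqrt_ofReal_complex {y : ℝ} (hy : 0 ≤ y) : Complex.sqrt y = (Real.sqrt y : ℂ) := by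
  rw [Complex.sqrt, Real.sqrt_eq_rpow, ofReal_cpow hy]
  norm_num

lemma real_sign_mul_abs (x : ℝ) : Real.sign x * |x| = x := by
  rcases lt_trichotomy x 0 with h | h | h
  · rw [Real.sign_of_neg h, abs_of_neg h]; ring
  · simp [h]
  · rw [Real.sign_of_pos h, abs_of_pos h, one_mul]

lemma abs_real_sign_le (x : ℝ) : |Real.sign x| ≤ 1 := by
  rcases Real.sign_apply_eq x with h | h | h <;> rw [h] <;> norm_num

/-- The dependence of the terms of the unary series on the real part, with a weight. -/
def unaryLeft (ν b w : ℝ) (z : ℂ) : ℂ :=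
  exp (-Real.pi * I * ν ^ 2 * z - 2 * Real.pi * I * ν * b) * Real.exp (-w * ν ^ 2)

/-- The dependence of the terms of the unary series on the imaginary part, with a weight. -/
def unaryRight (ν w : ℝ) (z : ℂ) : ℂ :=
  Real.sign ν * erfcC (Real.sqrt 2 * |ν| * Complex.sqrt z) *
    (exp (Real.pi * ν ^ 2 * z) * Real.exp (w * ν ^ 2))

/-- The weights e^{∓wν²} cancel; they shift part of the decay from the y-factor to the x-factor, so
that both become summable near the point. -/
lemma unaryTerm_eq_mul (a b w : ℝ) {τ : ℂ} (hτ : 0 < τ.im) (n : ℤ) :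
    unaryTerm a b τ n = unaryLeft (a + n) b w τ.re * unaryRight (a + n) w τ.im := by
  have h1 : beta (2 * (a + n) ^ 2 * τ.im)
      = 1 - errorE (Real.sqrt 2 * |a + n| * Real.sqrt τ.im) := by
    rw [← beta_sq (by positivity)]
    congr 1
    rw [mul_pow, mul_pow, Real.sq_sqrt zero_le_two, Real.sq_sqrt hτ.le, sq_abs]
  have h2 : (Real.sqrt 2 * |a + n| * Complex.sqrt τ.im : ℂ)
      = ((Real.sqrt 2 * |a + n| * Real.sqrt τ.im : ℝ) : ℂ) := by
    rw [sqrt_ofReal_complex hτ.le]; push_cast; ring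
  have h3 : (Real.exp (-w * (a + n) ^ 2) : ℂ) * Real.exp (w * (a + n) ^ 2) = 1 := by
    rw [← ofReal_mul, ← Real.exp_add]; norm_num
  have h4 : exp (-Real.pi * I * ((a + n : ℝ) : ℂ) ^ 2 * τ - 2 * Real.pi * I * ((a + n : ℝ) : ℂ) * b)
      = exp (-Real.pi * I * ((a + n : ℝ) : ℂ) ^ 2 * τ.re - 2 * Real.pi * I * ((a + n : ℝ) : ℂ) * b)
        * exp (Real.pi * ((a + n : ℝ) : ℂ) ^ 2 * τ.im) := by
    rw [← exp_add]
    congr 1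
    nth_rewrite 1 [← re_add_im τ]
    linear_combination (-Real.pi * ((a + n : ℝ) : ℂ) ^ 2 * τ.im) * I_sq
  rw [unaryTerm, h4, h1, unaryLeft, unaryRight]
  push_cast at h2 h3 ⊢
  rw [h2, ← ofReal_ofNat, ← ofReal_intCast]
  have h5 := erfcC_ofReal (Real.sqrt 2 * |a + n| * Real.sqrt τ.im)
  push_cast at h5 ⊢
  rw [h5]
  linear_combination (-(Real.sign (a + n) * (1 - (errorE (Real.sqrt 2 * |a + n| * Real.sqrt τ.im)))
    * exp (-Real.pi * I * (a + n : ℂ) ^ 2 * τ.re - 2 * Real.pi * I * (a + n : ℂ) * b)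
    * exp (Real.pi * (a + n : ℂ) ^ 2 * τ.im))) * h3

/-- With w = πy/2 each factor keeps the decay e^{-πyν²/4}: on the left 1/4 - 1/2 = -1/4, on the
right -3/4 + 1/2 = -1/4, in units of πyν². -/
lemma separatedSeries_unary (a b : ℝ) {y : ℝ} (hy : 0 < y) :
    SeparatedSeries (fun n : ℤ => unaryLeft (a + n) b (Real.pi * y / 2))
      (fun n : ℤ => unaryRight (a + n) (Real.pi * y / 2))
      (fun n : ℤ => Real.exp (-(Real.pi * y / 4) * (a + n) ^ 2))
      (fun n : ℤ => Real.exp (-(Real.pi * y / 4) * (a + n) ^ 2))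
      {z : ℂ | z.im < y / 4} {z : ℂ | 3 * y / 4 < z.re} where
  summable_left := summable_exp_shifted_one (by have := Real.pi_pos; positivity) a
  summable_right := summable_exp_shifted_one (by have := Real.pi_pos; positivity) a
  open_left := isOpen_lt continuous_im continuous_const
  open_right := isOpen_lt continuous_const continuous_re
  diff_left n := by unfold unaryLeft; fun_prop
  diff_right n := by
    unfold unaryRight
    intro z hz
    have hz' : z ∈ slitPlane := Or.inl (by have : 3 * y / 4 < z.re := hz; linarith)
    have h1 : DifferentiableAt ℂ (fun z => erfcC (Real.sqrt 2 * |a + n| * Complex.sqrt z)) z :=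
      (differentiable_erfcC _).comp z ((differentiableAt_sqrt hz').const_mul _)
    refine DifferentiableAt.differentiableWithinAt ?_
    fun_prop
  norm_left_le n z hz := by
    have hz : z.im < y / 4 := hz
    rw [unaryLeft, norm_mul, norm_exp, norm_real, Real.norm_eq_abs, Real.abs_exp, ← Real.exp_add]
    refine Real.exp_le_exp.2 ?_
    have : (-Real.pi * I * ((a + n : ℝ) : ℂ) ^ 2 * z - 2 * Real.pi * I * ((a + n : ℝ) : ℂ) * b : ℂ)
      = ((-Real.pi * (a + n) ^ 2 : ℝ) : ℂ) * (I * z)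
        + ((-2 * Real.pi * (a + n) * b : ℝ) : ℂ) * I := by push_cast; ring
    rw [this, add_re, re_ofReal_mul, re_ofReal_mul, I_re, I_mul_re]
    have h1 : 0 ≤ Real.pi * (a + n) ^ 2 := by have := Real.pi_pos; positivity
    nlinarith
  norm_right_le n z hz := by
    have hz : 3 * y / 4 < z.re := hz
    have h0 : 0 ≤ ((Real.sqrt 2 * |a + n| : ℝ) * Complex.sqrt z : ℂ).re := by
      rw [re_ofReal_mul]; exact mul_nonneg (by positivity) (re_sqrt_nonneg z)
    have h1 := norm_erfcC_le h0
    have h2 : (((Real.sqrt 2 * |a + n| : ℝ) * Complex.sqrt z : ℂ) ^ 2).re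
        = 2 * (a + n) ^ 2 * z.re := by
      rw [mul_pow, sqrt_sq_complex, ← ofReal_pow, mul_pow, Real.sq_sqrt zero_le_two, sq_abs,
        re_ofReal_mul]
    have h3 : (Real.pi * ((a + n : ℝ) : ℂ) ^ 2 * z).re = Real.pi * (a + n) ^ 2 * z.re := by
      rw [← ofReal_pow, ← ofReal_mul, re_ofReal_mul]
    rw [h2] at h1
    rw [unaryRight, ← ofReal_mul, norm_mul, norm_mul, norm_mul, norm_exp, h3, norm_real, norm_real,
      Real.norm_eq_abs, Real.norm_eq_abs, Real.abs_exp, ← Real.exp_add]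
    calc _ ≤ 1 * Real.exp (-Real.pi * (2 * (a + n) ^ 2 * z.re)) *
          Real.exp (Real.pi * (a + n) ^ 2 * z.re + Real.pi * y / 2 * (a + n) ^ 2) := by
          have := abs_real_sign_le (a + n)
          gcongr
      _ ≤ _ := by
          rw [one_mul, ← Real.exp_add]
          refine Real.exp_le_exp.2 ?_
          have h1 : 0 ≤ Real.pi * (a + n) ^ 2 := by have := Real.pi_pos; positivity
          nlinarith

lemma unaryR_eventuallyEq (a b w : ℝ) {τ : ℂ} (hτ : 0 < τ.im) :
    (fun z : ℂ => ∑' n : ℤ, unaryLeft (a + n) b w z.re * unaryRight (a + n) w z.im)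
      =ᶠ[nhds τ] unaryR a b := by
  filter_upwards [(isOpen_lt continuous_const continuous_im).mem_nhds hτ] with z hz
  exact tsum_congr fun n => (unaryTerm_eq_mul a b w hz n).symm

lemma analyticAt_unaryR (a b : ℝ) {τ : ℂ} (hτ : 0 < τ.im) : AnalyticAt ℝ (unaryR a b) τ :=
  ((separatedSeries_unary a b hτ).analyticAt (τ := τ)
    (show ((τ.re : ℂ)).im < _ by rw [ofReal_im]; positivity)
    (show _ < ((τ.im : ℂ)).re by rw [ofReal_re]; linarith)).congr
    (unaryR_eventuallyEq a b _ hτ)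

/-- The conjugate of the `τ̄`-derivative of the unary series, up to the factor `y^{-1/2}`. -/
def unaryShadowTerm (a b : ℝ) (τ : ℂ) (n : ℤ) : ℂ :=
  I / Real.sqrt 2 * (a + n) * exp (Real.pi * I * (a + n) ^ 2 * τ + 2 * Real.pi * I * (a + n) * b)

/-- The exponential is holomorphic in τ, so only the derivative of β survives. It is Gaussian and
turns the exponential into a conjugate; sign(ν)|ν| = ν removes the sign. -/
lemma dTauBar_unary_summand (ν b w : ℝ) {τ : ℂ} (hτ : 0 < τ.im) :
    (deriv (unaryLeft ν b w) τ.re * unaryRight ν w τ.im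
      + I * (unaryLeft ν b w τ.re * deriv (unaryRight ν w) τ.im)) / 2
    = ((Real.sqrt τ.im)⁻¹ : ℝ) * conj (I / Real.sqrt 2 * ν *
        exp (Real.pi * I * ν ^ 2 * τ + 2 * Real.pi * I * ν * b)) := by
  have hs : 0 < Real.sqrt τ.im := Real.sqrt_pos.2 hτ
  have dl : HasDerivAt (unaryLeft ν b w) (-Real.pi * I * ν ^ 2 * unaryLeft ν b w τ.re) τ.re := by
    have h := ((((hasDerivAt_id (τ.re : ℂ)).const_mul (-Real.pi * I * ν ^ 2 : ℂ)).sub_const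
      (2 * Real.pi * I * ν * b : ℂ)).cexp).mul_const (Real.exp (-w * ν ^ 2) : ℂ)
    refine h.congr_deriv ?_
    simp only [unaryLeft, id]
    ring
  have hslit : (τ.im : ℂ) ∈ slitPlane := Or.inl (by simpa using hτ)
  have dsq : HasDerivAt Complex.sqrt (1 / (2 * Real.sqrt τ.im : ℂ)) τ.im := by
    refine (hasDerivAt_sqrt hslit).congr_deriv ?_
    rw [neg_div, cpow_neg, show (1 / 2 : ℂ) = 2⁻¹ by norm_num]
    change (Complex.sqrt τ.im)⁻¹ / 2 = _
    rw [sqrt_ofReal_complex hτ.le]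
    field_simp
  have hc : (Real.sqrt 2 * |ν| * Complex.sqrt τ.im : ℂ)
      = ((Real.sqrt 2 * |ν| * Real.sqrt τ.im : ℝ) : ℂ) := by
    rw [sqrt_ofReal_complex hτ.le]; push_cast; ring
  have hc2 : (Real.sqrt 2 * |ν| * Real.sqrt τ.im) ^ 2 = 2 * ν ^ 2 * τ.im := by
    rw [mul_pow, mul_pow, Real.sq_sqrt zero_le_two, Real.sq_sqrt hτ.le, sq_abs]
  set W : ℂ := ((Real.exp (w * ν ^ 2) : ℝ) : ℂ) with hW
  set E : ℂ := exp (Real.pi * ν ^ 2 * τ.im) with hE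
  set G : ℂ := ((Real.exp (-Real.pi * (2 * ν ^ 2 * τ.im)) : ℝ) : ℂ) with hG
  set L := unaryLeft ν b w τ.re with hL
  set e : ℂ := erfcC (Real.sqrt 2 * |ν| * Complex.sqrt τ.im) with he
  have dr : HasDerivAt (unaryRight ν w) (Real.sign ν * (-2 * G * (Real.sqrt 2 * |ν| *
      (1 / (2 * Real.sqrt τ.im)))) * (E * W) + Real.sign ν * e * (Real.pi * ν ^ 2 * E * W))
      τ.im := by
    have d1 : HasDerivAt (fun z => erfcC (Real.sqrt 2 * |ν| * Complex.sqrt z))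
        (-2 * G * (Real.sqrt 2 * |ν| * (1 / (2 * Real.sqrt τ.im)))) τ.im := by
      have h1 := hasDerivAt_erfcC (Real.sqrt 2 * |ν| * Real.sqrt τ.im)
      rw [← hc, hc2] at h1
      refine (h1.comp (τ.im : ℂ) (dsq.const_mul (Real.sqrt 2 * |ν| : ℂ))).congr_deriv ?_
      rw [hG]
      push_cast
      ring
    have d2 := (((hasDerivAt_id (τ.im : ℂ)).const_mul (Real.pi * ν ^ 2 : ℂ)).cexp).mul_const W
    refine ((d1.const_mul (Real.sign ν : ℂ)).mul d2).congr_deriv ?_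
    simp only [id, ← hE, ← he]
    ring
  have hR : unaryRight ν w τ.im = Real.sign ν * e * (E * W) := rfl
  have hsg : (Real.sign ν : ℂ) * |ν| = ν := by exact_mod_cast real_sign_mul_abs ν
  have hprod : conj (exp (Real.pi * I * ν ^ 2 * τ + 2 * Real.pi * I * ν * b)) = L * W * E * G := by
    rw [← exp_conj, hL, unaryLeft, hW, hE, hG, ofReal_exp, ofReal_exp, ofReal_exp, ← exp_add,
      ← exp_add, ← exp_add, ← exp_add]
    congr 1
    have hcj : conj τ = τ.re - τ.im * I := by
      nth_rewrite 1 [← re_add_im τ]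
      rw [map_add, map_mul, conj_ofReal, conj_ofReal, conj_I]; ring
    simp only [map_add, map_mul, map_pow, conj_ofReal, conj_I, hcj, map_ofNat]
    push_cast
    linear_combination (Real.pi * ν ^ 2 * τ.im : ℂ) * I_sq
  have h2 : (Real.sqrt 2 : ℂ) ^ 2 = 2 := by exact_mod_cast Real.sq_sqrt zero_le_two
  have h20 : (Real.sqrt 2 : ℂ) ≠ 0 := by exact_mod_cast (Real.sqrt_pos.2 two_pos).ne'
  have hs0 : (Real.sqrt τ.im : ℂ) ≠ 0 := by exact_mod_cast hs.ne'
  rw [dl.deriv, dr.deriv, hR, map_mul, hprod, map_mul, map_div₀, conj_I, conj_ofReal, conj_ofReal,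
    ofReal_inv]
  field_simp
  linear_combination (-L * G * E * W * Real.sqrt 2 ^ 2) * hsg - L * G * E * W * ν * h2

lemma fderiv_unaryR (a b : ℝ) {τ : ℂ} (hτ : 0 < τ.im) :
    dTauBar (unaryR a b) τ = ((Real.sqrt τ.im)⁻¹ : ℝ) * conj (∑' n, unaryShadowTerm a b τ n) := by
  have hS := separatedSeries_unary a b hτ
  have hU : ((τ.re : ℂ)).im < τ.im / 4 := by rw [ofReal_im]; positivity
  have hV : 3 * τ.im / 4 < ((τ.im : ℂ)).re := by rw [ofReal_re]; linarith
  have h1 := hS.hasSum_fderiv_one (τ := τ) hU hV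
  have h2 := hS.hasSum_fderiv_I (τ := τ) hU hV
  rw [(unaryR_eventuallyEq a b _ hτ).fderiv_eq] at h1 h2
  rw [dTauBar, ← ((h1.add (h2.mul_left I)).div_const 2).tsum_eq, conj_tsum, ← tsum_mul_left]
  refine tsum_congr fun n => ?_
  rw [dTauBar_unary_summand _ _ _ hτ, unaryShadowTerm]
  push_cast
  rfl

lemma norm_unaryShadowTerm_le (a b : ℝ) {τ : ℂ} {c : ℝ} (hc : 0 < c) (hτ : c ≤ τ.im) (n : ℤ) :
    ‖unaryShadowTerm a b τ n‖ ≤ (1 + 2 / (Real.pi * c)) *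
      Real.exp (-(Real.pi * c / 2) * (a + n) ^ 2) := by
  set ν := a + n with hν
  have hn : ‖exp (Real.pi * I * (a + n) ^ 2 * τ + 2 * Real.pi * I * (a + n) * b : ℂ)‖
      = Real.exp (-Real.pi * ν ^ 2 * τ.im) := by
    rw [norm_exp]
    congr 1
    have : (Real.pi * I * (a + n) ^ 2 * τ + 2 * Real.pi * I * (a + n) * b : ℂ)
      = ((Real.pi * ν ^ 2 : ℝ) : ℂ) * (I * τ)
        + ((2 * Real.pi * ν * b : ℝ) : ℂ) * I := by rw [hν]; push_cast; ring
    rw [this, add_re, re_ofReal_mul, re_ofReal_mul, I_re, I_mul_re]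
    ring
  have h2 : ‖(I / Real.sqrt 2 * (a + n) : ℂ)‖ ≤ |ν| := by
    have e : (a + n : ℂ) = (ν : ℂ) := by rw [hν]; push_cast; rfl
    have h1 : 1 ≤ Real.sqrt 2 := Real.one_le_sqrt.2 (by norm_num)
    rw [norm_mul, norm_div, norm_I, norm_real, Real.norm_eq_abs, abs_of_nonneg (by positivity), e,
      norm_real, Real.norm_eq_abs]
    exact mul_le_of_le_one_left (abs_nonneg _) (by rw [div_le_one (by linarith)]; exact h1)
  have hp : 0 < Real.pi * c := mul_pos Real.pi_pos hc
  have h3 : |ν| ≤ (1 + 2 / (Real.pi * c)) * Real.exp (Real.pi * c / 2 * ν ^ 2) := by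
    have h4 : Real.pi * c / 2 * ν ^ 2 + 1 ≤ Real.exp (Real.pi * c / 2 * ν ^ 2) :=
      Real.add_one_le_exp _
    have h5 : |ν| ≤ 1 + ν ^ 2 := by nlinarith [sq_abs ν, sq_nonneg (|ν| - 1), abs_nonneg ν]
    have h6 : ν ^ 2 = 2 / (Real.pi * c) * (Real.pi * c / 2 * ν ^ 2) := by field_simp
    have h7 : 0 ≤ 2 / (Real.pi * c) := by positivity
    have h8 : 0 ≤ Real.pi * c / 2 * ν ^ 2 := by positivity
    nlinarith [mul_le_mul_of_nonneg_left h4 h7]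
  rw [unaryShadowTerm, norm_mul, hn]
  calc _ ≤ (1 + 2 / (Real.pi * c)) * Real.exp (Real.pi * c / 2 * ν ^ 2)
        * Real.exp (-Real.pi * ν ^ 2 * τ.im) := by
        gcongr; exact h2.trans h3
    _ ≤ _ := by
        rw [mul_assoc, ← Real.exp_add]
        refine mul_le_mul_of_nonneg_left (Real.exp_le_exp.2 ?_) (by positivity)
        have : 0 ≤ Real.pi * ν ^ 2 := by have := Real.pi_pos; positivity
        nlinarith

lemma isOpen_upperHalf : IsOpen {τ : ℂ | 0 < τ.im} := isOpen_lt continuous_const continuous_im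

lemma differentiableOn_unaryShadow (a b : ℝ) :
    DifferentiableOn ℂ (fun τ => ∑' n, unaryShadowTerm a b τ n) {τ : ℂ | 0 < τ.im} := by
  intro τ hτ
  have hτ : 0 < τ.im := hτ
  have h := differentiableOn_tsum_of_summable_norm
    ((summable_exp_shifted_one (c := Real.pi * (τ.im / 2) / 2)
      (by have := Real.pi_pos; positivity) a).mul_left (1 + 2 / (Real.pi * (τ.im / 2))))
    (F := fun (n : ℤ) z => unaryShadowTerm a b z n) (U := {z : ℂ | τ.im / 2 < z.im})
    (fun n => by unfold unaryShadowTerm; fun_prop)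
    (isOpen_lt continuous_const continuous_im)
    (fun n z hz => norm_unaryShadowTerm_le a b (by positivity) (le_of_lt hz) n)
  exact (h.differentiableAt ((isOpen_lt continuous_const continuous_im).mem_nhds
    (show τ.im / 2 < τ.im by linarith))).differentiableWithinAt

/-! ### The weight one half Casimir operator -/

/-- `f` is real analytic and its `τ̄`-derivative is `y^{-1/2}` times an antiholomorphic function. -/
structure IsHalfHarmonic (f : ℂ → ℂ) : Prop where
  analytic : AnalyticOnNhd ℝ f {τ : ℂ | 0 < τ.im}
  exists_shadow : ∃ g : ℂ → ℂ, DifferentiableOn ℂ g {τ : ℂ | 0 < τ.im} ∧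
    ∀ τ : ℂ, 0 < τ.im → dTauBar f τ = ((Real.sqrt τ.im)⁻¹ : ℝ) * conj (g τ)

lemma isHalfHarmonic_unaryR (a b : ℝ) : IsHalfHarmonic (unaryR a b) :=
  ⟨fun _ hτ => analyticAt_unaryR a b hτ, _, differentiableOn_unaryShadow a b,
    fun _ hτ => fderiv_unaryR a b hτ⟩

namespace IsHalfHarmonic

variable {f g : ℂ → ℂ}

lemma differentiableAt (hf : IsHalfHarmonic f) {τ : ℂ} (hτ : 0 < τ.im) :
    DifferentiableAt ℝ f τ := (hf.analytic τ hτ).differentiableAt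

lemma add (hf : IsHalfHarmonic f) (hg : IsHalfHarmonic g) : IsHalfHarmonic (fun τ => f τ + g τ) := by
  obtain ⟨u, hu, hu'⟩ := hf.exists_shadow
  obtain ⟨v, hv, hv'⟩ := hg.exists_shadow
  refine ⟨hf.analytic.add hg.analytic, fun τ => u τ + v τ, hu.add hv, fun τ hτ => ?_⟩
  have h := fderiv_fun_add (hf.differentiableAt hτ) (hg.differentiableAt hτ)
  have h1 := hu' τ hτ
  have h2 := hv' τ hτ
  rw [dTauBar] at h1 h2 ⊢
  rw [h, map_add, mul_add, ← h1, ← h2]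
  simp only [_root_.add_apply]
  ring

lemma const_mul (hf : IsHalfHarmonic f) (c : ℂ) : IsHalfHarmonic (fun τ => c * f τ) := by
  obtain ⟨u, hu, hu'⟩ := hf.exists_shadow
  refine ⟨analyticOnNhd_const.mul hf.analytic, fun τ => conj c * u τ, hu.const_mul _,
    fun τ hτ => ?_⟩
  have h := fderiv_const_mul (hf.differentiableAt hτ) c
  have h1 := hu' τ hτ
  rw [dTauBar] at h1 ⊢
  rw [h, map_mul, conj_conj, mul_left_comm, ← h1]
  simp only [_root_.smul_apply, smul_eq_mul]
  ring

lemma comp_mul (hf : IsHalfHarmonic f) {r : ℝ} (hr : 0 < r) :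
    IsHalfHarmonic (fun τ => f (r * τ)) := by
  obtain ⟨u, hu, hu'⟩ := hf.exists_shadow
  have hmem : ∀ τ : ℂ, 0 < τ.im → 0 < ((r : ℂ) * τ).im := fun τ hτ => by
    rw [im_ofReal_mul]; positivity
  refine ⟨fun τ hτ => ?_, fun τ => Real.sqrt r * u (r * τ), ?_, fun τ hτ => ?_⟩
  · exact (hf.analytic _ (hmem τ hτ)).comp (analyticAt_const.mul analyticAt_id)
  · exact (hu.comp (by fun_prop) fun τ hτ => hmem τ hτ).const_mul _
  · have h1 := hu' _ (hmem τ hτ)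
    have hL : HasFDerivAt (fun τ : ℂ => (r : ℂ) * τ) ((r : ℂ) • ContinuousLinearMap.id ℝ ℂ) τ :=
      (hasFDerivAt_id τ).const_mul (r : ℂ)
    have h := ((hf.differentiableAt (hmem τ hτ)).hasFDerivAt.comp τ hL).fderiv
    have e : ∀ v : ℂ, fderiv ℝ (fun τ => f (r * τ)) τ v = r * fderiv ℝ f (r * τ) v := fun v => by
      refine (DFunLike.congr_fun h v).trans ?_
      simp only [ContinuousLinearMap.comp_apply, _root_.smul_apply,
        ContinuousLinearMap.id_apply, smul_eq_mul]
      exact (congrArg _ real_smul.symm).trans ((map_smul (fderiv ℝ f (r * τ)) r v).trans real_smul)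
    rw [dTauBar] at h1 ⊢
    rw [e, e, map_mul, conj_ofReal]
    have h2 : (r : ℂ) * ((Real.sqrt (r * τ.im))⁻¹ : ℝ)
        = ((Real.sqrt τ.im)⁻¹ : ℝ) * Real.sqrt r := by
      rw [← ofReal_mul, ← ofReal_mul, Real.sqrt_mul hr.le]
      congr 1
      have := Real.sqrt_pos.2 hr
      have := Real.sqrt_pos.2 hτ
      field_simp
      rw [Real.sq_sqrt hr.le]
    rw [im_ofReal_mul] at h1
    calc _ = r * ((fderiv ℝ f (r * τ) 1 + I * fderiv ℝ f (r * τ) I) / 2) := by ring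
      _ = _ := by rw [h1, ← mul_assoc, h2, mul_assoc]

lemma congr (hf : IsHalfHarmonic f) (h : ∀ τ : ℂ, 0 < τ.im → f τ = g τ) : IsHalfHarmonic g := by
  obtain ⟨u, hu, hu'⟩ := hf.exists_shadow
  have he : ∀ τ : ℂ, 0 < τ.im → f =ᶠ[nhds τ] g := fun τ hτ => by
    filter_upwards [isOpen_upperHalf.mem_nhds hτ] with z hz using h z hz
  refine ⟨fun τ hτ => (hf.analytic τ hτ).congr (he τ hτ), u, hu, fun τ hτ => ?_⟩
  rw [← hu' τ hτ, dTauBar, dTauBar, (he τ hτ).fderiv_eq]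

end IsHalfHarmonic

lemma fderiv_apply_I_of_differentiableAt {f : ℂ → ℂ} {τ : ℂ} (hf : DifferentiableAt ℂ f τ) :
    fderiv ℝ f τ I = I * fderiv ℝ f τ 1 := by
  rw [hf.fderiv_restrictScalars ℝ]
  simp

lemma isHalfHarmonic_of_differentiableOn {f : ℂ → ℂ}
    (hf : DifferentiableOn ℂ f {τ : ℂ | 0 < τ.im}) : IsHalfHarmonic f := by
  refine ⟨fun τ hτ => (hf.analyticAt (isOpen_upperHalf.mem_nhds hτ)).restrictScalars, fun _ => 0,
    differentiableOn_const _, fun τ hτ => ?_⟩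
  rw [dTauBar, fderiv_apply_I_of_differentiableAt (hf.differentiableAt
    (isOpen_upperHalf.mem_nhds hτ)), map_zero, mul_zero, ← mul_assoc, I_mul_I]
  ring

/-- The antiholomorphic factor is constant for ∂/∂τ, and ∂y^{-1/2}/∂τ = (i/4)y^{-3/2}, so
-4y²∂²/∂τ∂τ̄ and iy∂/∂τ̄ cancel. -/
lemma IsHalfHarmonic.casimirHalf_eq {f : ℂ → ℂ} (hf : IsHalfHarmonic f) {τ : ℂ} (hτ : 0 < τ.im) :
    casimirHalf f τ = 3 / 16 * f τ := by
  obtain ⟨g, hg, hg'⟩ := hf.exists_shadow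
  have hs : 0 < Real.sqrt τ.im := Real.sqrt_pos.2 hτ
  have he : dTauBar f =ᶠ[nhds τ] fun z => (((Real.sqrt z.im)⁻¹ : ℝ) : ℂ) * conj (g z) := by
    filter_upwards [isOpen_upperHalf.mem_nhds hτ] with z hz using hg' z hz
  have hgd := hg.differentiableAt (isOpen_upperHalf.mem_nhds hτ)
  have dg : HasFDerivAt (fun z => conj (g z)) (conjCLE.toContinuousLinearMap.comp (fderiv ℝ g τ)) τ :=
    conjCLE.toContinuousLinearMap.hasFDerivAt.comp τ (hgd.restrictScalars ℝ).hasFDerivAt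
  have dr : HasDerivAt (fun y : ℝ => (Real.sqrt y)⁻¹)
      (-(1 / (2 * Real.sqrt τ.im)) / Real.sqrt τ.im ^ 2) τ.im :=
    (Real.hasDerivAt_sqrt hτ.ne').inv hs.ne'
  have dy : HasFDerivAt (fun z : ℂ => (((Real.sqrt z.im)⁻¹ : ℝ) : ℂ))
      (ofRealCLM.comp ((-(1 / (2 * Real.sqrt τ.im)) / Real.sqrt τ.im ^ 2) • imCLM)) τ :=
    ofRealCLM.hasFDerivAt.comp τ (dr.comp_hasFDerivAt τ imCLM.hasFDerivAt)
  have hd : fderiv ℝ (fun z : ℂ => (((Real.sqrt z.im)⁻¹ : ℝ) : ℂ) * conj (g z)) τ = _ :=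
    (dy.mul dg).fderiv
  have hI := fderiv_apply_I_of_differentiableAt hgd
  have hs0 : (Real.sqrt τ.im : ℂ) ≠ 0 := by exact_mod_cast hs.ne'
  have hsq : (Real.sqrt τ.im : ℂ) ^ 2 = τ.im := by exact_mod_cast Real.sq_sqrt hτ.le
  have e : dTau (dTauBar f) τ = I / 4 * (Real.sqrt τ.im : ℂ)⁻¹ ^ 3 * conj (g τ) := by
    rw [dTau, he.fderiv_eq, hd]
    simp [hI]
    field_simp
    linear_combination (Real.sqrt τ.im ^ 2 * 8 * conj (fderiv ℝ g τ 1)) * I_sq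
  rw [casimirHalf, e, hg' τ hτ, ← hsq]
  push_cast
  field_simp
  ring

end

end MockTheta

namespace MockTheta

noncomputable section

open Complex MeasureTheory Set Filter

open scoped ComplexConjugate

/-! ### Holomorphy of the seventh order functions -/

lemma norm_qPow (x : ℝ) (τ : ℂ) : ‖qPow x τ‖ = Real.exp (-(2 * Real.pi * x * τ.im)) := by
  rw [qPow, norm_exp]
  congr 1
  rw [show (2 * Real.pi * I * x * τ : ℂ) = ((2 * Real.pi * x : ℝ) : ℂ) * (I * τ) by
    push_cast; ring, re_ofReal_mul, I_mul_re]
  ring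

/-- With nonnegative exponents the norm of each term decreases as Im τ grows, so the series at one
height dominates it at all larger heights. -/
lemma hickerson_exponent_nonneg {k : ℤ} (h0 : 0 < k) (h1 : k ≤ 5) {r s : ℤ}
    (h : quadrantSign r s ≠ 0) :
    0 ≤ (3 * r ^ 2 + 8 * r * s + 3 * s ^ 2 + k * (r + s)) / 2 := by
  refine Int.ediv_nonneg ?_ zero_le_two
  by_cases hp : 0 ≤ r ∧ 0 ≤ s
  · obtain ⟨hr, hs⟩ := hp
    positivity
  · by_cases hn : r < 0 ∧ s < 0
    · obtain ⟨hr, hs⟩ := hn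
      nlinarith [mul_nonneg (show 0 ≤ -r - 1 by omega) (show 0 ≤ -s - 1 by omega),
        sq_nonneg (r + 1), sq_nonneg (s + 1), mul_nonneg (show 0 ≤ 5 - k by omega)
          (show 0 ≤ -(r + s) by omega)]
    · simp [quadrantSign, hp, hn] at h

lemma norm_hickersonTerm_le {k : ℤ} (h0 : 0 < k) (h1 : k ≤ 5) {c : ℤ} (hc : 0 ≤ c) {τ σ : ℂ}
    (hτσ : σ.im ≤ τ.im) (p : ℤ × ℤ) :
    ‖hickersonTerm k c (qPow 1 τ) p‖ ≤ ‖hickersonTerm k c (qPow 1 σ) p‖ := by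
  rw [hickersonTerm, hickersonTerm, norm_mul, norm_mul _ (qPow 1 σ ^ _)]
  by_cases h : quadrantSign p.1 p.2 = 0
  · simp [h]
  · refine mul_le_mul_of_nonneg_left ?_ (norm_nonneg _)
    have hN := add_nonneg (hickerson_exponent_nonneg h0 h1 h) hc
    have hN' : (0 : ℝ) ≤ ((3 * p.1 ^ 2 + 8 * p.1 * p.2 + 3 * p.2 ^ 2 + k * (p.1 + p.2)) / 2 + c : ℤ) :=
      by exact_mod_cast hN
    rw [qPow_one_zpow, qPow_one_zpow, norm_qPow, norm_qPow]
    refine Real.exp_le_exp.2 (neg_le_neg (mul_le_mul_of_nonneg_left hτσ ?_))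
    have := Real.pi_pos
    positivity

lemma differentiableOn_hickerson {k : ℤ} (hk : Odd k) (h0 : 0 < k) (h1 : k ≤ 5) {c : ℤ}
    (hc : 0 ≤ c) :
    DifferentiableOn ℂ (fun τ => ∑' p, hickersonTerm k c (qPow 1 τ) p) {τ : ℂ | 0 < τ.im} := by
  intro τ hτ
  have hτ : 0 < τ.im := hτ
  have hU : IsOpen {z : ℂ | τ.im / 2 < z.im} := isOpen_lt continuous_const continuous_im
  have hs := (summable_hickersonTerm hk h0 (by omega) c (τ := τ.im / 2 * I)
    (by simpa using hτ)).norm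
  have h := differentiableOn_tsum_of_summable_norm hs
    (F := fun p z => hickersonTerm k c (qPow 1 z) p) (U := {z : ℂ | τ.im / 2 < z.im})
    (fun p => by
      unfold hickersonTerm
      simp only [qPow_one_zpow]
      unfold qPow
      fun_prop) hU
    (fun p z hz => norm_hickersonTerm_le h0 h1 hc (by
      have : τ.im / 2 < z.im := hz
      simpa using this.le) p)
  exact (h.differentiableAt (hU.mem_nhds
    (show τ.im / 2 < τ.im by linarith))).differentiableWithinAt

lemma differentiableOn_qPow_mul_div (a : ℝ) {S : ℂ → ℂ}
    (hS : DifferentiableOn ℂ S {τ : ℂ | 0 < τ.im}) :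
    DifferentiableOn ℂ (fun τ => qPow a τ * (S τ / qInfinity (qPow 1 τ))) {τ : ℂ | 0 < τ.im} := by
  simp_rw [qPow_mul_div_qInfinity a (a + 1 / 24) rfl]
  refine DifferentiableOn.div (DifferentiableOn.mul (by unfold qPow; fun_prop) hS)
    (fun τ hτ => ?_) fun τ hτ => eta_ne_zero hτ
  exact (ModularForm.differentiableAt_eta_of_mem_upperHalfPlaneSet hτ).differentiableWithinAt

lemma differentiableOn_F7 (j : Fin 3) :
    DifferentiableOn ℂ (fun τ => F7 τ j) {τ : ℂ | 0 < τ.im} := by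
  fin_cases j
  · exact differentiableOn_qPow_mul_div _
      (differentiableOn_hickerson (by decide) (by norm_num) (by norm_num) le_rfl)
  · exact differentiableOn_qPow_mul_div _
      (differentiableOn_hickerson (by decide) (by norm_num) (by norm_num) le_rfl)
  · exact differentiableOn_qPow_mul_div _
      (differentiableOn_hickerson (by decide) (by norm_num) (by norm_num) zero_le_one)

lemma isHalfHarmonic_G7 (j : Fin 3) : IsHalfHarmonic (fun τ => G7 τ j) := by
  have h : ∀ c d a b a' b', IsHalfHarmonic (fun τ =>
      -(c * unaryR a b (21 * τ) + d * unaryR a' b' (21 * τ))) := fun c d a b a' b' => by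
    have h1 := ((isHalfHarmonic_unaryR a b).comp_mul (r := 21) (by norm_num)).const_mul c
    have h2 := ((isHalfHarmonic_unaryR a' b').comp_mul (r := 21) (by norm_num)).const_mul d
    refine ((h1.add h2).const_mul (-1)).congr fun τ _ => ?_
    push_cast
    ring
  fin_cases j
  · exact h _ _ _ _ _ _
  · exact h _ _ _ _ _ _
  · exact h _ _ _ _ _ _

/-- Through H₇ = F₇ - G₇, a holomorphic function minus unary series, which avoids differentiating
the indefinite theta series. -/
lemma isHalfHarmonic_H7 (j : Fin 3) : IsHalfHarmonic (fun τ => H7 τ j) := by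
  refine ((isHalfHarmonic_of_differentiableOn (differentiableOn_F7 j)).add
    ((isHalfHarmonic_G7 j).const_mul (-1))).congr fun τ hτ => ?_
  rw [F7_eq_H7_add_G7 hτ, Pi.add_apply]
  ring

/-! ### Nonvanishing -/

lemma tendsto_qInfinity : Tendsto qInfinity (nhds 0) (nhds 1) := by
  have h := tendsto_tprod_one_add_of_dominated_convergence (𝓕 := nhds 0) (g := 0)
    (f := fun (q : ℂ) (n : ℕ) => -q ^ (n + 1)) (bound := fun n => (1 / 2 : ℝ) ^ (n + 1))
  simp only [norm_neg, norm_pow, Pi.zero_apply, add_zero, tprod_one] at h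
  refine (h ?_ ?_ ?_).congr fun q => ?_
  · simpa only [pow_succ'] using (summable_geometric_of_abs_lt_one (by norm_num)).mul_left _
  · intro n
    have : Continuous fun q : ℂ => -q ^ (n + 1) := by fun_prop
    simpa using this.tendsto 0
  · filter_upwards [Metric.ball_mem_nhds (0 : ℂ) (show (0 : ℝ) < 1 / 2 by norm_num)] with q hq n
    have : ‖q‖ < 1 / 2 := by simpa using hq
    gcongr
  · simp only [qInfinity, sub_eq_add_neg]

lemma tendsto_qPow_mul_I {x : ℝ} (hx : 0 < x) :
    Tendsto (fun y : ℝ => qPow x (y * I)) atTop (nhds 0) := by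
  rw [tendsto_zero_iff_norm_tendsto_zero]
  have h : ∀ y : ℝ, ‖qPow x (y * I)‖ = Real.exp (-(2 * Real.pi * x * y)) := fun y => by
    rw [norm_qPow]; simp
  simp_rw [h]
  refine Real.tendsto_exp_neg_atTop_nhds_zero.comp ?_
  exact tendsto_id.const_mul_atTop (by have := Real.pi_pos; positivity)

lemma tendsto_hickerson_one :
    Tendsto (fun y : ℝ => ∑' p, hickersonTerm 1 0 (qPow 1 (y * I)) p) atTop (nhds 1) := by
  have hlim : ∀ p : ℤ × ℤ, Tendsto (fun y : ℝ => hickersonTerm 1 0 (qPow 1 (y * I)) p) atTop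
      (nhds (if p = 0 then 1 else 0)) := by
    rintro ⟨r, s⟩
    split_ifs with hp
    · obtain ⟨rfl, rfl⟩ := Prod.mk.injEq .. ▸ hp
      simp [hickersonTerm, quadrantSign]
    · by_cases h : quadrantSign r s = 0
      · simp [hickersonTerm, h]
      · have hpos : 0 < (3 * r ^ 2 + 8 * r * s + 3 * s ^ 2 + 1 * (r + s)) / 2 + 0 := by
          rw [add_zero]
          refine Int.lt_of_add_one_le (Int.le_ediv_of_mul_le two_pos ?_)
          have hp' : r ≠ 0 ∨ s ≠ 0 := by
            by_contra! h'
            exact hp (Prod.ext h'.1 h'.2)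
          by_cases h1 : 0 ≤ r ∧ 0 ≤ s
          · obtain ⟨hr, hs⟩ := h1
            have : 1 ≤ r + s := by omega
            nlinarith [mul_nonneg hr hs, sq_nonneg (r - s), mul_self_nonneg (r + s - 1)]
          · by_cases h2 : r < 0 ∧ s < 0
            · obtain ⟨hr, hs⟩ := h2
              nlinarith [mul_nonneg (show 0 ≤ -r - 1 by omega) (show 0 ≤ -s - 1 by omega),
                sq_nonneg (r + 1), sq_nonneg (s + 1)]
            · simp [quadrantSign, h1, h2] at h
        have hpos' : (0 : ℝ) < ((3 * r ^ 2 + 8 * r * s + 3 * s ^ 2 + 1 * (r + s)) / 2 + 0 : ℤ) := by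
          exact_mod_cast hpos
        simp only [hickersonTerm, qPow_one_zpow]
        simpa using (tendsto_qPow_mul_I hpos').const_mul (quadrantSign r s * (-1) ^ (r + s))
  have hs := (summable_hickersonTerm (k := 1) (by decide) (by norm_num) (by norm_num) 0 (τ := I)
    (by simp)).norm
  have := tendsto_tsum_of_dominated_convergence hs hlim (by
    filter_upwards [eventually_ge_atTop 1] with y hy p
    exact norm_hickersonTerm_le (by norm_num) (by norm_num) le_rfl (by simpa using hy) p)
  simpa using this

lemma norm_unaryR_le (a b : ℝ) {τ : ℂ} (hτ : 1 ≤ τ.im) :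
    ‖unaryR a b τ‖ ≤ ∑' n : ℤ, Real.exp (-Real.pi * (a + n) ^ 2) := by
  refine tsum_of_norm_bounded (summable_exp_shifted_one Real.pi_pos a).hasSum fun n =>
    (norm_unaryTerm_le a b (zero_le_one.trans hτ) n).trans (Real.exp_le_exp.2 ?_)
  have : 0 ≤ Real.pi * (a + n) ^ 2 := by have := Real.pi_pos; positivity
  nlinarith

/-- If H₇ vanished, boundedness of the first entry of G₇ for y ≥ 1 would force Hickerson's sum for
𝓕₀ to be O(q^{1/168}) on the imaginary axis, while it tends to its constant term 1. -/
lemma exists_H7_ne_zero : ∃ τ : ℂ, 0 < τ.im ∧ H7 τ ≠ 0 := by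
  by_contra! hcon
  set C := ‖zeta 84 ^ (-13 : ℤ)‖ * (∑' n : ℤ, Real.exp (-Real.pi * (13 / 42 + n) ^ 2))
    + ‖zeta 84‖ * ∑' n : ℤ, Real.exp (-Real.pi * (41 / 42 + n) ^ 2) with hC
  have hG : ∀ y : ℝ, 1 ≤ y → ‖G7 (y * I) 0‖ ≤ C := fun y hy => by
    have him : 1 ≤ (21 * (y * I) : ℂ).im := by simp; linarith
    have e : G7 (y * I) 0 = -(zeta 84 ^ (-13 : ℤ) * unaryR (13 / 42) (-1 / 2) (21 * (y * I))
        + zeta 84 * unaryR (41 / 42) (-1 / 2) (21 * (y * I))) := rfl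
    rw [e, norm_neg, hC]
    refine (norm_add_le _ _).trans ?_
    rw [norm_mul, norm_mul]
    gcongr
    · exact norm_unaryR_le _ _ him
    · exact norm_unaryR_le _ _ him
  have hF : ∀ y : ℝ, 1 ≤ y → qPow (-1 / 168) (y * I)
      * (∑' p, hickersonTerm 1 0 (qPow 1 (y * I)) p) =
        G7 (y * I) 0 * qInfinity (qPow 1 (y * I)) := fun y hy => by
    have him : 0 < (y * I : ℂ).im := by simp; linarith
    have h := congrFun (F7_eq_H7_add_G7 him) 0
    rw [hcon _ him, zero_add] at h
    have hq : qInfinity (qPow 1 (y * I)) ≠ 0 := fun h0 => by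
      have := eta_ne_zero him
      rw [eta_eq, h0, mul_zero] at this
      exact this rfl
    rw [← h]
    change _ = qPow (-1 / 168) (y * I) * ((∑' p, hickersonTerm 1 0 (qPow 1 (y * I)) p)
      / qInfinity (qPow 1 (y * I))) * _
    field_simp
  have hq0 : Tendsto (fun y : ℝ => qInfinity (qPow 1 (y * I)) * qPow (1 / 168) (y * I))
      atTop (nhds 0) := by
    simpa using (tendsto_qInfinity.comp (tendsto_qPow_mul_I one_pos)).mul
      (tendsto_qPow_mul_I (x := 1 / 168) (by norm_num))
  have hS : Tendsto (fun y : ℝ => ∑' p, hickersonTerm 1 0 (qPow 1 (y * I)) p) atTop (nhds 0) := by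
    have hb : Tendsto (fun y : ℝ => C * ‖qInfinity (qPow 1 (y * I)) * qPow (1 / 168) (y * I)‖)
        atTop (nhds 0) := by
      simpa only [norm_zero, mul_zero] using hq0.norm.const_mul C
    refine squeeze_zero_norm' ?_ hb
    filter_upwards [eventually_ge_atTop 1] with y hy
    have h1 : qPow (1 / 168) (y * I) * qPow (-1 / 168) (y * I) = 1 := by
      rw [← qPow_add]; norm_num [qPow]
    have h2 : ∑' p, hickersonTerm 1 0 (qPow 1 (y * I)) p
        = G7 (y * I) 0 * (qInfinity (qPow 1 (y * I)) * qPow (1 / 168) (y * I)) := by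
      linear_combination (-∑' p, hickersonTerm 1 0 (qPow 1 (y * I)) p) * h1
        + qPow (1 / 168) (y * I) * hF y hy
    rw [h2, norm_mul]
    exact mul_le_mul_of_nonneg_right (hG y hy) (norm_nonneg _)
  exact one_ne_zero (tendsto_nhds_unique tendsto_hickerson_one hS)

end

end MockTheta

namespace MockTheta

noncomputable section

open Complex MeasureTheory Set Filter

/-! ### Boundedness of the unary series near rational points -/

/-- Both points of the m-th difference lie in [m, m+1], so it is at most h(m) - h(m+1), and these
telescope. -/
lemma abs_sum_range_sub_le {h : ℝ → ℝ} (hh : AntitoneOn h (Ici 0)) (h0 : ∀ x, 0 ≤ h x) {c : ℝ}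
    (hc0 : 0 ≤ c) (hc1 : c ≤ 1) (M : ℕ) :
    ‖∑ m ∈ Finset.range M, (h (m + c) - h (m + 1 - c))‖ ≤ h 0 := by
  have key : ∀ m : ℕ, ‖h (m + c) - h (m + 1 - c)‖ ≤ h m - h (m + 1) := fun m => by
    have hm : (0 : ℝ) ≤ m := m.cast_nonneg
    have a1 : h (m + c) ≤ h m := hh hm (by simp only [mem_Ici]; positivity) (by linarith)
    have a2 : h (m + 1) ≤ h (m + c) :=
      hh (by simp only [mem_Ici]; positivity) (by simp only [mem_Ici]; positivity) (by linarith)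
    have a3 : h (m + 1 - c) ≤ h m := hh hm (by simp only [mem_Ici]; linarith) (by linarith)
    have a4 : h (m + 1) ≤ h (m + 1 - c) :=
      hh (by simp only [mem_Ici]; linarith) (by simp only [mem_Ici]; positivity) (by linarith)
    exact abs_le.2 ⟨by linarith, by linarith⟩
  have tel : ∑ m ∈ Finset.range M, (h m - h (m + 1)) = h 0 - h M := by
    have := Finset.sum_range_sub' (fun m : ℕ => h m) M
    simpa using this
  calc _ ≤ ∑ m ∈ Finset.range M, (h m - h (m + 1)) := norm_sum_le_of_le _ fun m _ => key m
    _ ≤ h 0 := by rw [tel]; linarith [h0 M]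

/-- After reduction to the fractional part d of c, the terms m and -(m+1) have opposite signs and
arguments m + d and m + 1 - d. -/
lemma norm_tsum_sign_mul_le {h : ℝ → ℝ} (hh : AntitoneOn h (Ici 0)) (h0 : ∀ x, 0 ≤ h x)
    {c : ℝ} (hc : ∀ n : ℤ, c ≠ n) (hs : Summable fun m : ℤ => Real.sign (c + m) * h |c + m|) :
    ‖∑' m : ℤ, Real.sign (c + m) * h |c + m|‖ ≤ h 0 := by
  set d := Int.fract c with hd
  have hd0 : 0 < d := (Int.fract_nonneg c).lt_of_ne fun h => hc ⌊c⌋ (by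
    linarith [Int.floor_add_fract c])
  have hd1 : d < 1 := Int.fract_lt_one c
  have hcd : ∀ m : ℤ, c + m = d + ((m + ⌊c⌋ : ℤ) : ℝ) := fun m => by
    push_cast; rw [hd]; linarith [Int.floor_add_fract c]
  have hs' : Summable fun m : ℤ => Real.sign (d + m) * h |d + m| := by
    refine (Equiv.addRight ⌊c⌋).summable_iff.1 (hs.congr fun m => ?_)
    simp only [Function.comp_apply, Equiv.coe_addRight, ← hcd]
  have ht : ∑' m : ℤ, Real.sign (c + m) * h |c + m| = ∑' m : ℤ, Real.sign (d + m) * h |d + m| := by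
    rw [← (Equiv.addRight ⌊c⌋).tsum_eq fun m : ℤ => Real.sign (d + m) * h |d + m|]
    exact tsum_congr fun m => by rw [hcd m, Equiv.coe_addRight]
  have hnat := hs'.hasSum.nat_add_neg_add_one
  rw [ht]
  refine le_of_tendsto hnat.tendsto_sum_nat.norm (.of_forall fun M => ?_)
  refine le_trans (le_of_eq ?_) (abs_sum_range_sub_le hh h0 hd0.le hd1.le M)
  refine congrArg _ (Finset.sum_congr rfl fun m _ => ?_)
  have hm : (0 : ℝ) ≤ m := m.cast_nonneg
  have p1 : 0 < d + ((m : ℤ) : ℝ) := by push_cast; linarith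
  have p2 : d + ((-((m : ℤ) + 1) : ℤ) : ℝ) < 0 := by push_cast; linarith
  rw [Real.sign_of_pos p1, abs_of_pos p1, Real.sign_of_neg p2, abs_of_neg p2]
  push_cast
  rw [show (m : ℝ) + d = d + m by ring, show (m : ℝ) + 1 - d = -(d + (-1 + -m)) by ring]
  ring_nf

/-- On a vertical line the term splits into a real amplitude and a phase independent of t. -/
lemma unaryTerm_vertical (a b ξ : ℝ) {t : ℝ} (ht : 0 < t) (n : ℤ) :
    unaryTerm a b (ξ + t * I) n =
      ((Real.sign (a + n) * betaWeighted (|a + n| * Real.sqrt t) : ℝ) : ℂ) *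
        ex (-(a + n) ^ 2 * ξ / 2 - (a + n) * b) := by
  have him : (ξ + t * I : ℂ).im = t := by simp
  have h1 : (|a + n| * Real.sqrt t) ^ 2 = (a + n) ^ 2 * t := by
    rw [mul_pow, sq_abs, Real.sq_sqrt ht.le]
  have h2 : exp (-Real.pi * I * ((a + n : ℝ) : ℂ) ^ 2 * (ξ + t * I)
        - 2 * Real.pi * I * ((a + n : ℝ) : ℂ) * b)
      = (Real.exp (Real.pi * ((a + n) ^ 2 * t)) : ℂ) * ex (-(a + n) ^ 2 * ξ / 2 - (a + n) * b) := by
    rw [ex, ofReal_exp, ← exp_add]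
    congr 1
    push_cast
    linear_combination (-Real.pi * (a + n : ℂ) ^ 2 * t) * I_sq
  rw [unaryTerm, him, betaWeighted, h1, h2, show 2 * (a + n) ^ 2 * t = 2 * ((a + n) ^ 2 * t) by ring]
  simp only [ofReal_mul]
  ring

/-- For rational data the phase is periodic in n with some period N. Each of the N residue classes
contributes at most `betaWeighted 0` = 1, so N itself is a bound for every t > 0. -/
lemma exists_norm_unaryR_vertical_le (a b ξ : ℚ) (ha : ∀ n : ℤ, a ≠ n) :
    ∃ C : ℝ, ∀ t : ℝ, 0 < t → ‖unaryR a b (ξ + t * I)‖ ≤ C := by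
  -- Replacing ν by ν + Nm changes the phase by -νNmξ - N²m²ξ/2 - Nmb; Nξ is taken even because of
  -- the halved square.
  obtain ⟨N, hN, ka, kx, kb, hNa, hNx, hNb⟩ : ∃ N : ℕ, N ≠ 0 ∧ ∃ ka kx kb : ℤ,
      (N : ℝ) * a * ξ = ka ∧ (N : ℝ) * ξ = 2 * kx ∧ (N : ℝ) * b = kb := by
    refine ⟨2 * (a.den * ξ.den * b.den), by positivity, 2 * (a.num * ξ.num * b.den),
      a.den * ξ.num * b.den, 2 * (a.den * ξ.den * b.num), ?_, ?_, ?_⟩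
    all_goals
      have e1 : (a.den : ℝ) * a = a.num := by exact_mod_cast a.den_mul_eq_num
      have e2 : (ξ.den : ℝ) * ξ = ξ.num := by exact_mod_cast ξ.den_mul_eq_num
      have e3 : (b.den : ℝ) * b = b.num := by exact_mod_cast b.den_mul_eq_num
      push_cast
    · rw [← e1, ← e2]; ring
    · rw [← e2]; ring
    · rw [← e3]; ring
  have : NeZero N := ⟨hN⟩
  have hN0 : (0 : ℝ) < N := by positivity
  refine ⟨N, fun t ht => ?_⟩
  have him : 0 < ((ξ : ℝ) + t * I : ℂ).im := by simpa using ht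
  have hsum := summable_unaryTerm a b him
  have hcast : ((ξ : ℂ)) = ((ξ : ℝ) : ℂ) := by push_cast; rfl
  rw [hcast, unaryR, tsum_int_eq_sum_fin N hsum]
  refine (norm_sum_le_of_le (s := Finset.univ) (f := _) (n := fun _ => (1 : ℝ)) fun j _ => ?_).trans
    (by simp)
  set h : ℝ → ℝ := fun x => betaWeighted (N * x * Real.sqrt t) with hh
  set c : ℝ := (a + (j : ℕ)) / N with hc
  have hterm : ∀ m : ℤ, unaryTerm a b ((ξ : ℝ) + t * I) (N * m + (j : ℕ)) =
      ((Real.sign (c + m) * h |c + m| : ℝ) : ℂ) *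
        ex (-(a + (j : ℕ)) ^ 2 * ξ / 2 - (a + (j : ℕ)) * b) := fun m => by
    have e : (a : ℝ) + ((N * m + (j : ℕ) : ℤ) : ℝ) = N * (c + m) := by
      rw [hc]; push_cast; field_simp; ring
    have e1 : Real.sign (N * (c + m)) = Real.sign (c + m) := by
      rcases lt_trichotomy (c + m) 0 with hx | hx | hx
      · rw [Real.sign_of_neg hx, Real.sign_of_neg (by nlinarith)]
      · rw [hx, mul_zero]
      · rw [Real.sign_of_pos hx, Real.sign_of_pos (by positivity)]
    rw [unaryTerm_vertical _ _ _ ht, e, e1, abs_mul, abs_of_pos hN0, ← e]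
    congr 1
    refine ex_eq_of_sub_eq (n := -(ka * m + m * (j : ℕ) * (2 * kx) + N * kx * m ^ 2 + kb * m)) ?_
    push_cast
    linear_combination (-m : ℝ) * hNa - (m * (j : ℕ) + N * m ^ 2 / 2 : ℝ) * hNx - m * hNb
  have hs1 : Summable fun m : ℤ => unaryTerm a b ((ξ : ℝ) + t * I) (N * m + (j : ℕ)) :=
    hsum.comp_injective (i := fun m : ℤ => N * m + (j : ℕ)) fun m m' hm => by
      simpa [hN] using hm
  simp_rw [hterm] at hs1
  have hs2 : Summable fun m : ℤ => Real.sign (c + m) * h |c + m| := by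
    rw [summable_mul_right_iff (ex_ne_zero _)] at hs1
    exact_mod_cast hs1
  simp_rw [hterm]
  rw [tsum_mul_right, norm_mul, norm_ex, mul_one, ← ofReal_tsum, norm_real]
  refine (norm_tsum_sign_mul_le (h := h) ?_ (fun x => betaWeighted_nonneg _) ?_ hs2).trans ?_
  · intro x hx y hy hxy
    have hx : 0 ≤ x := hx
    have hy : 0 ≤ y := hy
    exact betaWeighted_antitoneOn (by simp only [mem_Ici]; positivity)
      (by simp only [mem_Ici]; positivity) (by gcongr)
  · intro n hn
    rw [hc, div_eq_iff hN0.ne'] at hn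
    refine ha (n * N - (j : ℕ)) ?_
    have : (a : ℝ) = ((n * N - (j : ℕ) : ℤ) : ℝ) := by push_cast; linarith
    exact_mod_cast this
  · simp [hh, betaWeighted_zero]

lemma exists_norm_G7_vertical_le (ξ : ℚ) : ∃ C : ℝ, ∀ t : ℝ, 0 < t → ‖G7 (ξ + t * I)‖ ≤ C := by
  have h : ∀ a b : ℚ, (a.den ≠ 1) → ∃ C : ℝ, ∀ t : ℝ, 0 < t →
      ‖unaryR a b (21 * (ξ + t * I))‖ ≤ C := fun a b ha => by
    obtain ⟨C, hC⟩ := exists_norm_unaryR_vertical_le a b (21 * ξ) fun n hn => ha (by simp [hn])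
    refine ⟨C, fun t ht => ?_⟩
    have := hC (21 * t) (by positivity)
    push_cast at this
    rwa [mul_assoc (21 : ℂ) (t : ℂ) I, ← mul_add] at this
  have h' : ∀ (a b a' b' : ℚ) (c d : ℂ), a.den ≠ 1 → a'.den ≠ 1 → ∃ C : ℝ, ∀ t : ℝ, 0 < t →
      ‖-(c * unaryR a b (21 * (ξ + t * I)) + d * unaryR a' b' (21 * (ξ + t * I)))‖ ≤ C :=
    fun a b a' b' c d ha ha' => by
      obtain ⟨C, hC⟩ := h a b ha
      obtain ⟨C', hC'⟩ := h a' b' ha'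
      refine ⟨‖c‖ * C + ‖d‖ * C', fun t ht => ?_⟩
      rw [norm_neg]
      refine (norm_add_le _ _).trans ?_
      rw [norm_mul, norm_mul]
      gcongr
      · exact hC t ht
      · exact hC' t ht
  have hd : ∀ k : ℕ, k ∈ [13, 41, 11, 25, 23, 37] → ((k : ℚ) / 42).den ≠ 1 := fun k hk => by
    fin_cases hk <;> norm_num
  obtain ⟨C₀, h₀⟩ := h' (13 / 42) (-1 / 2) (41 / 42) (-1 / 2) (zeta 84 ^ (-13 : ℤ)) (zeta 84)
    (hd 13 (by simp)) (hd 41 (by simp))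
  obtain ⟨C₁, h₁⟩ := h' (11 / 42) (-5 / 2) (25 / 42) (-5 / 2) (zeta 84 ^ (29 : ℤ))
    (zeta 84 ^ (-41 : ℤ)) (hd 11 (by simp)) (hd 25 (by simp))
  obtain ⟨C₂, h₂⟩ := h' (23 / 42) (-3 / 2) (37 / 42) (-3 / 2) (zeta 28 ^ (5 : ℤ))
    (zeta 28 ^ (-9 : ℤ)) (hd 23 (by simp)) (hd 37 (by simp))
  refine ⟨max C₀ (max C₁ C₂), fun t ht => ?_⟩
  have n0 := h₀ t ht
  have n1 := h₁ t ht
  have n2 := h₂ t ht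
  push_cast at n0 n1 n2
  refine (pi_norm_le_iff_of_nonneg ((norm_nonneg _).trans (n0.trans (le_max_left _ _)))).2 fun j => ?_
  fin_cases j
  · exact n0.trans (le_max_left _ _)
  · exact n1.trans ((le_max_left _ _).trans (le_max_right _ _))
  · exact n2.trans ((le_max_right _ _).trans (le_max_right _ _))

end

end MockTheta

/-! ### Assembly of the proposition. -/

theorem mainTheorem3 :
    -- all the series in the definitions converge absolutely
    (∀ τ : ℂ, 0 < τ.im →
      Summable (MockTheta.hickersonTerm 1 0 (MockTheta.qPow 1 τ)) ∧
      Summable (MockTheta.hickersonTerm 3 0 (MockTheta.qPow 1 τ)) ∧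
      Summable (MockTheta.hickersonTerm 5 1 (MockTheta.qPow 1 τ)) ∧
      (∀ a b : Fin 2 → ℝ, Summable
        (MockTheta.indefThetaTerm MockTheta.A7 MockTheta.c71 MockTheta.c72 a b τ)) ∧
      (∀ a b : ℝ, Summable (MockTheta.unaryTerm a b τ))) ∧
    -- the decomposition
    (∀ τ : ℂ, 0 < τ.im → MockTheta.F7 τ = MockTheta.H7 τ + MockTheta.G7 τ) ∧
    -- the properties of the first summand
    MockTheta.IsRealAnalyticModularForm (1 / 2) MockTheta.H7 ∧
    (∀ τ : ℂ, 0 < τ.im → MockTheta.H7 (τ + 1) = MockTheta.T7.mulVec (MockTheta.H7 τ)) ∧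
    (∀ τ : ℂ, 0 < τ.im →
      MockTheta.H7 (-1 / τ) =
        (-Complex.I * τ) ^ (1 / 2 : ℂ) • MockTheta.M7.mulVec (MockTheta.H7 τ)) ∧
    MockTheta.IsCasimirHalfEigenfunction MockTheta.H7 (3 / 16) ∧
    -- the second summand is bounded as the argument tends vertically to a rational number
    (∀ ξ : ℚ, ∃ C : ℝ, ∀ᶠ t : ℝ in nhdsWithin 0 (Set.Ioi 0),
      ‖MockTheta.G7 ((ξ : ℂ) + t * Complex.I)‖ ≤ C) := by
  refine ⟨fun τ hτ => ⟨MockTheta.summable_hickersonTerm (by decide) (by norm_num) (by norm_num) 0 hτ,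
      MockTheta.summable_hickersonTerm (by decide) (by norm_num) (by norm_num) 0 hτ,
      MockTheta.summable_hickersonTerm (by decide) (by norm_num) (by norm_num) 1 hτ,
      fun a b => MockTheta.summable_indefThetaTerm a b hτ,
      fun a b => MockTheta.summable_unaryTerm a b hτ⟩,
    fun τ hτ => MockTheta.F7_eq_H7_add_G7 hτ,
    ⟨AnalyticOnNhd.pi fun j => (MockTheta.isHalfHarmonic_H7 j).analytic, MockTheta.H7_modular⟩,
    fun τ _ => MockTheta.H7_add_one τ, fun τ hτ => MockTheta.H7_neg_one_div hτ,
    ⟨MockTheta.exists_H7_ne_zero,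
      fun τ hτ j => (MockTheta.isHalfHarmonic_H7 j).casimirHalf_eq hτ⟩, fun ξ => ?_⟩
  obtain ⟨C, hC⟩ := MockTheta.exists_norm_G7_vertical_le ξ
  exact ⟨C, by filter_upwards [self_mem_nhdsWithin] with t ht using hC t ht⟩
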